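/- Let $r$ be a natural number and let $G=(V,E)$ be a finite simple graph of width at most $r$: there is a partition of $V$ into nonempty bags of size at most $r$, and a rooted tree whose nodes are the bags, such that every edge of $G$ lies inside a bag or joins a vertex of a bag to a vertex of its parent bag (such a partition together with the tree is called a decomposition of $G$; its width is its largest bag size). Let $c,l:E\to\mathbb R_{\ge 0}$ be edge capacities and edge lengths, and let $d_G$ be the shortest-path distance of $G$ with respect to $l$. Then there is a set $E'\subseteq E$ such that every connected component of $(V,E\setminus E')$ has diameter strictly less than $1$ with respect to $d_G$ (a small diameter decomposition), and $$\sum_{e\in E'}c(e)\;\le\;136\,\ln(r+1)\sum_{e\in E}c(e)\,l(e).$$ Moreover, such a set can be constructed in polynomial time: there is an algorithm which, given $G$, a decomposition of $G$ of width $r$, $c$ and $l$, outputs such a set $E'$, and which uses a number of steps (arithmetic operations and comparisons of real numbers, and elementary operations on integers charged by binary length) polynomial in the size of $G$; on rational $c$ and $l$ the same algorithm runs in time polynomial in the binary length of the input, where each operation is charged by the binary length of the numbers involved. -/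

import Mathlib

open scoped ENNReal

universe u

namespace SmallDiam

/-! ### Weighted graphs and small diameter decompositions

Capacities and lengths are functions on `Sym2 V`; only their values on the edges of the
graph are ever used. -/

section Graphs

/-- The length of a shortest `u`-`v` path of `G` with respect to the edge lengths `l`
(`⊤` if there is no such path).  For nonnegative lengths walks and paths give the same value. -/
noncomputable def dist {V : Type*} (G : SimpleGraph V) (l : Sym2 V → ℝ) (u v : V) : ℝ≥0∞ :=
  ⨅ p : G.Walk u v, ENNReal.ofReal (p.edges.map l).sum

/-- The weak diameter of a set of vertices: distances are measured in the whole graph `G`. -/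
noncomputable def weakDiam {V : Type*} (G : SimpleGraph V) (l : Sym2 V → ℝ) (S : Set V) : ℝ≥0∞ :=
  ⨆ u ∈ S, ⨆ v ∈ S, dist G l u v

/-- `E'` is a set of edges of `G` and every component of `(V, E \ E')` has diameter
strictly less than `1` with respect to the distance of `G`. -/
def IsSmallDiameterDecomposition {V : Type*} (G : SimpleGraph V) (l : Sym2 V → ℝ)
    (E' : Finset (Sym2 V)) : Prop :=
  (E' : Set (Sym2 V)) ⊆ G.edgeSet ∧
    ∀ C : (G.deleteEdges (E' : Set (Sym2 V))).ConnectedComponent, weakDiam G l C.supp < 1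

open Classical in
/-- The sum of `f e` over all edges `e` of `G`. -/
noncomputable def edgeSum {V M : Type*} [Fintype V] [AddCommMonoid M] (G : SimpleGraph V)
    (f : Sym2 V → M) : M :=
  ∑ e ∈ G.edgeFinset, f e

/-- A partition of the vertices of `G` into nonempty bags indexed by `ι`, the bags being the
nodes of a rooted tree, such that every edge lies inside a bag or joins a bag to its parent.
The rooted tree is given by its parent function, with the convention that the root is its own
parent; every node reaches the root by going to the parent repeatedly. -/
structure TreePartition {V : Type*} (G : SimpleGraph V) (ι : Type*) where
  bag : V → ι
  bag_surjective : Function.Surjective bag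
  root : ι
  parent : ι → ι
  parent_root : parent root = root
  reaches_root : ∀ i, ∃ k : ℕ, parent^[k] i = root
  edge_mem : ∀ u v, G.Adj u v →
    bag u = bag v ∨ parent (bag u) = bag v ∨ parent (bag v) = bag u

open Classical in
/-- The largest size of a bag. -/
noncomputable def TreePartition.width {V ι : Type*} [Fintype V] [Fintype ι] {G : SimpleGraph V}
    (D : TreePartition G ι) : ℕ :=
  Finset.univ.sup fun i : ι => (Finset.univ.filter fun v : V => D.bag v = i).card

/-- `G` is a graph of width at most `r`. -/
def HasWidthAtMost {V : Type*} [Fintype V] (G : SimpleGraph V) (r : ℕ) : Prop :=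
  ∃ (m : ℕ) (D : TreePartition G (Fin m)), D.width ≤ r

end Graphs

/-! ### A random access machine with natural numbers and real numbers

Programs are while-programs over two-dimensional arrays of natural numbers and of real numbers
(a variable is the entry `(0, 0)` of an array).  The arrays are named by fixed numerals of the
program; their indices are computed.  The only operations on real numbers are the
four arithmetic operations, comparison, and conversion of a natural number. -/

section Machine

/-- The memory. -/
structure State where
  nat : ℕ → ℕ → ℕ → ℕ
  val : ℕ → ℕ → ℕ → ℝ

/-- Write `k` into entry `(i, j)` of the natural number array `A`. -/
def State.setNat (s : State) (A i j k : ℕ) : State where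
  nat := fun A' i' j' => if A' = A ∧ i' = i ∧ j' = j then k else s.nat A' i' j'
  val := s.val

/-- Write `x` into entry `(i, j)` of the real number array `A`. -/
noncomputable def State.setVal (s : State) (A i j : ℕ) (x : ℝ) : State where
  nat := s.nat
  val := fun A' i' j' => if A' = A ∧ i' = i ∧ j' = j then x else s.val A' i' j'

/-- Expressions for natural numbers. -/
inductive NExp : Type
  | lit (k : ℕ)
  | get (A : ℕ) (i j : NExp)
  | add (a b : NExp)
  | sub (a b : NExp)
  | mul (a b : NExp)

/-- Expressions for real numbers. -/
inductive VExp : Type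
  | ofNat (a : NExp)
  | get (A : ℕ) (i j : NExp)
  | add (x y : VExp)
  | sub (x y : VExp)
  | mul (x y : VExp)
  | div (x y : VExp)

/-- Tests. -/
inductive Cond : Type
  | le (a b : NExp)
  | vle (x y : VExp)
  | not (p : Cond)
  | and (p q : Cond)

/-- Programs. -/
inductive Program : Type
  | skip
  | setNat (A : ℕ) (i j e : NExp)
  | setVal (A : ℕ) (i j : NExp) (e : VExp)
  | seq (P Q : Program)
  | ite (p : Cond) (P Q : Program)
  | while (p : Cond) (P : Program)

def NExp.eval (s : State) : NExp → ℕ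
  | .lit k => k
  | .get A i j => s.nat A (i.eval s) (j.eval s)
  | .add a b => a.eval s + b.eval s
  | .sub a b => a.eval s - b.eval s
  | .mul a b => a.eval s * b.eval s

noncomputable def VExp.eval (s : State) : VExp → ℝ
  | .ofNat a => (a.eval s : ℝ)
  | .get A i j => s.val A (i.eval s) (j.eval s)
  | .add x y => x.eval s + y.eval s
  | .sub x y => x.eval s - y.eval s
  | .mul x y => x.eval s * y.eval s
  | .div x y => x.eval s / y.eval s

def Cond.holds (s : State) : Cond → Prop
  | .le a b => a.eval s ≤ b.eval s
  | .vle x y => x.eval s ≤ y.eval s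
  | .not p => ¬ p.holds s
  | .and p q => p.holds s ∧ q.holds s

/-! Evaluation costs.  Each operation costs one plus the size of its result, so that the size of
every operand and of every address is charged as well.  The size of a natural number is its
number of binary digits; the size of a real number is a parameter of the cost model. -/

def NExp.cost (s : State) : NExp → ℕ
  | .lit k => 1 + Nat.size k
  | .get A i j => i.cost s + j.cost s + 1 + Nat.size ((NExp.get A i j).eval s)
  | .add a b => a.cost s + b.cost s + 1 + Nat.size ((NExp.add a b).eval s)
  | .sub a b => a.cost s + b.cost s + 1 + Nat.size ((NExp.sub a b).eval s)
  | .mul a b => a.cost s + b.cost s + 1 + Nat.size ((NExp.mul a b).eval s)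

noncomputable def VExp.cost (size : ℝ → ℕ) (s : State) : VExp → ℕ
  | .ofNat a => a.cost s + 1 + size ((VExp.ofNat a).eval s)
  | .get A i j => i.cost s + j.cost s + 1 + size ((VExp.get A i j).eval s)
  | .add x y => x.cost size s + y.cost size s + 1 + size ((VExp.add x y).eval s)
  | .sub x y => x.cost size s + y.cost size s + 1 + size ((VExp.sub x y).eval s)
  | .mul x y => x.cost size s + y.cost size s + 1 + size ((VExp.mul x y).eval s)
  | .div x y => x.cost size s + y.cost size s + 1 + size ((VExp.div x y).eval s)

noncomputable def Cond.cost (size : ℝ → ℕ) (s : State) : Cond → ℕ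
  | .le a b => a.cost s + b.cost s + 1
  | .vle x y => x.cost size s + y.cost size s + 1
  | .not p => p.cost size s + 1
  | .and p q => p.cost size s + q.cost size s + 1

/-- `Exec size P s t s'`: started in memory `s`, the program `P` halts after total cost `t`
with memory `s'`. -/
inductive Exec (size : ℝ → ℕ) : Program → State → ℕ → State → Prop
  | skip (s : State) : Exec size .skip s 1 s
  | setNat (s : State) (A : ℕ) (i j e : NExp) :
      Exec size (.setNat A i j e) s (i.cost s + j.cost s + e.cost s + 1)
        (s.setNat A (i.eval s) (j.eval s) (e.eval s))
  | setVal (s : State) (A : ℕ) (i j : NExp) (e : VExp) :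
      Exec size (.setVal A i j e) s (i.cost s + j.cost s + e.cost size s + 1)
        (s.setVal A (i.eval s) (j.eval s) (e.eval s))
  | seq {P Q : Program} {s s' s'' : State} {t t' : ℕ} :
      Exec size P s t s' → Exec size Q s' t' s'' → Exec size (.seq P Q) s (t + t') s''
  | ite_true {p : Cond} {P Q : Program} {s s' : State} {t : ℕ} :
      p.holds s → Exec size P s t s' → Exec size (.ite p P Q) s (p.cost size s + 1 + t) s'
  | ite_false {p : Cond} {P Q : Program} {s s' : State} {t : ℕ} :
      ¬ p.holds s → Exec size Q s t s' → Exec size (.ite p P Q) s (p.cost size s + 1 + t) s'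
  | while_true {p : Cond} {P : Program} {s s' s'' : State} {t t' : ℕ} :
      p.holds s → Exec size P s t s' → Exec size (.while p P) s' t' s'' →
        Exec size (.while p P) s (p.cost size s + 1 + t + t') s''
  | while_false {p : Cond} {P : Program} {s : State} :
      ¬ p.holds s → Exec size (.while p P) s (p.cost size s + 1) s

/-- The size of real numbers in the arithmetic model: every number has size one. -/
def unitSize (_ : ℝ) : ℕ := 1

open Classical in
/-- The size of real numbers in the bit model: the binary length of numerator and denominator.
Only rational numbers occur in computations on rational data; irrational numbers get a dummy
value. -/
noncomputable def bitSize (x : ℝ) : ℕ :=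
  if h : ∃ q : ℚ, (q : ℝ) = x then Nat.size h.choose.num.natAbs + Nat.size h.choose.den else 0

end Machine

/-! ### The computational problem -/

section Problem

/-- An instance: a graph, a decomposition of it, edge capacities and edge lengths. -/
structure Instance where
  n : ℕ
  m : ℕ
  G : SimpleGraph (Fin n)
  D : TreePartition G (Fin m)
  c : Sym2 (Fin n) → ℝ
  l : Sym2 (Fin n) → ℝ
  c_nonneg : ∀ e ∈ G.edgeSet, 0 ≤ c e
  l_nonneg : ∀ e ∈ G.edgeSet, 0 ≤ l e

/-- All capacities and lengths are rational numbers. -/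
def Instance.IsRational (I : Instance) : Prop :=
  ∀ e ∈ I.G.edgeSet, (∃ q : ℚ, (q : ℝ) = I.c e) ∧ ∃ q : ℚ, (q : ℝ) = I.l e

/-- The size of the input, up to a polynomial: number of vertices, number of bags, and sizes of
the capacities and lengths of the edges. -/
noncomputable def Instance.inputSize (size : ℝ → ℕ) (I : Instance) : ℕ :=
  I.n + I.m + edgeSum I.G fun e => size (I.c e) + size (I.l e)

open Classical in
/-- The initial memory.  Natural number arrays: `0` holds the number of vertices, `1` the number
of bags, `2` the bag of each vertex, `3` the parent of each bag, `4` the adjacency matrix.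
Real number arrays: `0` holds the matrix of capacities, `1` the matrix of lengths.
Everything else is zero. -/
noncomputable def Instance.input (I : Instance) : State where
  nat := fun A i j =>
    if A = 0 ∧ i = 0 ∧ j = 0 then I.n
    else if A = 1 ∧ i = 0 ∧ j = 0 then I.m
    else if h : A = 2 ∧ i < I.n ∧ j = 0 then (I.D.bag ⟨i, h.2.1⟩ : ℕ)
    else if h : A = 3 ∧ i < I.m ∧ j = 0 then (I.D.parent ⟨i, h.2.1⟩ : ℕ)
    else if h : A = 4 ∧ i < I.n ∧ j < I.n then
      if I.G.Adj ⟨i, h.2.1⟩ ⟨j, h.2.2⟩ then 1 else 0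
    else 0
  val := fun A i j =>
    if h : i < I.n ∧ j < I.n then
      if I.G.Adj ⟨i, h.1⟩ ⟨j, h.2⟩ then
        if A = 0 then I.c s(⟨i, h.1⟩, ⟨j, h.2⟩)
        else if A = 1 then I.l s(⟨i, h.1⟩, ⟨j, h.2⟩)
        else 0
      else 0
    else 0

open Classical in
/-- In memory `s`, the natural number array `5` holds the indicator matrix of a
small diameter decomposition whose cost is within the required bound. -/
def Instance.IsSolution (I : Instance) (s : State) : Prop :=
  ∃ E' : Finset (Sym2 (Fin I.n)),
    IsSmallDiameterDecomposition I.G I.l E' ∧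
    ∑ e ∈ E', I.c e ≤
      136 * Real.log ((I.D.width : ℝ) + 1) * edgeSum I.G (fun e => I.c e * I.l e) ∧
    ∀ u v : Fin I.n, s.nat 5 u v = if s(u, v) ∈ E' then 1 else 0

/-- On each of the given instances the program halts with a solution, at a cost bounded by a
polynomial in the size of the input. -/
def SolvesInPolyTime (size : ℝ → ℕ) (instances : Set Instance) (P : Program) : Prop :=
  ∃ p : Polynomial ℕ, ∀ I ∈ instances, ∃ (t : ℕ) (s : State),
    Exec size P I.input t s ∧ t ≤ p.eval (I.inputSize size) ∧ I.IsSolution s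

end Problem

end SmallDiam

/-! The bags are processed in an order in which parents precede children. When the bag `F` has its
turn, every vertex `x` of `F` that is not yet covered acts as a centre. It covers each uncovered `w`
that it reaches by a walk of length at most `1 / 3` among uncovered vertices, provided that every
earlier region meeting `F` also meets the bag of `w` (`Seed`). The vertices covered at time `t` form
the region of `t`. The side condition makes regions nested (`Hits.nested`), and the bags met by a
region form a subtree below its centre (`Hits.convex`). The level of a region is the number of
regions meeting the bag of its centre. It is at most `r`, because regions are disjoint and each uses
its own vertex of that bag.

The heart is a packing bound. Say that a vertex is charged by a region if it lies at distance less
than `1 / 6` from it, measured among the vertices uncovered at that time. Then a vertex is charged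
by at most two regions of each level (`not_charged_thrice`). With three such regions there is a walk
of length less than `1 / 3` from the first region to a vertex `u` of the third. By
`coveredAt_of_minimal_level`, every centre above `u` that comes after the first region, covers its
own bag in part, and has least level among these covers `u`, if that level is at most the level of
the first region. The second and the third region would both qualify, but `u` is covered only once.
So a vertex is charged by at most `2 r` regions, and by at most `K = 2 r ^ 2` centres
(`charges_le`).

Around the vertices covered by each centre a ball of radius less than `1 / 6` is grown among the
unlabelled vertices, and it becomes a cluster. Every cluster has radius less than `1 / 3 + 1 / 6 = 1
/ 2`. Region growing (`exists_threshold`) yields a radius with `K * cut ≤ 6 * log (1 + K) * (K * vol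
+ tot)`, where `vol` belongs to pairs that leave the unlabelled graph and `tot` to pairs that are
charged. Summed over all balls, the volumes `vol` contribute at most the total volume, and the
volumes `tot` at most `K` times the total volume (`IsClustering.addBall`,
`IsClustering.cutCost_le`). Since `1 + K ≤ (r + 1) ^ 3`, the constant `72` would suffice in place of
`136`.

The algorithm does just this. It avoids logarithms by taking, among the finitely many radii at which
a ball changes, one with the smallest ratio of cut to `K * vol + tot`, compared by
cross-multiplication. It is written with counting loops only, so that a syntactic condition
(`Prg.wf`) gives the running time: `Prg.exec` bounds the entries of the memory by the number of
operations, and `Prg.exists_poly` turns this into a polynomial valid in both cost models. The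
existence statement follows by running the algorithm on an enumeration of the vertices. -/

namespace SmallDiam

/-! ### Structured programs with a denotational semantics -/

section Structured

/-- Programs whose only loops are counting loops; `loop v B P` runs `P` with the variable `v`
counting from `0` up to the value of the variable `B`. -/
inductive Prg : Type
  | skip
  | setNat (A : ℕ) (i j e : NExp)
  | setVal (A : ℕ) (i j : NExp) (e : VExp)
  | seq (P Q : Prg)
  | ite (p : Cond) (P Q : Prg)
  | loop (v B : ℕ) (P : Prg)

/-- The variable `A`. -/
abbrev NExp.var (A : ℕ) : NExp := .get A (.lit 0) (.lit 0)

/-- Add one to the variable `v`. -/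
abbrev incr (v : ℕ) : Program :=
  .setNat v (.lit 0) (.lit 0) (.add (.var v) (.lit 1))

/-- The test `v < B` of a counting loop. -/
abbrev loopTest (v B : ℕ) : Cond := .not (.le (.var B) (.var v))

def Prg.compile : Prg → Program
  | .skip => .skip
  | .setNat A i j e => .setNat A i j e
  | .setVal A i j e => .setVal A i j e
  | .seq P Q => .seq P.compile Q.compile
  | .ite p P Q => .ite p P.compile Q.compile
  | .loop v B P => .seq (.setNat v (.lit 0) (.lit 0) (.lit 0))
      (.while (loopTest v B) (.seq P.compile (incr v)))

/-- The states passed by a counting loop whose body acts as `f`. -/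
noncomputable def iter (f : State → State) (v : ℕ) (s : State) : ℕ → State
  | 0 => s.setNat v 0 0 0
  | j + 1 => (f (iter f v s j)).setNat v 0 0 (j + 1)

open Classical in
/-- The final memory of a structured program. -/
noncomputable def Prg.run : Prg → State → State
  | .skip, s => s
  | .setNat A i j e, s => s.setNat A (i.eval s) (j.eval s) (e.eval s)
  | .setVal A i j e, s => s.setVal A (i.eval s) (j.eval s) (e.eval s)
  | .seq P Q, s => Q.run (P.run s)
  | .ite p P Q, s => if p.holds s then P.run s else Q.run s
  | .loop v B P, s => iter P.run v s (s.nat B 0 0)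

/-- The program may write to the natural number array `A`. -/
def Prg.wN (A : ℕ) : Prg → Bool
  | .skip => false
  | .setNat A' _ _ _ => A' == A
  | .setVal _ _ _ _ => false
  | .seq P Q => P.wN A || Q.wN A
  | .ite _ P Q => P.wN A || Q.wN A
  | .loop v _ P => v == A || P.wN A

/-- The program may write to the real number array `A`. -/
def Prg.wV (A : ℕ) : Prg → Bool
  | .skip => false
  | .setNat _ _ _ _ => false
  | .setVal A' _ _ _ => A' == A
  | .seq P Q => P.wV A || Q.wV A
  | .ite _ P Q => P.wV A || Q.wV A
  | .loop _ _ P => P.wV A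

theorem State.setNat_nat_ne {s : State} {A A' i j k : ℕ} (h : A' ≠ A) :
    (s.setNat A i j k).nat A' = s.nat A' := by
  funext i' j'; simp [State.setNat, h]

theorem State.setVal_val_ne {s : State} {A A' i j : ℕ} {x : ℝ} (h : A' ≠ A) :
    (s.setVal A i j x).val A' = s.val A' := by
  funext i' j'; simp [State.setVal, h]

@[simp] theorem State.setNat_val {s : State} {A i j k : ℕ} : (s.setNat A i j k).val = s.val := rfl

@[simp] theorem State.setVal_nat {s : State} {A i j : ℕ} {x : ℝ} :
    (s.setVal A i j x).nat = s.nat := rfl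

theorem State.setNat_nat {s : State} {A i j k A' i' j' : ℕ} :
    (s.setNat A i j k).nat A' i' j' = if A' = A ∧ i' = i ∧ j' = j then k else s.nat A' i' j' := rfl

theorem State.setVal_val {s : State} {A i j A' i' j' : ℕ} {x : ℝ} :
    (s.setVal A i j x).val A' i' j' = if A' = A ∧ i' = i ∧ j' = j then x else s.val A' i' j' := rfl

theorem Prg.run_nat {A : ℕ} : ∀ {P : Prg} (s : State), P.wN A = false →
    (P.run s).nat A = s.nat A := by
  intro P
  induction P with
  | skip => intro s _; rfl
  | setNat A' i j e =>
    intro s h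
    simp only [Prg.wN, beq_eq_false_iff_ne] at h
    exact State.setNat_nat_ne (Ne.symm h)
  | setVal A' i j e => intro s _; rfl
  | seq P Q hP hQ =>
    intro s h
    simp only [Prg.wN, Bool.or_eq_false_iff] at h
    simp only [Prg.run, hQ _ h.2, hP _ h.1]
  | ite p P Q hP hQ =>
    intro s h
    simp only [Prg.wN, Bool.or_eq_false_iff] at h
    simp only [Prg.run]
    split
    · exact hP _ h.1
    · exact hQ _ h.2
  | loop v B P hP =>
    intro s h
    simp only [Prg.wN, Bool.or_eq_false_iff, beq_eq_false_iff_ne] at h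
    simp only [Prg.run]
    generalize s.nat B 0 0 = k
    induction k with
    | zero => exact State.setNat_nat_ne (Ne.symm h.1)
    | succ k ih => rw [iter, State.setNat_nat_ne (Ne.symm h.1), hP _ h.2, ih]

theorem Prg.run_val {A : ℕ} : ∀ {P : Prg} (s : State), P.wV A = false →
    (P.run s).val A = s.val A := by
  intro P
  induction P with
  | skip => intro s _; rfl
  | setNat A' i j e => intro s _; rfl
  | setVal A' i j e =>
    intro s h
    simp only [Prg.wV, beq_eq_false_iff_ne] at h
    exact State.setVal_val_ne (Ne.symm h)
  | seq P Q hP hQ =>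
    intro s h
    simp only [Prg.wV, Bool.or_eq_false_iff] at h
    simp only [Prg.run, hQ _ h.2, hP _ h.1]
  | ite p P Q hP hQ =>
    intro s h
    simp only [Prg.wV, Bool.or_eq_false_iff] at h
    simp only [Prg.run]
    split
    · exact hP _ h.1
    · exact hQ _ h.2
  | loop v B P hP =>
    intro s h
    simp only [Prg.wV] at h
    simp only [Prg.run]
    generalize s.nat B 0 0 = k
    induction k with
    | zero => rfl
    | succ k ih => rw [iter, State.setNat_val, hP _ h, ih]

theorem iter_nat {f : State → State} {v A : ℕ} {s : State} (hv : A ≠ v)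
    (hf : ∀ s, (f s).nat A = s.nat A) (k : ℕ) : (iter f v s k).nat A = s.nat A := by
  induction k with
  | zero => exact State.setNat_nat_ne hv
  | succ k ih => rw [iter, State.setNat_nat_ne hv, hf, ih]

theorem iter_val {f : State → State} {v A : ℕ} {s : State}
    (hf : ∀ s, (f s).val A = s.val A) (k : ℕ) : (iter f v s k).val A = s.val A := by
  induction k with
  | zero => rfl
  | succ k ih => rw [iter, State.setNat_val, hf, ih]

theorem iter_var {f : State → State} {v : ℕ} {s : State} (k : ℕ) :
    (iter f v s k).nat v 0 0 = k := by
  cases k <;> simp [iter, State.setNat]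

/-- The invariant rule for counting loops; arrays that are not written keep their contents. -/
theorem Prg.loop_rule {v B : ℕ} {P : Prg} {s : State} (Inv : ℕ → State → Prop)
    (h0 : Inv 0 (s.setNat v 0 0 0))
    (hs : ∀ j < s.nat B 0 0, ∀ s' : State,
      (∀ A, (Prg.loop v B P).wN A = false → s'.nat A = s.nat A) →
      (∀ A, P.wV A = false → s'.val A = s.val A) →
      s'.nat v 0 0 = j → Inv j s' → Inv (j + 1) ((P.run s').setNat v 0 0 (j + 1))) :
    Inv (s.nat B 0 0) ((Prg.loop v B P).run s) := by
  have key : ∀ k ≤ s.nat B 0 0, Inv k (iter P.run v s k) := by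
    intro k
    induction k with
    | zero => intro _; exact h0
    | succ k ih =>
      intro hk
      refine hs k hk _ ?_ ?_ (iter_var k) (ih (Nat.le_of_succ_le hk))
      · intro A hA
        simp only [Prg.wN, Bool.or_eq_false_iff, beq_eq_false_iff_ne] at hA
        exact iter_nat (Ne.symm hA.1) (fun s => Prg.run_nat s hA.2) k
      · intro A hA
        exact iter_val (fun s => Prg.run_val s hA) k
  exact key _ le_rfl

end Structured

/-! ### A syntactic criterion for polynomial running time -/

section Cost

/-- Well-typedness: what is assigned to natural number arrays. -/
def NExp.ok : NExp → Bool
  | .lit k => k ≤ 1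
  | .get _ _ _ => true
  | .add (.get _ _ _) (.lit k) => k ≤ 1
  | _ => false

/-- Well-typedness: what is assigned to real number arrays.  The arrays `0` and `1` are input. -/
def VExp.ok : VExp → Bool
  | .ofNat (.lit k) => k ≤ 1
  | .get _ _ _ => true
  | .add (.get _ _ _) (.get B _ _) => B ≤ 1
  | .add (.get _ _ _) (.mul (.get B _ _) (.get B' _ _)) => B ≤ 1 && B' ≤ 1
  | _ => false

/-- Values in tests are not stored, so tests may multiply freely. Only division would spoil the
control of denominators in the bit model. -/
def VExp.noDiv : VExp → Bool
  | .ofNat _ => true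
  | .get _ _ _ => true
  | .add x y => x.noDiv && y.noDiv
  | .sub x y => x.noDiv && y.noDiv
  | .mul x y => x.noDiv && y.noDiv
  | .div _ _ => false

def Cond.noDiv : Cond → Bool
  | .le _ _ => true
  | .vle x y => x.noDiv && y.noDiv
  | .not p => p.noDiv
  | .and p q => p.noDiv && q.noDiv

/-- Natural number arrays below `5` and real arrays below `2` hold the input and stay untouched.
Loop bounds are the numbers of vertices and of bags only, and the body of a loop cannot write to its
counter, so the number of rounds is known in advance. -/
def Prg.wf : Prg → Bool
  | .skip => true
  | .setNat A _ _ e => 5 ≤ A && e.ok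
  | .setVal A _ _ e => 2 ≤ A && e.ok
  | .seq P Q => P.wf && Q.wf
  | .ite p P Q => p.noDiv && P.wf && Q.wf
  | .loop v B P => 5 ≤ v && B ≤ 1 && !(P.wN v) && P.wf

theorem Prg.wN_of_wf {A : ℕ} (P : Prg) (h : P.wf = true) (hA : A < 5) : P.wN A = false := by
  induction P with
  | skip => rfl
  | setNat A' i j e =>
    simp only [Prg.wf, Bool.and_eq_true, decide_eq_true_eq] at h
    simp only [Prg.wN, beq_eq_false_iff_ne]; omega
  | setVal A' i j e => rfl
  | seq P Q hP hQ =>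
    simp only [Prg.wf, Bool.and_eq_true] at h
    simp only [Prg.wN, hP h.1, hQ h.2, Bool.or_false]
  | ite p P Q hP hQ =>
    simp only [Prg.wf, Bool.and_eq_true] at h
    simp only [Prg.wN, hP h.1.2, hQ h.2, Bool.or_false]
  | loop v B P hP =>
    simp only [Prg.wf, Bool.and_eq_true, decide_eq_true_eq] at h
    simp only [Prg.wN, hP h.2, Bool.or_false, beq_eq_false_iff_ne]; omega

theorem Prg.wV_of_wf {A : ℕ} (P : Prg) (h : P.wf = true) (hA : A < 2) : P.wV A = false := by
  induction P with
  | skip => rfl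
  | setNat A' i j e => rfl
  | setVal A' i j e =>
    simp only [Prg.wf, Bool.and_eq_true, decide_eq_true_eq] at h
    simp only [Prg.wV, beq_eq_false_iff_ne]; omega
  | seq P Q hP hQ =>
    simp only [Prg.wf, Bool.and_eq_true] at h
    simp only [Prg.wV, hP h.1, hQ h.2, Bool.or_false]
  | ite p P Q hP hQ =>
    simp only [Prg.wf, Bool.and_eq_true] at h
    simp only [Prg.wV, hP h.1.2, hQ h.2, Bool.or_false]
  | loop v B P hP =>
    simp only [Prg.wf, Bool.and_eq_true] at h
    simp only [Prg.wV, hP h.2]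

/-- Sizes of expressions and programs. -/
def NExp.wt : NExp → ℕ
  | .lit k => k + 1
  | .get _ i j => i.wt + j.wt + 1
  | .add a b => a.wt + b.wt + 1
  | .sub a b => a.wt + b.wt + 1
  | .mul a b => a.wt + b.wt + 1

def VExp.wt : VExp → ℕ
  | .ofNat a => a.wt + 1
  | .get _ i j => i.wt + j.wt + 1
  | .add x y => x.wt + y.wt + 1
  | .sub x y => x.wt + y.wt + 1
  | .mul x y => x.wt + y.wt + 1
  | .div x y => x.wt + y.wt + 1

def Cond.wt : Cond → ℕ
  | .le a b => a.wt + b.wt + 1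
  | .vle x y => x.wt + y.wt + 1
  | .not p => p.wt + 1
  | .and p q => p.wt + q.wt + 1

/-- The summand `20` pays for the reset, the test and the increment of a loop counter. -/
def Prg.wt : Prg → ℕ
  | .skip => 1
  | .setNat _ i j e => i.wt + j.wt + e.wt + 1
  | .setVal _ i j e => i.wt + j.wt + e.wt + 1
  | .seq P Q => P.wt + Q.wt
  | .ite p P Q => p.wt + P.wt + Q.wt + 1
  | .loop _ _ P => P.wt + 20

/-- A bound for the number of operations, if no loop is longer than `N`. -/
def Prg.steps (N : ℕ) : Prg → ℕ
  | .skip => 1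
  | .setNat _ _ _ _ => 1
  | .setVal _ _ _ _ => 1
  | .seq P Q => P.steps N + Q.steps N
  | .ite _ P Q => 1 + P.steps N + Q.steps N
  | .loop _ _ P => 2 + N * (P.steps N + 2)

/-- A cost model for real numbers: `has d B x` says that `x` has magnitude at most `B` and a
denominator of degree at most `d` in the denominators of the input. -/
structure SizeModel (size : ℝ → ℕ) (q : ℕ) where
  has : ℕ → ℕ → ℝ → Prop
  nat : ∀ k : ℕ, has 0 k k
  mono : ∀ {d d' B B' : ℕ} {x : ℝ}, d ≤ d' → B ≤ B' → has d B x → has d' B' x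
  add : ∀ {d B B' : ℕ} {x y : ℝ}, has d B x → has d B' y → has d (B + B') (x + y)
  sub : ∀ {d B B' : ℕ} {x y : ℝ}, has d B x → has d B' y → has d (B + B') (x - y)
  mul : ∀ {d d' B B' : ℕ} {x y : ℝ}, has d B x → has d' B' y → has (d + d') (B * B') (x * y)
  size_le : ∀ {d B : ℕ} {x : ℝ}, has d B x → size x ≤ 2 * (Nat.size B + d * q + 2)

theorem size_pow_le {Z w : ℕ} (hw : 1 ≤ w) : Nat.size (Z ^ w) ≤ w * Nat.size Z := by
  rw [Nat.size_le, mul_comm, pow_mul]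
  exact Nat.pow_lt_pow_left (Nat.lt_size_self Z) (by omega)

/-- This lets values be bounded by powers of `Z` with the weight as exponent, for sums as well as
for products. -/
theorem pow_add_pow_le {Z : ℕ} (hZ : 2 ≤ Z) (a b : ℕ) : Z ^ a + Z ^ b ≤ Z ^ (a + b + 1) := by
  have ha : Z ^ a ≤ Z ^ (a + b) := Nat.pow_le_pow_right (by omega) (by omega)
  have hb : Z ^ b ≤ Z ^ (a + b) := Nat.pow_le_pow_right (by omega) (by omega)
  calc Z ^ a + Z ^ b ≤ Z ^ (a + b) * 2 := by omega
    _ ≤ Z ^ (a + b) * Z := Nat.mul_le_mul_left _ hZ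
    _ = Z ^ (a + b + 1) := (pow_succ _ _).symm

theorem NExp.one_le_wt (e : NExp) : 1 ≤ e.wt := by cases e <;> simp [NExp.wt]

theorem VExp.one_le_wt (e : VExp) : 1 ≤ e.wt := by cases e <;> simp [VExp.wt]

variable {size : ℝ → ℕ} {q : ℕ}

/-- All entries of the memory are at most `Z`. -/
structure Fit (M : SizeModel size q) (Z : ℕ) (s : State) : Prop where
  two_le : 2 ≤ Z
  nat : ∀ A i j, s.nat A i j ≤ Z
  val : ∀ A i j, M.has 2 Z (s.val A i j)

/-- The cost of handling a number in a memory with entries up to `Z`. -/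
def unitCost (q Z : ℕ) : ℕ := 2 * (Nat.size Z + 2 * q + 2)

variable {M : SizeModel size q} {Z : ℕ} {s : State}

theorem NExp.eval_le (h : Fit M Z s) (e : NExp) : e.eval s ≤ Z ^ e.wt := by
  have hZ := h.two_le
  induction e with
  | lit k =>
    exact (Nat.lt_pow_self (by omega)).le.trans (Nat.pow_le_pow_right (by omega) (Nat.le_succ k))
  | get A i j =>
    exact (h.nat _ _ _).trans (Nat.le_self_pow (by simp [NExp.wt]) Z)
  | add a b ha hb => exact (Nat.add_le_add ha hb).trans (pow_add_pow_le hZ _ _)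
  | sub a b ha hb =>
    exact (Nat.sub_le _ _).trans (ha.trans (Nat.pow_le_pow_right (by omega)
      (by simp only [NExp.wt]; omega)))
  | mul a b ha hb =>
    refine (Nat.mul_le_mul ha hb).trans ?_
    rw [← pow_add]
    exact Nat.pow_le_pow_right (by omega) (Nat.le_succ _)

theorem NExp.cost_le (h : Fit M Z s) (e : NExp) :
    e.cost s ≤ e.wt * (e.wt * unitCost q Z + 1) := by
  have hsize : ∀ e : NExp, Nat.size (e.eval s) ≤ e.wt * unitCost q Z := fun e =>
    ((Nat.size_le_size (e.eval_le h)).trans (size_pow_le e.one_le_wt)).trans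
      (Nat.mul_le_mul_left _ (by unfold unitCost; omega))
  have hbin : ∀ {a b x y k : ℕ}, x ≤ a * (a * unitCost q Z + 1) → y ≤ b * (b * unitCost q Z + 1) →
      k ≤ (a + b + 1) * unitCost q Z →
      x + y + 1 + k ≤ (a + b + 1) * ((a + b + 1) * unitCost q Z + 1) := by
    intro a b x y k hx hy hk
    generalize unitCost q Z = u at *
    nlinarith [Nat.zero_le (a * b * u), Nat.zero_le (a * u), Nat.zero_le (b * u)]
  induction e with
  | lit k =>
    have := hsize (.lit k)
    simp only [NExp.cost, NExp.wt, NExp.eval] at *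
    nlinarith [Nat.zero_le (k * ((k + 1) * unitCost q Z)), Nat.zero_le k]
  | get A i j hi hj => exact hbin hi hj (hsize (.get A i j))
  | add a b hi hj => exact hbin hi hj (hsize (.add a b))
  | sub a b hi hj => exact hbin hi hj (hsize (.sub a b))
  | mul a b hi hj => exact hbin hi hj (hsize (.mul a b))

theorem VExp.has_eval (h : Fit M Z s) (e : VExp) (he : e.noDiv = true) :
    M.has (2 * e.wt) (Z ^ e.wt) (e.eval s) := by
  have hZ := h.two_le
  induction e with
  | ofNat a =>
    exact M.mono (Nat.zero_le _) ((a.eval_le h).trans (Nat.pow_le_pow_right (by omega)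
      (Nat.le_succ _))) (M.nat _)
  | get A i j =>
    exact M.mono (by simp [VExp.wt]) (Nat.le_self_pow (by simp [VExp.wt]) Z) (h.val _ _ _)
  | add x y hx hy =>
    simp only [VExp.noDiv, Bool.and_eq_true] at he
    refine M.mono le_rfl (pow_add_pow_le hZ _ _)
      (M.add (M.mono ?_ le_rfl (hx he.1)) (M.mono ?_ le_rfl (hy he.2))) <;>
    simp only [VExp.wt] <;> omega
  | sub x y hx hy =>
    simp only [VExp.noDiv, Bool.and_eq_true] at he
    refine M.mono le_rfl (pow_add_pow_le hZ _ _)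
      (M.sub (M.mono ?_ le_rfl (hx he.1)) (M.mono ?_ le_rfl (hy he.2))) <;>
    simp only [VExp.wt] <;> omega
  | mul x y hx hy =>
    simp only [VExp.noDiv, Bool.and_eq_true] at he
    refine M.mono ?_ ?_ (M.mul (hx he.1) (hy he.2))
    · simp only [VExp.wt]; omega
    · rw [← pow_add]
      exact Nat.pow_le_pow_right (by omega) (Nat.le_succ _)
  | div x y => simp [VExp.noDiv] at he

theorem VExp.cost_le (h : Fit M Z s) (e : VExp) (he : e.noDiv = true) :
    e.cost size s ≤ e.wt * (e.wt * unitCost q Z + 1) := by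
  have hsize : ∀ e : VExp, e.noDiv = true → size (e.eval s) ≤ e.wt * unitCost q Z := by
    intro e he
    refine (M.size_le (e.has_eval h he)).trans ?_
    have h1 := size_pow_le (Z := Z) e.one_le_wt
    have h2 := e.one_le_wt
    unfold unitCost
    nlinarith
  have hbin : ∀ {a b x y k : ℕ}, x ≤ a * (a * unitCost q Z + 1) → y ≤ b * (b * unitCost q Z + 1) →
      k ≤ (a + b + 1) * unitCost q Z →
      x + y + 1 + k ≤ (a + b + 1) * ((a + b + 1) * unitCost q Z + 1) := by
    intro a b x y k hx hy hk
    generalize unitCost q Z = u at *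
    nlinarith [Nat.zero_le (a * b * u), Nat.zero_le (a * u), Nat.zero_le (b * u)]
  induction e with
  | ofNat a =>
    have h1 := hsize (.ofNat a) he
    have h2 := a.cost_le h
    simp only [VExp.cost, VExp.wt] at *
    generalize unitCost q Z = u at *
    nlinarith [Nat.zero_le (a.wt * u)]
  | get A i j => exact hbin (i.cost_le h) (j.cost_le h) (hsize (.get A i j) he)
  | add a b hi hj =>
    have h1 := he
    simp only [VExp.noDiv, Bool.and_eq_true] at h1
    exact hbin (hi h1.1) (hj h1.2) (hsize _ he)
  | sub a b hi hj =>
    have h1 := he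
    simp only [VExp.noDiv, Bool.and_eq_true] at h1
    exact hbin (hi h1.1) (hj h1.2) (hsize _ he)
  | mul a b hi hj =>
    have h1 := he
    simp only [VExp.noDiv, Bool.and_eq_true] at h1
    exact hbin (hi h1.1) (hj h1.2) (hsize _ he)
  | div x y => simp [VExp.noDiv] at he

theorem Cond.cost_le (h : Fit M Z s) (p : Cond) (hp : p.noDiv = true) :
    p.cost size s ≤ p.wt * (p.wt * unitCost q Z + 1) := by
  have hbin : ∀ {a b x y : ℕ}, x ≤ a * (a * unitCost q Z + 1) → y ≤ b * (b * unitCost q Z + 1) →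
      x + y + 1 ≤ (a + b + 1) * ((a + b + 1) * unitCost q Z + 1) := by
    intro a b x y hx hy
    generalize unitCost q Z = u at *
    nlinarith [Nat.zero_le (a * b * u), Nat.zero_le (a * u), Nat.zero_le (b * u)]
  induction p with
  | le a b => exact hbin (a.cost_le h) (b.cost_le h)
  | vle x y =>
    simp only [Cond.noDiv, Bool.and_eq_true] at hp
    exact hbin (x.cost_le h hp.1) (y.cost_le h hp.2)
  | not p ih =>
    have := ih hp
    simp only [Cond.cost, Cond.wt]
    generalize unitCost q Z = u at *
    nlinarith [Nat.zero_le (p.wt * u)]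
  | and x y hx hy =>
    simp only [Cond.noDiv, Bool.and_eq_true] at hp
    exact hbin (hx hp.1) (hy hp.2)

/-- The entries of the memory after `τ` operations. -/
structure Bdd (M : SizeModel size q) (N X τ : ℕ) (s : State) : Prop where
  nat : ∀ A i j, s.nat A i j ≤ N + 1 + τ
  inp : ∀ A i j, A ≤ 1 → M.has 1 X (s.val A i j)
  val : ∀ A i j, M.has 2 (X * X * (1 + τ)) (s.val A i j)
  bound : ∀ B ≤ 1, s.nat B 0 0 ≤ N

/-- A bound for the entries of the memory after `S` operations. -/
def maxEntry (N X S : ℕ) : ℕ := N + 1 + S + X * X * (1 + S) + 2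

variable {N X τ S : ℕ}

theorem Bdd.fit (h : Bdd M N X τ s) (hS : τ ≤ S) : Fit M (maxEntry N X S) s where
  two_le := by unfold maxEntry; omega
  nat A i j := (h.nat A i j).trans (by unfold maxEntry; omega)
  val A i j := M.mono le_rfl ((Nat.mul_le_mul_left _ (Nat.add_le_add_left hS 1)).trans
    (by unfold maxEntry; omega)) (h.val A i j)

theorem Bdd.mono (h : Bdd M N X τ s) {τ' : ℕ} (hS : τ ≤ τ') : Bdd M N X τ' s where
  nat A i j := (h.nat A i j).trans (by omega)
  inp := h.inp
  val A i j := M.mono le_rfl (Nat.mul_le_mul_left _ (by omega)) (h.val A i j)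
  bound := h.bound

/-- An assignment copies an entry, adds at most one to it, or writes `0` or `1`; hence entries grow
by at most one per operation. -/
theorem NExp.ok_eval_le (h : Bdd M N X τ s) (e : NExp) (he : e.ok = true) :
    e.eval s ≤ N + 1 + (τ + 1) := by
  match e with
  | .lit k => simp [NExp.ok] at he; simp only [NExp.eval]; omega
  | .get A i j => have := h.nat A (i.eval s) (j.eval s); simp only [NExp.eval]; omega
  | .add (.get A i j) (.lit k) =>
    have := h.nat A (i.eval s) (j.eval s)
    simp [NExp.ok] at he; simp only [NExp.eval]; omega

/-- Growth is additive: to a stored number only an input number or a product of two input numbers is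
added. The magnitude rises by at most `X * X`, and the degree of the denominator stays at `2`
because sums do not raise it. -/
theorem VExp.ok_has_eval (h : Bdd M N X τ s) (hX : 1 ≤ X) (e : VExp) (he : e.ok = true) :
    M.has 2 (X * X * (1 + (τ + 1))) (e.eval s) := by
  have hXX : 1 ≤ X * X := Nat.mul_pos hX hX
  have hsplit : X * X * (1 + (τ + 1)) = X * X * (1 + τ) + X * X := by ring
  match e with
  | .ofNat (.lit k) =>
    simp [VExp.ok] at he
    exact M.mono (Nat.zero_le _) (by nlinarith) (M.nat k)
  | .get A i j => exact M.mono le_rfl (by omega) (h.val A _ _)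
  | .add (.get A i j) (.get B i' j') =>
    simp [VExp.ok] at he
    rw [hsplit]
    exact M.add (h.val _ _ _) (M.mono (by omega) (Nat.le_mul_of_pos_left _ hX) (h.inp _ _ _ he))
  | .add (.get A i j) (.mul (.get B i1 j1) (.get B' i2 j2)) =>
    simp [VExp.ok] at he
    rw [hsplit]
    exact M.add (h.val _ _ _) (M.mul (h.inp _ _ _ he.1) (h.inp _ _ _ he.2))

theorem VExp.noDiv_of_ok (e : VExp) (he : e.ok = true) : e.noDiv = true := by
  match e with
  | .ofNat (.lit k) => rfl
  | .get A i j => rfl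
  | .add (.get A i j) (.get B i' j') => rfl
  | .add (.get A i j) (.mul (.get B i1 j1) (.get B' i2 j2)) => rfl

/-- A bound for the cost of one operation. -/
def opCost (q N X S W : ℕ) : ℕ := W * (W * unitCost q (maxEntry N X S) + 1)

theorem le_opCost {w W : ℕ} (h : w ≤ W) :
    w * (w * unitCost q (maxEntry N X S) + 1) ≤ opCost q N X S W := by
  unfold opCost; gcongr

theorem sum_le_opCost {a b c x y z W : ℕ}
    (hx : x ≤ a * (a * unitCost q (maxEntry N X S) + 1))
    (hy : y ≤ b * (b * unitCost q (maxEntry N X S) + 1))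
    (hz : z ≤ c * (c * unitCost q (maxEntry N X S) + 1)) (h : a + b + c + 1 ≤ W) :
    x + y + z + 1 ≤ opCost q N X S W := by
  refine le_trans ?_ (le_opCost h)
  generalize unitCost q (maxEntry N X S) = u at *
  nlinarith [Nat.zero_le (a * b * u), Nat.zero_le (a * u), Nat.zero_le (b * u),
    Nat.zero_le (a * c * u), Nat.zero_le (b * c * u), Nat.zero_le (c * u)]

theorem Bdd.setNat (h : Bdd M N X τ s) {A i j k : ℕ} (hA : 5 ≤ A) (hk : k ≤ N + 1 + (τ + 1)) :
    Bdd M N X (τ + 1) (s.setNat A i j k) where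
  nat A' i' j' := by
    rw [State.setNat_nat]
    split_ifs
    · exact hk
    · exact (h.nat _ _ _).trans (by omega)
  inp := h.inp
  val A' i' j' := (h.mono (Nat.le_succ τ)).val _ _ _
  bound B hB := by
    rw [State.setNat_nat_ne (by omega)]
    exact h.bound B hB

theorem Bdd.setVal (h : Bdd M N X τ s) {A i j : ℕ} {x : ℝ} (hA : 2 ≤ A)
    (hx : M.has 2 (X * X * (1 + (τ + 1))) x) :
    Bdd M N X (τ + 1) (s.setVal A i j x) where
  nat A' i' j' := (h.nat _ _ _).trans (by omega)
  inp A' i' j' hA' := by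
    rw [State.setVal_val_ne (by omega)]
    exact h.inp _ _ _ hA'
  val A' i' j' := by
    rw [State.setVal_val]
    split_ifs
    · exact hx
    · exact (h.mono (Nat.le_succ τ)).val _ _ _
  bound := h.bound

/-- A well-typed program computes its denotation, at a cost bounded by its number of steps. -/
theorem Prg.exec (hX : 1 ≤ X) {W : ℕ} (P : Prg) : ∀ (s : State) (τ : ℕ), P.wf = true → P.wt ≤ W →
    Bdd M N X τ s → τ + P.steps N ≤ S →
    Bdd M N X (τ + P.steps N) (P.run s) ∧
      ∃ t, Exec size P.compile s t (P.run s) ∧ t ≤ P.steps N * opCost q N X S W := by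
  induction P with
  | skip =>
    intro s τ _ hW hb hS
    refine ⟨hb.mono (by simp), 1, .skip s, ?_⟩
    simp only [Prg.steps, one_mul]
    simp only [Prg.wt] at hW
    exact Nat.mul_pos hW (Nat.succ_pos _)
  | setNat A i j e =>
    intro s τ hwf hW hb hS
    simp only [Prg.wf, Bool.and_eq_true, decide_eq_true_eq] at hwf
    have hf := hb.fit (S := S) (by omega)
    refine ⟨hb.setNat hwf.1 (e.ok_eval_le hb hwf.2), _, .setNat s A i j e, ?_⟩
    simp only [Prg.steps, one_mul]
    exact sum_le_opCost (i.cost_le hf) (j.cost_le hf) (e.cost_le hf) hW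
  | setVal A i j e =>
    intro s τ hwf hW hb hS
    simp only [Prg.wf, Bool.and_eq_true, decide_eq_true_eq] at hwf
    have hf := hb.fit (S := S) (by omega)
    refine ⟨hb.setVal hwf.1 (e.ok_has_eval hb hX hwf.2), _, .setVal s A i j e, ?_⟩
    simp only [Prg.steps, one_mul]
    exact sum_le_opCost (i.cost_le hf) (j.cost_le hf) (e.cost_le hf (e.noDiv_of_ok hwf.2)) hW
  | seq P Q hP hQ =>
    intro s τ hwf hW hb hS
    simp only [Prg.wf, Bool.and_eq_true] at hwf
    simp only [Prg.steps, Prg.wt] at hS hW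
    obtain ⟨hb1, t1, h1, ht1⟩ := hP s τ hwf.1 (by omega) hb (by omega)
    obtain ⟨hb2, t2, h2, ht2⟩ := hQ (P.run s) _ hwf.2 (by omega) hb1 (by omega)
    refine ⟨?_, _, .seq h1 h2, ?_⟩
    · rw [Prg.steps, ← Nat.add_assoc]; exact hb2
    · rw [Prg.steps, Nat.add_mul]; exact Nat.add_le_add ht1 ht2
  | ite p P Q hP hQ =>
    intro s τ hwf hW hb hS
    simp only [Prg.wf, Bool.and_eq_true] at hwf
    simp only [Prg.steps, Prg.wt] at hS hW
    have hf := hb.fit (S := S) (by omega)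
    have hp : p.cost size s + 1 ≤ opCost q N X S W := by
      have := sum_le_opCost (p.cost_le hf hwf.1.1) (Nat.zero_le (0 * _))
        (Nat.zero_le (0 * _)) (show p.wt + 0 + 0 + 1 ≤ W by omega)
      simpa using this
    simp only [Prg.run, Prg.steps]
    split_ifs with hc
    · obtain ⟨hb1, t1, h1, ht1⟩ := hP s τ hwf.1.2 (by omega) hb (by omega)
      refine ⟨hb1.mono (by omega), _, .ite_true hc h1, ?_⟩
      calc p.cost size s + 1 + t1 ≤ opCost q N X S W + P.steps N * opCost q N X S W :=
            Nat.add_le_add hp ht1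
        _ ≤ _ := by rw [Nat.add_mul, Nat.add_mul, one_mul]; omega
    · obtain ⟨hb1, t1, h1, ht1⟩ := hQ s τ hwf.2 (by omega) hb (by omega)
      refine ⟨hb1.mono (by omega), _, .ite_false hc h1, ?_⟩
      calc p.cost size s + 1 + t1 ≤ opCost q N X S W + Q.steps N * opCost q N X S W :=
            Nat.add_le_add hp ht1
        _ ≤ _ := by rw [Nat.add_mul, Nat.add_mul, one_mul]; omega
  | loop v B P hP =>
    intro s τ hwf hW hb hS
    simp only [Prg.wf, Bool.and_eq_true, decide_eq_true_eq, Bool.not_eq_true'] at hwf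
    obtain ⟨⟨⟨hv, hB⟩, hvP⟩, hPwf⟩ := hwf
    simp only [Prg.steps, Prg.wt] at hS hW
    set U := opCost q N X S W with hU
    set b := P.steps N + 2 with hb'
    set K := s.nat B 0 0 with hK
    have hKN : K ≤ N := hb.bound B hB
    have hKS : ∀ k ≤ K, k * b ≤ N * b := fun k hk => Nat.mul_le_mul_right _ (hk.trans hKN)
    have hBP : P.wN B = false := P.wN_of_wf hPwf (by omega)
    have hBk : ∀ k, (iter P.run v s k).nat B = s.nat B :=
      fun k => iter_nat (by omega) (fun s => Prg.run_nat s hBP) k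
    have htest : ∀ {s' : State} {τ' : ℕ}, Bdd M N X τ' s' → τ' ≤ S →
        (loopTest v B).cost size s' + 1 ≤ U := by
      intro s' τ' h1 h2
      have h3 := sum_le_opCost ((loopTest v B).cost_le (h1.fit h2) rfl) (Nat.zero_le (0 * _))
        (Nat.zero_le (0 * _)) (show (loopTest v B).wt + 0 + 0 + 1 ≤ W by
          simp [Cond.wt, NExp.wt]; omega)
      simpa using h3
    have hinc : ∀ {s' : State} {τ' : ℕ}, Bdd M N X τ' s' → τ' ≤ S →
        (NExp.lit 0).cost s' + (NExp.lit 0).cost s' +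
          (NExp.add (.var v) (.lit 1)).cost s' + 1 ≤ U := by
      intro s' τ' h1 h2
      have hf := h1.fit h2
      exact sum_le_opCost (NExp.cost_le hf _) (NExp.cost_le hf _) (NExp.cost_le hf _)
        (by simp [NExp.wt]; omega)
    have h0 : Bdd M N X (τ + 1) (iter P.run v s 0) := hb.setNat hv (by omega)
    -- one round of the loop
    have hround : ∀ k < K, Bdd M N X (τ + 1 + k * b) (iter P.run v s k) →
        Bdd M N X (τ + 1 + (k + 1) * b) (iter P.run v s (k + 1)) ∧
        ∃ t, Exec size (.seq P.compile (incr v)) (iter P.run v s k) t (iter P.run v s (k + 1)) ∧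
          t ≤ P.steps N * U + U := by
      intro k hk hbk
      have hkb := hKS (k + 1) hk
      have hexp : (k + 1) * b = k * b + b := by ring
      obtain ⟨hb1, t1, h1, ht1⟩ := hP _ _ hPwf (by omega) hbk (by omega)
      have hvk : (P.run (iter P.run v s k)).nat v 0 0 = k := by
        rw [Prg.run_nat _ hvP, iter_var]
      have hstep := Exec.setNat (size := size) (P.run (iter P.run v s k)) v (.lit 0) (.lit 0)
        (.add (.var v) (.lit 1))
      -- The compiled increment reads the counter again; it still equals `k` because the body does
      -- not write to `v`.
      have heq : (P.run (iter P.run v s k)).setNat v ((NExp.lit 0).eval (P.run (iter P.run v s k)))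
          ((NExp.lit 0).eval (P.run (iter P.run v s k)))
          ((NExp.add (.var v) (.lit 1)).eval (P.run (iter P.run v s k)))
          = iter P.run v s (k + 1) := by
        simp [NExp.eval, hvk, iter]
      rw [heq] at hstep
      refine ⟨?_, _, .seq h1 hstep, Nat.add_le_add ht1 (hinc hb1 (by omega))⟩
      have := hb1.setNat (i := 0) (j := 0) (k := k + 1) hv (by omega)
      exact this.mono (by omega)
    have hbk : ∀ k ≤ K, Bdd M N X (τ + 1 + k * b) (iter P.run v s k) := by
      intro k
      induction k with
      | zero => intro _; simpa using h0
      | succ k ih => intro hk; exact (hround k hk (ih (Nat.le_of_succ_le hk))).1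
    -- Induction on the number `d` of remaining rounds, because the rule for `while` unfolds the
    -- first round.
    have hwhile : ∀ d k, k + d = K → ∃ t, Exec size (.while (loopTest v B)
        (.seq P.compile (incr v))) (iter P.run v s k) t (iter P.run v s K) ∧ t ≤ d * (b * U) + U := by
      intro d
      induction d with
      | zero =>
        intro k hk
        obtain rfl : k = K := by omega
        refine ⟨_, .while_false ?_, ?_⟩
        · simp only [Cond.holds, NExp.eval, iter_var, hBk]
          omega
        · have := htest (hbk K le_rfl) (by have := hKS K le_rfl; omega)
          omega
      | succ d ih =>
        intro k hk
        obtain ⟨t1, h1, ht1⟩ := (hround k (by omega) (hbk k (by omega))).2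
        obtain ⟨t2, h2, ht2⟩ := ih (k + 1) (by omega)
        refine ⟨_, .while_true ?_ h1 h2, ?_⟩
        · simp only [Cond.holds, NExp.eval, iter_var, hBk]
          omega
        · have := htest (hbk k (by omega)) (by have := hKS k (by omega); omega)
          calc (loopTest v B).cost size (iter P.run v s k) + 1 + t1 + t2
              ≤ U + (P.steps N * U + U) + (d * (b * U) + U) := by omega
            _ = (d + 1) * (b * U) + U := by rw [hb']; ring
    obtain ⟨t, ht, htle⟩ := hwhile K 0 (by omega)
    have hrun : (Prg.loop v B P).run s = iter P.run v s K := rfl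
    rw [hrun]
    refine ⟨?_, _, .seq (.setNat s v (.lit 0) (.lit 0) (.lit 0)) ht, ?_⟩
    · refine (hbk K le_rfl).mono ?_
      have := hKS K le_rfl
      simp only [Prg.steps, ← hb']
      omega
    · have hc : (NExp.lit 0).cost s + (NExp.lit 0).cost s + (NExp.lit 0).cost s + 1 ≤ U := by
        have hf := hb.fit (S := S) (by omega)
        exact sum_le_opCost (NExp.cost_le hf _) (NExp.cost_le hf _) (NExp.cost_le hf _)
          (by simp [NExp.wt]; omega)
      simp only [Prg.steps]
      calc _ ≤ U + (K * (b * U) + U) := Nat.add_le_add hc htle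
        _ ≤ U + (N * (b * U) + U) := by
          have := Nat.mul_le_mul_right (b * U) hKN
          omega
        _ = (2 + N * b) * U := by ring

end Cost

/-! ### The arithmetic and the bit cost model, and the polynomial time bound -/

section SizeModels

/-- In the arithmetic model nothing has to be kept track of. -/
def unitModel (q : ℕ) : SizeModel unitSize q where
  has _ _ _ := True
  nat _ := trivial
  mono _ _ _ := trivial
  add _ _ := trivial
  sub _ _ := trivial
  mul _ _ := trivial
  size_le _ := by unfold unitSize; omega

/-- At most one rational number has a given real value, so the choice made in `bitSize` is
immaterial. -/
theorem bitSize_ratCast (r : ℚ) : bitSize (r : ℝ) = Nat.size r.num.natAbs + Nat.size r.den := by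
  have h : ∃ q : ℚ, (q : ℝ) = (r : ℝ) := ⟨r, rfl⟩
  have h2 : h.choose = r := Rat.cast_injective h.choose_spec
  unfold bitSize
  rw [dif_pos h, h2]

/-- In the bit model the numbers have denominators dividing a power of `Q`. -/
def bitModel {Q q : ℕ} (hQ : 1 ≤ Q) (hq : Q ≤ 2 ^ q) : SizeModel bitSize q where
  has d B x := (∃ z : ℤ, x * (Q : ℝ) ^ d = z) ∧ |x| ≤ B
  nat k := ⟨⟨k, by simp⟩, by simp⟩
  mono := by
    rintro d d' B B' x hd hB ⟨⟨z, hz⟩, hx⟩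
    refine ⟨⟨z * (Q : ℤ) ^ (d' - d), ?_⟩, hx.trans (by exact_mod_cast hB)⟩
    rw [← Nat.add_sub_of_le hd, pow_add, ← mul_assoc, hz]
    push_cast
    simp
  add := by
    rintro d B B' x y ⟨⟨z, hz⟩, hx⟩ ⟨⟨w, hw⟩, hy⟩
    refine ⟨⟨z + w, by push_cast; rw [add_mul, hz, hw]⟩, ?_⟩
    push_cast
    exact (abs_add_le x y).trans (add_le_add hx hy)
  sub := by
    rintro d B B' x y ⟨⟨z, hz⟩, hx⟩ ⟨⟨w, hw⟩, hy⟩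
    refine ⟨⟨z - w, by push_cast; rw [sub_mul, hz, hw]⟩, ?_⟩
    push_cast
    exact (abs_sub x y).trans (add_le_add hx hy)
  mul := by
    rintro d d' B B' x y ⟨⟨z, hz⟩, hx⟩ ⟨⟨w, hw⟩, hy⟩
    refine ⟨⟨z * w, ?_⟩, ?_⟩
    · push_cast; rw [← hz, ← hw]; ring
    · push_cast; rw [abs_mul]; exact mul_le_mul hx hy (abs_nonneg _) (Nat.cast_nonneg _)
  size_le := by
    rintro d B x ⟨⟨z, hz⟩, hx⟩
    have hQd : (0 : ℝ) < (Q : ℝ) ^ d := by positivity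
    obtain ⟨r, rfl⟩ : ∃ r : ℚ, (r : ℝ) = x := by
      refine ⟨(z : ℚ) / (Q : ℚ) ^ d, ?_⟩
      push_cast
      rw [← hz]; field_simp
    have hr : r * ((Q ^ d : ℕ) : ℚ) = z := by
      push_cast; exact_mod_cast hz
    have hden : r.den ∣ Q ^ d := by
      have h0 : ((Q ^ d : ℕ) : ℤ) ≠ 0 := by positivity
      have : r = Rat.divInt z ((Q ^ d : ℕ) : ℤ) := by
        rw [Rat.divInt_eq_div, ← hr]
        push_cast
        have : (Q : ℚ) ^ d ≠ 0 := by positivity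
        field_simp
      have h2 := Rat.den_dvd z ((Q ^ d : ℕ) : ℤ)
      rw [← this] at h2
      exact_mod_cast h2
    have hden2 : r.den ≤ Q ^ d := Nat.le_of_dvd (by positivity) hden
    have hQ2 : Q ^ d ≤ 2 ^ (d * q) := by
      rw [mul_comm, pow_mul]; exact Nat.pow_le_pow_left hq d
    have hnum : r.num.natAbs ≤ B * 2 ^ (d * q) := by
      have h1 : (r.num.natAbs : ℝ) = |(r : ℝ)| * r.den := by
        have h2 : (r : ℝ) * r.den = r.num := by exact_mod_cast Rat.mul_den_eq_num r
        rw [Nat.cast_natAbs, Int.cast_abs, ← h2, abs_mul, Nat.abs_cast]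
      have h3 : (r.num.natAbs : ℝ) ≤ B * (2 ^ (d * q) : ℕ) := by
        rw [h1]
        exact mul_le_mul hx (by exact_mod_cast hden2.trans hQ2) (Nat.cast_nonneg _)
          (Nat.cast_nonneg _)
      exact_mod_cast h3
    rw [bitSize_ratCast]
    have s1 : Nat.size r.num.natAbs ≤ Nat.size B + d * q := by
      rw [Nat.size_le, pow_add]
      exact hnum.trans_lt (Nat.mul_lt_mul_of_pos_right (Nat.lt_size_self B) (by positivity))
    have s2 : Nat.size r.den ≤ d * q + 1 := by
      rw [Nat.size_le]
      exact (hden2.trans hQ2).trans_lt (Nat.pow_lt_pow_right (by norm_num) (Nat.lt_succ_self _))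
    omega

/-- The number of steps as a polynomial. -/
noncomputable def Prg.stepsPoly : Prg → Polynomial ℕ
  | .skip => 1
  | .setNat _ _ _ _ => 1
  | .setVal _ _ _ _ => 1
  | .seq P Q => P.stepsPoly + Q.stepsPoly
  | .ite _ P Q => 1 + P.stepsPoly + Q.stepsPoly
  | .loop _ _ P => 2 + Polynomial.X * (P.stepsPoly + 2)

theorem Prg.eval_stepsPoly (P : Prg) (N : ℕ) : P.stepsPoly.eval N = P.steps N := by
  induction P with
  | skip => simp [stepsPoly, steps]
  | setNat => simp [stepsPoly, steps]
  | setVal => simp [stepsPoly, steps]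
  | seq P Q hP hQ => simp [stepsPoly, steps, hP, hQ]
  | ite p P Q hP hQ => simp [stepsPoly, steps, hP, hQ]
  | loop v B P hP => simp [stepsPoly, steps, hP]

/-- Input numbers of magnitude `2 ^ N` lead to entries whose binary length is linear in `N` and in
the number `S` of operations. -/
theorem size_maxEntry_le (N S : ℕ) : Nat.size (maxEntry N (2 ^ N) S) ≤ 3 * N + 2 * S + 4 := by
  rw [Nat.size_le]
  have h1 : N + 2 * S + 4 < 2 ^ (N + 2 * S + 4) := Nat.lt_two_pow_self
  have h2 : 1 ≤ 2 ^ N * 2 ^ N := Nat.one_le_iff_ne_zero.2 (by positivity)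
  have h3 : (2 : ℕ) ^ (3 * N + 2 * S + 4) = 2 ^ N * 2 ^ N * 2 ^ (N + 2 * S + 4) := by
    rw [← pow_add, ← pow_add]; congr 1; ring
  rw [h3]
  unfold maxEntry
  calc N + 1 + S + 2 ^ N * 2 ^ N * (1 + S) + 2 ≤ 2 ^ N * 2 ^ N * (N + 2 * S + 4) := by
        generalize 2 ^ N * 2 ^ N = a at *
        nlinarith
    _ < _ := Nat.mul_lt_mul_of_pos_left h1 h2

/-- A well-typed program runs in polynomial time, if the entries of the initial memory have
moderate size. -/
theorem Prg.exists_poly (P : Prg) (hP : P.wf = true) : ∃ p : Polynomial ℕ,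
    ∀ (size : ℝ → ℕ) (N : ℕ) (M : SizeModel size N) (s : State), Bdd M N (2 ^ N) 0 s →
      ∃ t, Exec size P.compile s t (P.run s) ∧ t ≤ p.eval N := by
  let W := P.wt
  -- The polynomial copies `steps * opCost`, with the binary length of the largest entry replaced by
  -- the bound of `size_maxEntry_le`.
  refine ⟨P.stepsPoly * (Polynomial.C W * (Polynomial.C W * (2 * (3 * Polynomial.X +
    2 * P.stepsPoly + 4 + 2 * Polynomial.X + 2)) + 1)), fun size N M s hs => ?_⟩
  obtain ⟨-, t, ht, hle⟩ := P.exec (S := P.steps N) (W := W) Nat.one_le_two_pow s 0 hP le_rfl hs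
    (by omega)
  refine ⟨t, ht, hle.trans ?_⟩
  simp only [Polynomial.eval_mul, Polynomial.eval_add, Polynomial.eval_C, Polynomial.eval_X,
    Polynomial.eval_ofNat, Polynomial.eval_one, P.eval_stepsPoly]
  unfold opCost unitCost
  have := size_maxEntry_le N (P.steps N)
  gcongr

end SizeModels

/-! ### The initial memory satisfies the size bounds -/

section InitialState

theorem Instance.input_bdd {size : ℝ → ℕ} {N X : ℕ} (I : Instance) (M : SizeModel size N)
    (hX : 1 ≤ X) (hn : I.n ≤ N) (hm : I.m ≤ N)
    (hc : ∀ e ∈ I.G.edgeSet, M.has 1 X (I.c e) ∧ M.has 1 X (I.l e)) : Bdd M N X 0 I.input := by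
  have h0 : ∀ d B, M.has d B 0 := fun d B => by
    simpa using M.mono (Nat.zero_le d) (Nat.zero_le B) (M.nat 0)
  have hval : ∀ A i j, M.has 1 X (I.input.val A i j) := by
    intro A i j
    simp only [Instance.input]
    split_ifs with h1 h2 h3 h4
    · exact (hc _ h2).1
    · exact (hc _ h2).2
    all_goals exact h0 _ _
  refine ⟨fun A i j => ?_, fun A i j _ => hval A i j, fun A i j => ?_, fun B hB => ?_⟩
  · simp only [Instance.input]
    split_ifs with h1 h2 h3 h4
    · omega
    · omega
    · exact (I.D.bag _).2.le.trans (by omega)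
    · exact (I.D.parent _).2.le.trans (by omega)
    all_goals omega
  · exact M.mono (by norm_num) (by nlinarith) (hval A i j)
  · have : B = 0 ∨ B = 1 := by omega
    rcases this with rfl | rfl <;> simpa [Instance.input]

theorem Instance.le_inputSize (I : Instance) (size : ℝ → ℕ) :
    I.n ≤ I.inputSize size ∧ I.m ≤ I.inputSize size ∧
      edgeSum I.G (fun e => size (I.c e) + size (I.l e)) ≤ I.inputSize size := by
  unfold Instance.inputSize; omega

theorem Instance.input_bdd_unit (I : Instance) :
    Bdd (unitModel (I.inputSize unitSize)) (I.inputSize unitSize) (2 ^ I.inputSize unitSize) 0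
      I.input :=
  I.input_bdd _ Nat.one_le_two_pow (I.le_inputSize _).1 (I.le_inputSize _).2.1
    fun _ _ => ⟨trivial, trivial⟩

open Classical in
theorem Instance.input_bdd_bit (I : Instance) (hI : I.IsRational) :
    ∃ M : SizeModel bitSize (I.inputSize bitSize),
      Bdd M (I.inputSize bitSize) (2 ^ I.inputSize bitSize) 0 I.input := by
  set N := I.inputSize bitSize with hN
  have key : ∀ x : ℝ, ∃ a : ℕ, 1 ≤ a ∧ ((∃ q : ℚ, (q : ℝ) = x) →
      a ≤ 2 ^ bitSize x ∧ |x| ≤ (2 ^ bitSize x : ℕ) ∧ ∃ z : ℤ, x * a = z) := by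
    intro x
    by_cases h : ∃ q : ℚ, (q : ℝ) = x
    · obtain ⟨q, rfl⟩ := h
      refine ⟨q.den, q.den_pos, fun _ => ?_⟩
      rw [bitSize_ratCast]
      have e1 : (q : ℝ) * q.den = q.num := by exact_mod_cast Rat.mul_den_eq_num q
      refine ⟨?_, ?_, q.num, e1⟩
      · exact (Nat.lt_size_self _).le.trans (Nat.pow_le_pow_right (by norm_num) (by omega))
      · have h2 : (q.num.natAbs : ℝ) = |(q : ℝ)| * q.den := by
          rw [Nat.cast_natAbs, Int.cast_abs, ← e1, abs_mul, Nat.abs_cast]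
        have h3 : (1 : ℝ) ≤ q.den := by exact_mod_cast q.den_pos
        have h4 : q.num.natAbs ≤ 2 ^ (Nat.size q.num.natAbs + Nat.size q.den) :=
          (Nat.lt_size_self _).le.trans (Nat.pow_le_pow_right (by norm_num) (by omega))
        calc |(q : ℝ)| ≤ |(q : ℝ)| * q.den := le_mul_of_one_le_right (abs_nonneg _) h3
          _ ≤ _ := by rw [← h2]; exact_mod_cast h4
    · exact ⟨1, le_rfl, fun h' => absurd h' h⟩
  choose a ha1 ha using key
  -- `Q` is the product of the denominators of all capacities and lengths of edges. Each denominator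
  -- is at most two to its share of the input size, whence `Q ≤ 2 ^ N`.
  set Q : ℕ := ∏ e ∈ I.G.edgeFinset, a (I.c e) * a (I.l e) with hQ
  have hQ1 : 1 ≤ Q := Finset.one_le_prod' fun e _ => Nat.mul_pos (ha1 _) (ha1 _)
  have hsum : ∑ e ∈ I.G.edgeFinset, (bitSize (I.c e) + bitSize (I.l e)) ≤ N := by
    have h := (I.le_inputSize bitSize).2.2
    unfold edgeSum at h
    convert h
  have hQ2 : Q ≤ 2 ^ N := by
    refine le_trans ?_ (Nat.pow_le_pow_right (by norm_num) hsum)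
    rw [← Finset.prod_pow_eq_pow_sum]
    refine Finset.prod_le_prod' fun e he => ?_
    rw [SimpleGraph.mem_edgeFinset] at he
    rw [pow_add]
    exact Nat.mul_le_mul (ha _ (hI e he).1).1 (ha _ (hI e he).2).1
  have hsize : ∀ e ∈ I.G.edgeSet, bitSize (I.c e) + bitSize (I.l e) ≤ N := fun e he =>
    (Finset.single_le_sum (f := fun e => bitSize (I.c e) + bitSize (I.l e))
      (fun _ _ => Nat.zero_le _) (SimpleGraph.mem_edgeFinset.2 he)).trans hsum
  have hmodel : ∀ (e) (x : ℝ), a x ∣ a (I.c e) * a (I.l e) → e ∈ I.G.edgeSet →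
      (∃ q : ℚ, (q : ℝ) = x) → bitSize x ≤ N → (bitModel hQ1 hQ2).has 1 (2 ^ N) x := by
    intro e x hd he hx hN
    obtain ⟨k, hk⟩ := hd.trans (Finset.dvd_prod_of_mem (fun e => a (I.c e) * a (I.l e))
      (SimpleGraph.mem_edgeFinset.2 he))
    obtain ⟨-, h2, z, hz⟩ := ha x hx
    refine ⟨⟨z * k, ?_⟩, h2.trans (by exact_mod_cast Nat.pow_le_pow_right (by norm_num) hN)⟩
    rw [← hQ] at hk
    rw [hk]; push_cast; rw [← hz]; ring
  refine ⟨bitModel hQ1 hQ2, I.input_bdd _ Nat.one_le_two_pow (I.le_inputSize _).1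
    (I.le_inputSize _).2.1 fun e he => ⟨?_, ?_⟩⟩
  · exact hmodel e _ (dvd_mul_right _ _) he (hI e he).1 (by have := hsize e he; omega)
  · exact hmodel e _ (dvd_mul_left _ _) he (hI e he).2 (by have := hsize e he; omega)

/-- A well-typed structured program that is correct solves the problem in polynomial time. -/
theorem Prg.solves (P : Prg) (hwf : P.wf = true)
    (hP : ∀ I : Instance, I.IsSolution (P.run I.input)) :
    SolvesInPolyTime unitSize Set.univ P.compile ∧
      SolvesInPolyTime bitSize {I | I.IsRational} P.compile := by
  obtain ⟨p, hp⟩ := P.exists_poly hwf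
  refine ⟨⟨p, fun I _ => ?_⟩, ⟨p, fun I hI => ?_⟩⟩
  · obtain ⟨t, h1, h2⟩ := hp _ _ _ _ I.input_bdd_unit
    exact ⟨t, _, h1, h2, hP I⟩
  · obtain ⟨M, hM⟩ := I.input_bdd_bit hI
    obtain ⟨t, h1, h2⟩ := hp _ _ _ _ hM
    exact ⟨t, _, h1, h2, hP I⟩

end InitialState

/-! ### Walks in induced subgraphs, with number of edges and length -/

section Paths

variable {V : Type*} (G : SimpleGraph V) (l : Sym2 V → ℝ)

/-- There is a walk in the subgraph induced by `A` with `k` edges and length `d`. -/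
inductive PathIn (A : Set V) : V → V → ℕ → ℝ → Prop
  | refl {u : V} : u ∈ A → PathIn A u u 0 0
  | step {u v w : V} {k : ℕ} {d : ℝ} : PathIn A u v k d → G.Adj v w → w ∈ A →
      PathIn A u w (k + 1) (d + l s(v, w))

variable {G l} {A B : Set V} {u v w : V} {k k' : ℕ} {d d' : ℝ}

theorem PathIn.right_mem (h : PathIn G l A u v k d) : v ∈ A := by cases h <;> assumption

theorem PathIn.left_mem (h : PathIn G l A u v k d) : u ∈ A := by
  induction h with
  | refl h => exact h
  | step _ _ _ ih => exact ih

theorem PathIn.mono (hAB : A ⊆ B) (h : PathIn G l A u v k d) : PathIn G l B u v k d := by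
  induction h with
  | refl h => exact .refl (hAB h)
  | step _ ha hw ih => exact .step ih ha (hAB hw)

theorem PathIn.trans (h : PathIn G l A u v k d) (h' : PathIn G l A v w k' d') :
    PathIn G l A u w (k + k') (d + d') := by
  induction h' with
  | refl _ => simpa using h
  | step _ ha hw ih => rw [← add_assoc, ← add_assoc]; exact .step ih ha hw

theorem PathIn.symm (h : PathIn G l A u v k d) : PathIn G l A v u k d := by
  induction h with
  | refl h => exact .refl h
  | @step v w k d hp ha hw ih =>
    have h1 : PathIn G l A w v 1 (l s(v, w)) := by
      have := PathIn.step (l := l) (.refl hw) ha.symm hp.right_mem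
      rwa [zero_add, zero_add, Sym2.eq_swap] at this
    have h2 := h1.trans ih
    rwa [add_comm 1 k, add_comm (l s(v, w))] at h2

theorem PathIn.nonneg (hl : ∀ e ∈ G.edgeSet, 0 ≤ l e) (h : PathIn G l A u v k d) : 0 ≤ d := by
  induction h with
  | refl h => exact le_rfl
  | step _ ha hw ih => exact add_nonneg ih (hl _ ha)

theorem PathIn.exists_walk (h : PathIn G l A u v k d) :
    ∃ p : G.Walk u v, (p.edges.map l).sum = d := by
  induction h with
  | refl h => exact ⟨.nil, by simp⟩
  | step _ ha hw ih =>
    obtain ⟨p, hp⟩ := ih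
    exact ⟨p.concat ha, by simp [SimpleGraph.Walk.edges_concat, hp]⟩

theorem PathIn.dist_le (h : PathIn G l A u v k d) : dist G l u v ≤ ENNReal.ofReal d := by
  obtain ⟨p, rfl⟩ := h.exists_walk
  exact iInf_le _ p

end Paths

/-! ### The ancestor relation on bags -/

section Ancestors

variable {V ι : Type*} {G : SimpleGraph V} (D : TreePartition G ι)

/-- The bag `E` is an ancestor of the bag `F`, or equal to it. -/
def Anc (E F : ι) : Prop := ∃ k, D.parent^[k] F = E

variable {D} {E F F' : ι}

theorem Anc.refl (E : ι) : Anc D E E := ⟨0, rfl⟩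

theorem Anc.trans (h : Anc D E F) (h' : Anc D F F') : Anc D E F' := by
  obtain ⟨k, rfl⟩ := h
  obtain ⟨k', rfl⟩ := h'
  exact ⟨k + k', Function.iterate_add_apply _ _ _ _⟩

theorem Anc.parent (E : ι) : Anc D (D.parent E) E := ⟨1, rfl⟩

theorem Anc.eq_or (h : Anc D E F) : E = F ∨ Anc D E (D.parent F) := by
  obtain ⟨k, rfl⟩ := h
  cases k with
  | zero => exact .inl rfl
  | succ k => exact .inr ⟨k, rfl⟩

/-- Both bags lie on the path from `F'` to the root, which is a chain. -/
theorem Anc.total (h : Anc D E F') (h' : Anc D F F') : Anc D E F ∨ Anc D F E := by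
  obtain ⟨k, rfl⟩ := h
  obtain ⟨k', rfl⟩ := h'
  rcases le_total k k' with hk | hk
  · right
    refine ⟨k' - k, ?_⟩
    rw [← Function.iterate_add_apply, Nat.sub_add_cancel hk]
  · left
    refine ⟨k - k', ?_⟩
    rw [← Function.iterate_add_apply, Nat.sub_add_cancel hk]

/-- An edge that enters the subtree of `E` ends in the bag `E`. -/
theorem Anc.bag_eq {v w : V} (h : Anc D E (D.bag w)) (ha : G.Adj v w)
    (hv : ¬ Anc D E (D.bag v)) : D.bag w = E := by
  rcases D.edge_mem v w ha with h1 | h1 | h1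
  · exact absurd (h1 ▸ h) hv
  · exact absurd ((h1 ▸ h : Anc D E (D.parent (D.bag v))).trans (Anc.parent _)) hv
  · rcases h.eq_or with h2 | h2
    · exact h2.symm
    · exact absurd (h1 ▸ h2) hv

/-- A walk that enters the subtree of `E` does so through the bag `E`. -/
theorem PathIn.exists_entry {l : Sym2 V → ℝ} {A : Set V} {p u : V} {k : ℕ} {d : ℝ}
    (hl : ∀ e ∈ G.edgeSet, 0 ≤ l e)
    (h : PathIn G l A p u k d) (hu : Anc D E (D.bag u)) (hp : ¬ Anc D E (D.bag p)) :
    ∃ z k' d', D.bag z = E ∧ d' ≤ d ∧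
      PathIn G l {w | w ∈ A ∧ Anc D E (D.bag w)} z u k' d' := by
  induction h with
  | refl _ => exact absurd hu hp
  | @step v w k d hpath ha hw ih =>
    by_cases hv : Anc D E (D.bag v)
    · obtain ⟨z, k', d', hz, hd, hz'⟩ := ih hv
      exact ⟨z, _, _, hz, add_le_add_left hd _, .step hz' ha ⟨hw, hu⟩⟩
    -- The walk enters the subtree with this edge, so the part to be kept starts afresh at `w`.
    · exact ⟨w, 0, 0, hu.bag_eq ha hv, add_nonneg (hpath.nonneg hl) (hl _ ha), .refl ⟨hw, hu⟩⟩

end Ancestors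

/-! ### The covering process: nested regions whose bags form subtrees -/

section Covering

variable {V ι : Type*} {G : SimpleGraph V} (D : TreePartition G ι) (l : Sym2 V → ℝ)

/-- The vertices not covered yet. -/
def alive (net : V → Option ι) : Set V := {w | net w = none}

/-- Every covered region that meets the bag `F` also meets the bag of `w`. -/
def Meets (net : V → Option ι) (F : ι) (w : V) : Prop :=
  ∀ y, D.bag y = F → net y ≠ none → ∃ z, D.bag z = D.bag w ∧ net z = net y

/-- The vertices that are covered by the centre `x`. -/
def Seed (net : V → Option ι) (x w : V) : Prop :=
  w ∈ alive net ∧ Meets D net (D.bag x) w ∧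
    ∃ k d, d ≤ 1 / 3 ∧ PathIn G l (alive net) x w k d

open Classical in
/-- Cover vertices near the bag `F`. -/
noncomputable def netStep (net : V → Option ι) (F : ι) (w : V) : Option ι :=
  if ∃ x, D.bag x = F ∧ Seed D l net x w then some F else net w

/-- The bags are processed in the order `ord`. -/
noncomputable def netAt (ord : ℕ → ι) : ℕ → V → Option ι
  | 0 => fun _ => none
  | t + 1 => netStep D l (netAt ord t) (ord t)

/-- `ord` lists distinct bags, parents first, up to time `T`. -/
structure Topo (ord : ℕ → ι) (T : ℕ) : Prop where
  inj : ∀ t < T, ∀ t' < T, ord t = ord t' → t = t'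
  parent : ∀ t < T, D.parent (ord t) = ord t ∨ ∃ t' < t, ord t' = D.parent (ord t)

/-- The vertex `w` is covered at time `t`. -/
def CoveredAt (ord : ℕ → ι) (t : ℕ) (w : V) : Prop :=
  w ∈ alive (netAt D l ord t) ∧ w ∉ alive (netAt D l ord (t + 1))

/-- The region covered at time `t` meets the bag `E`. -/
def Hits (ord : ℕ → ι) (t : ℕ) (E : ι) : Prop := ∃ w, D.bag w = E ∧ CoveredAt D l ord t w

variable {D l} {ord : ℕ → ι} {T t t' : ℕ} {w : V} {E F : ι}

theorem netAt_congr {ord' : ℕ → ι} (h : ∀ t < T, ord t = ord' t) :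
    netAt D l ord T = netAt D l ord' T := by
  induction T with
  | zero => rfl
  | succ T ih =>
    rw [netAt, netAt, ih fun t ht => h t (by omega), h T (by omega)]

theorem netStep_of_ne {net : V → Option ι} (h : w ∉ alive net) : netStep D l net F w = net w := by
  rw [netStep, if_neg]
  rintro ⟨x, -, hx⟩
  exact h hx.1

theorem netAt_of_le (h : t ≤ t') (hw : w ∉ alive (netAt D l ord t)) :
    netAt D l ord t' w = netAt D l ord t w := by
  induction t', h using Nat.le_induction with
  | base => rfl
  | succ t' _ ih =>
    rw [netAt, netStep_of_ne, ih]
    intro h; apply hw; simp only [alive, Set.mem_ofPred_eq] at *; rw [← ih, h]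

theorem alive_anti (h : t ≤ t') : alive (netAt D l ord t') ⊆ alive (netAt D l ord t) := by
  intro w hw
  by_contra h'
  have := netAt_of_le h h'
  exact h' (this ▸ hw : netAt D l ord t w = none)

theorem coveredAt_iff : CoveredAt D l ord t w ↔
    ∃ x, D.bag x = ord t ∧ Seed D l (netAt D l ord t) x w := by
  constructor
  · rintro ⟨h1, h2⟩
    by_contra h
    apply h2
    simp only [alive, netAt, netStep, Set.mem_ofPred_eq] at *
    rwa [if_neg h]
  · rintro ⟨x, hx, hs⟩
    refine ⟨hs.1, ?_⟩
    simp only [alive, netAt, netStep, Set.mem_ofPred_eq]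
    rw [if_pos ⟨x, hx, hs⟩]
    simp

theorem CoveredAt.netAt_eq (h : CoveredAt D l ord t w) (ht : t < t') :
    netAt D l ord t' w = some (ord t) := by
  rw [netAt_of_le ht h.2, netAt, netStep, if_pos (coveredAt_iff.1 h)]

theorem CoveredAt.unique (h : CoveredAt D l ord t w) (h' : CoveredAt D l ord t' w) : t = t' := by
  rcases lt_trichotomy t t' with hlt | heq | hlt
  · exact absurd (alive_anti hlt h'.1) h.2
  · exact heq
  · exact absurd (alive_anti hlt h.1) h'.2

theorem exists_coveredAt (htt : t ≤ t') (h : w ∈ alive (netAt D l ord t))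
    (h' : w ∉ alive (netAt D l ord t')) :
    ∃ c, t ≤ c ∧ c < t' ∧ CoveredAt D l ord c w := by
  induction t', htt using Nat.le_induction with
  | base => exact absurd h h'
  | succ t' ht' ih =>
    by_cases hw : w ∈ alive (netAt D l ord t')
    · exact ⟨t', ht', Nat.lt_succ_self _, hw, h'⟩
    · obtain ⟨c, h1, h2, h3⟩ := ih hw
      exact ⟨c, h1, by omega, h3⟩

theorem mem_alive_zero : w ∈ alive (netAt D l ord 0) := rfl

/-- An uncovered vertex of the current bag is a centre and covers itself: the distance is zero, and
the condition on earlier regions is trivial in its own bag. -/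
theorem not_alive_of_bag (h : D.bag w = ord t) (htt : t < t') :
    w ∉ alive (netAt D l ord t') := by
  intro hw
  have h1 := alive_anti (Nat.le_of_lt htt) hw
  refine (?_ : CoveredAt D l ord t w).2 (alive_anti htt hw)
  exact coveredAt_iff.2 ⟨w, h, h1, fun y hy _ => ⟨y, hy, rfl⟩, 0, 0, by norm_num, .refl h1⟩

theorem Topo.exists_time (hT : Topo D ord T) (ht : t < T) (h : Anc D E (ord t)) :
    ∃ t' ≤ t, ord t' = E := by
  obtain ⟨k, hk⟩ := h
  induction k generalizing t with
  | zero => exact ⟨t, le_rfl, hk⟩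
  | succ k ih =>
    rw [Function.iterate_succ_apply] at hk
    rcases hT.parent t ht with h | ⟨t', h1, h2⟩
    · exact ih ht (h ▸ hk)
    · obtain ⟨t'', h3, h4⟩ := ih (h1.trans ht) (h2 ▸ hk)
      exact ⟨t'', by omega, h4⟩

theorem Topo.le_of_anc (hT : Topo D ord T) (ht : t < T) (ht' : t' < T)
    (h : Anc D (ord t) (ord t')) : t ≤ t' := by
  obtain ⟨c, hc, hce⟩ := hT.exists_time ht' h
  rw [← hT.inj c (by omega) t ht hce]; exact hc

theorem Topo.anc_of_le (hT : Topo D ord T) (ht' : t' < T) (h : Anc D (ord t) F)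
    (h' : Anc D (ord t') F) (hle : t ≤ t') : Anc D (ord t) (ord t') := by
  rcases h.total h' with h1 | h1
  · exact h1
  · have := hT.le_of_anc ht' (by omega) h1
    rw [le_antisymm hle this]; exact .refl _

/-- A walk could leave the subtree of `ord t` only through the parent bag. That bag was processed
earlier, so none of its vertices is alive. -/
theorem Topo.anc_of_path (hT : Topo D ord T) (ht : t < T) {u : V} {k : ℕ} {d : ℝ}
    (h : PathIn G l (alive (netAt D l ord t)) u w k d) (hu : Anc D (ord t) (D.bag u)) :
    Anc D (ord t) (D.bag w) := by
  induction h with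
  | refl _ => exact hu
  | @step v w k d hp ha hw ih =>
    rcases D.edge_mem v w ha with h | h | h
    · exact h ▸ ih
    · rcases ih.eq_or with h' | h'
      · rcases hT.parent t ht with h2 | ⟨t', h1, h2⟩
        · rw [← h, ← h', h2]; exact .refl _
        · refine absurd hw (not_alive_of_bag (t := t') ?_ h1)
          rw [h2, h', h]
      · exact h ▸ h'
    · exact (h ▸ ih : Anc D (ord t) (D.parent (D.bag w))).trans (Anc.parent _)

theorem CoveredAt.anc (hT : Topo D ord T) (ht : t < T) (h : CoveredAt D l ord t w) :
    Anc D (ord t) (D.bag w) := by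
  obtain ⟨x, hx, -, -, k, d, -, hp⟩ := coveredAt_iff.1 h
  exact hT.anc_of_path ht hp (hx ▸ .refl _)

theorem Hits.anc (hT : Topo D ord T) (ht : t < T) (h : Hits D l ord t E) :
    Anc D (ord t) E := by
  obtain ⟨w, rfl, hw⟩ := h
  exact hw.anc hT ht

/-- Covered regions are nested: a region that meets the bag of a later centre meets
every bag that is met by the region of that centre. -/
theorem Hits.nested (hT : Topo D ord T) (ht' : t' < T) (h : Hits D l ord t (ord t'))
    (h' : Hits D l ord t' E) (htt : t < t') : Hits D l ord t E := by
  obtain ⟨y, hy, hyc⟩ := h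
  obtain ⟨w, rfl, hw⟩ := h'
  obtain ⟨x, hx, -, hm, -⟩ := coveredAt_iff.1 hw
  have hy1 := hyc.netAt_eq htt
  -- The side condition in `Seed` enters here: the region of `t` meets the bag of the centre, so it
  -- has a vertex `z` in the bag of `w`. The label of `z` determines `t` because bags are not
  -- repeated.
  obtain ⟨z, hz, hzy⟩ := hm y (hx ▸ hy) (by rw [hy1]; simp)
  have hzn : z ∉ alive (netAt D l ord t') := by
    simp only [alive, Set.mem_ofPred_eq]; rw [hzy, hy1]; simp
  obtain ⟨c, -, hc, hcz⟩ := exists_coveredAt (Nat.zero_le _) mem_alive_zero hzn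
  have h3 := hcz.netAt_eq hc
  rw [hzy, hy1, Option.some_inj] at h3
  obtain rfl := hT.inj t (by omega) c (by omega) h3
  exact ⟨z, hz, hcz⟩

/-- The set of bags met by a covered region is a subtree. -/
theorem Hits.convex (hl : ∀ e ∈ G.edgeSet, 0 ≤ l e) (hT : Topo D ord T) (ht : t < T)
    (h : Hits D l ord t E)
    (hF : Anc D (ord t) F) (hFE : Anc D F E) : Hits D l ord t F := by
  induction t using Nat.strong_induction_on generalizing E F with
  | _ t ih =>
    have hE := h
    obtain ⟨w, rfl, hw⟩ := h
    obtain ⟨x, hx, hwa, hm, k, d, hd, hp⟩ := coveredAt_iff.1 hw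
    -- An earlier region that meets `ord t` meets `E` by nestedness, and therefore `F` by the
    -- induction hypothesis on time. So no vertex of `F` is excluded by the side condition.
    have hmeet : ∀ z, D.bag z = F → Meets D (netAt D l ord t) (D.bag x) z := by
      intro z hz y hy hyn
      obtain ⟨c, -, hc, hcy⟩ := exists_coveredAt (Nat.zero_le _) mem_alive_zero hyn
      have h1 : Hits D l ord c (ord t) := ⟨y, hy.trans hx, hcy⟩
      have h2 := h1.nested hT ht hE hc
      obtain ⟨z', hz', hzc⟩ := ih c hc (hc.trans ht) h2
        ((h1.anc hT (hc.trans ht)).trans hF) hFE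
      exact ⟨z', hz'.trans hz.symm, by rw [hzc.netAt_eq hc, hcy.netAt_eq hc]⟩
    by_cases hxF : Anc D F (D.bag x)
    · have h1 : F = ord t := by
        obtain ⟨c, hc, hcF⟩ := hT.exists_time ht (hx ▸ hxF)
        have := hT.le_of_anc (t := t) (t' := c) ht (by omega) (hcF ▸ hF)
        rw [← hcF, le_antisymm hc this]
      have hxa := hp.left_mem
      exact ⟨x, hx.trans h1.symm, coveredAt_iff.2 ⟨x, hx, hxa, hmeet x (hx.trans h1.symm), 0, 0,
        by norm_num, .refl hxa⟩⟩
    -- The walk from the centre to `w` must enter the subtree of `F` through a vertex of the bag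
    -- `F`. Its initial part up to that vertex is no longer than the whole, so this vertex is
    -- covered too.
    · have key : ∀ {u : V} {k : ℕ} {d : ℝ}, PathIn G l (alive (netAt D l ord t)) x u k d →
          Anc D F (D.bag u) →
          ∃ z k' d', D.bag z = F ∧ d' ≤ d ∧ PathIn G l (alive (netAt D l ord t)) x z k' d' := by
        intro u k d hp
        induction hp with
        | refl _ => exact fun h => absurd h hxF
        | @step v w k d hpath ha hw ih =>
          intro hu
          have h0 : 0 ≤ l s(v, w) := hl _ ha
          by_cases hv : Anc D F (D.bag v)
          · obtain ⟨z, k', d', h1, h2, h3⟩ := ih hv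
            exact ⟨z, k', d', h1, by linarith, h3⟩
          · exact ⟨w, _, _, hu.bag_eq ha hv, le_rfl, .step hpath ha hw⟩
      obtain ⟨z, k', d', hz, hd', hpz⟩ := key hp hFE
      exact ⟨z, hz, coveredAt_iff.2 ⟨x, hx, hpz.right_mem, hmeet z hz, k', d', by linarith, hpz⟩⟩

end Covering

/-! ### The packing bound: how often a vertex is charged -/

section Packing

variable {V ι : Type*} {G : SimpleGraph V} (D : TreePartition G ι) (l : Sym2 V → ℝ)

open Classical in
/-- The times at which a region that meets the bag `E` is covered. -/
noncomputable def hitTimes (ord : ℕ → ι) (T : ℕ) (E : ι) : Finset ℕ :=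
  (Finset.range T).filter fun t => Hits D l ord t E

/-- The nesting depth of the region covered at time `t`. -/
noncomputable def level (ord : ℕ → ι) (T t : ℕ) : ℕ := (hitTimes D l ord T (ord t)).card

/-- The vertex `v` is close to the region covered at time `t`. -/
def Charged (ord : ℕ → ι) (t : ℕ) (v : V) : Prop :=
  ∃ p k d, CoveredAt D l ord t p ∧ d < 1 / 6 ∧ PathIn G l (alive (netAt D l ord t)) p v k d

variable {D l} {ord : ℕ → ι} {T : ℕ} {E F : ι} {v : V}

theorem mem_hitTimes {t : ℕ} : t ∈ hitTimes D l ord T E ↔ t < T ∧ Hits D l ord t E := by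
  simp [hitTimes]

theorem Hits.self (hl : ∀ e ∈ G.edgeSet, 0 ≤ l e) (hT : Topo D ord T) {t : ℕ} (ht : t < T)
    (h : Hits D l ord t E) : Hits D l ord t (ord t) :=
  h.convex hl hT ht (.refl _) (h.anc hT ht)

/-- By nestedness, an earlier region that reaches the bag of the centre of `t` reaches every bag met
by the region of `t`. -/
theorem hitTimes_subset (hT : Topo D ord T) {t : ℕ} (ht : t < T) (h : Hits D l ord t E) :
    hitTimes D l ord T (ord t) ⊆ hitTimes D l ord T E := by
  intro c hc
  rw [mem_hitTimes] at hc ⊢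
  refine ⟨hc.1, ?_⟩
  rcases (hT.le_of_anc hc.1 ht (hc.2.anc hT hc.1)).eq_or_lt with rfl | hlt
  · exact h
  · exact hc.2.nested hT ht h hlt

/-- The inclusion of hit times is strict: the region of `b` counts towards its own level, but it
meets only bags below `ord b`, hence not the proper ancestor `ord c`. -/
theorem level_lt (hT : Topo D ord T) {b c : ℕ} (hb : b < T) (hbb : Hits D l ord b (ord b))
    (hc : c ∈ hitTimes D l ord T (ord b)) (hcb : c ≠ b) : level D l ord T c < level D l ord T b := by
  rw [mem_hitTimes] at hc
  refine Finset.card_lt_card ⟨hitTimes_subset hT hc.1 hc.2, fun h => hcb ?_⟩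
  have h1 := h (mem_hitTimes.2 ⟨hb, hbb⟩)
  rw [mem_hitTimes] at h1
  exact le_antisymm (hT.le_of_anc hc.1 hb (hc.2.anc hT hc.1))
    (hT.le_of_anc hb hc.1 (h1.2.anc hT hb))

/-- If `u` is close to the region covered at time `f`, and `b` is a later centre above `u` of
smallest level, which is at most the level of `f`, then `u` is covered at time `b`. -/
theorem coveredAt_of_minimal_level (hl : ∀ e ∈ G.edgeSet, 0 ≤ l e) (hT : Topo D ord T)
    (hall : ∀ F, ∃ t < T, ord t = F) {f b : ℕ} {p u : V} {k : ℕ} {d : ℝ} (hf : f < T)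
    (hp : CoveredAt D l ord f p) (hpath : PathIn G l (alive (netAt D l ord f)) p u k d)
    (hd : d ≤ 1 / 3) (hb : b < T) (hfb : f < b) (hbb : Hits D l ord b (ord b))
    (hbu : Anc D (ord b) (D.bag u)) (hlev : level D l ord T b ≤ level D l ord T f)
    (hmin : ∀ e < T, f < e → Hits D l ord e (ord e) → Anc D (ord e) (D.bag u) →
      level D l ord T b ≤ level D l ord T e) : CoveredAt D l ord b u := by
  have hfp := hp.anc hT hf
  have hfu := hT.anc_of_path hf hpath hfp
  have hancfb : Anc D (ord f) (ord b) := hT.anc_of_le hb hfu hbu hfb.le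
  -- regions around `ord b` are older than `f`
  have hold : ∀ c, Hits D l ord c (ord b) → c < T → c ≠ b → c < f := by
    intro c hc hcT hcb
    -- The region of `c` has smaller level than that of `b`. For `c = f` this contradicts `hlev`,
    -- and for `c` later than `f` the minimality of `b`.
    have h1 := level_lt hT hb hbb (mem_hitTimes.2 ⟨hcT, hc⟩) hcb
    by_contra hfc
    rcases (not_lt.1 hfc).eq_or_lt with rfl | hfc
    · omega
    · have := hmin c hcT hfc (hc.self hl hT hcT) ((hc.anc hT hcT).trans hbu)
      omega
  -- If the region of `f` met a bag below `ord b`, then by convexity it would meet `ord b` itself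
  -- and be older than itself.
  have hmiss : ∀ E', Anc D (ord b) E' → ¬ Hits D l ord f E' := by
    intro E' hE' h
    exact lt_irrefl _ (hold f (h.convex hl hT hf hancfb hE') hf hfb.ne)
  have hpb : ∀ E', Anc D (ord b) E' → ¬ Anc D E' (D.bag p) := fun E' hE' h =>
    hmiss _ (hE'.trans h) ⟨p, rfl, hp⟩
  -- the end of the walk is still alive at time `b`
  obtain ⟨z, k', d', hz, hd', hzu⟩ := hpath.exists_entry hl hbu (hpb _ (.refl _))
  -- A region covering such a vertex between the times `f` and `b` would meet `ord b` by convexity,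
  -- although it is not older than `f`. So the tail of the walk is usable by a centre at time `b`.
  have hsub : {w | w ∈ alive (netAt D l ord f) ∧ Anc D (ord b) (D.bag w)} ⊆
      alive (netAt D l ord b) := by
    rintro w ⟨hw, hwb⟩
    by_contra hwn
    obtain ⟨c, h1, h2, h3⟩ := exists_coveredAt hfb.le hw hwn
    have hcT : c < T := h2.trans hb
    have h4 : Hits D l ord c (D.bag w) := ⟨w, rfl, h3⟩
    have h5 := h4.convex hl hT hcT (hT.anc_of_le hb (h4.anc hT hcT) hwb h2.le) hwb
    have := hold c h5 hcT h2.ne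
    omega
  have hzu' := hzu.mono hsub
  -- the regions that meet `ord b` also meet the bag of `u`
  have hmeet : ∀ n : ℕ, ∀ e < T, e = n → Anc D (ord b) (ord e) → Anc D (ord e) (D.bag u) →
      ∀ c, Hits D l ord c (ord b) → c < T → c ≠ b → Hits D l ord c (ord e) := by
    intro n
    induction n using Nat.strong_induction_on with
    | _ n ih =>
      rintro e he rfl hbe heu c hc hcT hcb
      by_contra hce
      have hcf := hold c hc hcT hcb
      have hbe' := hT.le_of_anc hb he hbe
      -- Before time `b`, convexity moves the hit up to `ord b`. From time `b` on, the bag `ord c'`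
      -- lies between `ord b` and `ord e`, so by induction `c` meets `ord c'`, and by nestedness
      -- also `ord e`, contrary to the choice of `c`.
      have holdE : ∀ c', Hits D l ord c' (ord e) → c' < T → c' ≠ e → c' < f := by
        intro c' hc' hc'T hc'e
        have h1 := hc'.anc hT hc'T
        have h2 := hT.le_of_anc hc'T he h1
        by_contra hfc
        rcases lt_or_ge c' b with hlt | hge
        · have h3 := hc'.convex hl hT hc'T (hT.anc_of_le hb (h1.trans heu) hbu hlt.le) hbe
          exact hfc (hold c' h3 hc'T hlt.ne)
        · have h3 := hT.anc_of_le hc'T hbu (h1.trans heu) hge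
          have h4 := ih c' (by omega) c' hc'T rfl h3 (h1.trans heu) c hc hcT hcb
          exact hce (h4.nested hT hc'T hc' (by omega))
      -- The walk passes through a vertex `y` of the bag `ord e` that is alive at time `f`. By
      -- `holdE` only the region of `e` itself can cover it.
      obtain ⟨y, _, _, hy, _, hyu⟩ := hpath.exists_entry hl heu (hpb _ hbe)
      have hya : y ∈ alive (netAt D l ord f) := hyu.left_mem.1
      obtain ⟨e', he', hee⟩ := hall (D.bag y)
      obtain ⟨c', h1, h2, h3⟩ := exists_coveredAt (t' := T) hf.le hya
        (not_alive_of_bag hee.symm he')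
      have h4 : Hits D l ord c' (ord e) := ⟨y, hy, h3⟩
      have h5 : c' = e := by
        by_contra hne
        have := holdE c' h4 h2 hne
        omega
      subst h5
      -- Apart from itself, the region of `e` counts only regions that also meet `ord b`, are
      -- different from `b`, and are different from `c`. So its level is smaller than that of `b`,
      -- against minimality.
      have hlt : level D l ord T c' < level D l ord T b := by
        have hins : (hitTimes D l ord T (ord c')).erase c' ⊆
            ((hitTimes D l ord T (ord b)).erase b).erase c := by
          intro a ha
          rw [Finset.mem_erase, mem_hitTimes] at ha
          have haf := holdE a ha.2.2 ha.2.1 ha.1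
          rw [Finset.mem_erase, Finset.mem_erase, mem_hitTimes]
          have h6 := ha.2.2.anc hT ha.2.1
          exact ⟨fun h => hce (h ▸ ha.2.2), by omega, ha.2.1, ha.2.2.convex hl hT ha.2.1
            (hT.anc_of_le hb (h6.trans heu) hbu (by omega)) hbe⟩
        have h7 := Finset.card_le_card hins
        have hbm : b ∈ hitTimes D l ord T (ord b) := mem_hitTimes.2 ⟨hb, hbb⟩
        rw [Finset.card_erase_of_mem (mem_hitTimes.2 ⟨h2, h4⟩), Finset.card_erase_of_mem
          (Finset.mem_erase.2 ⟨hcb, mem_hitTimes.2 ⟨hcT, hc⟩⟩), Finset.card_erase_of_mem hbm] at h7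
        have h8 : 1 < (hitTimes D l ord T (ord b)).card :=
          Finset.one_lt_card.2 ⟨b, hbm, c, mem_hitTimes.2 ⟨hcT, hc⟩, hcb.symm⟩
        unfold level
        omega
      have := hmin c' h2 (by
        rcases h1.eq_or_lt with rfl | h
        · exact absurd h4 (hmiss _ hbe)
        · exact h) h4 heu
      omega
  obtain ⟨e, he, heu⟩ := hall (D.bag u)
  refine coveredAt_iff.2 ⟨z, hz, hzu'.right_mem, ?_, k', d', hd'.trans hd, hzu'⟩
  intro y hy hyn
  obtain ⟨c, -, hc, hcy⟩ := exists_coveredAt (Nat.zero_le _) mem_alive_zero hyn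
  have h1 : Hits D l ord c (ord b) := ⟨y, hy.trans hz, hcy⟩
  obtain ⟨z', hz', hzc⟩ := hmeet e e he rfl (heu ▸ hbu) (heu ▸ .refl _) c h1 (hc.trans hb) hc.ne
  exact ⟨z', hz'.trans heu, by rw [hzc.netAt_eq hc, hcy.netAt_eq hc]⟩

theorem Charged.anc (hT : Topo D ord T) {t : ℕ} (ht : t < T) (h : Charged D l ord t v) :
    Anc D (ord t) (D.bag v) := by
  obtain ⟨p, k, d, hp, -, hpath⟩ := h
  exact hT.anc_of_path ht hpath (hp.anc hT ht)

theorem Charged.self (hl : ∀ e ∈ G.edgeSet, 0 ≤ l e) (hT : Topo D ord T) {t : ℕ} (ht : t < T)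
    (h : Charged D l ord t v) : Hits D l ord t (ord t) := by
  obtain ⟨p, k, d, hp, -, hpath⟩ := h
  exact Hits.self hl hT ht ⟨p, rfl, hp⟩

/-- A vertex is not charged three times by regions of the same level. -/
theorem not_charged_thrice (hl : ∀ e ∈ G.edgeSet, 0 ≤ l e) (hT : Topo D ord T)
    (hall : ∀ F, ∃ t < T, ord t = F) {t₁ t₂ t₃ : ℕ} (h₁₂ : t₁ < t₂) (h₂₃ : t₂ < t₃) (h₃ : t₃ < T)
    (hc₁ : Charged D l ord t₁ v) (hc₂ : Charged D l ord t₂ v) (hc₃ : Charged D l ord t₃ v)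
    (hlev₂ : level D l ord T t₂ ≤ level D l ord T t₁)
    (hlev₃ : level D l ord T t₃ = level D l ord T t₂) : False := by
  have ha₂ := hc₂.anc hT (h₂₃.trans h₃)
  have ha₃ := hc₃.anc hT h₃
  have hs₂ := hc₂.self hl hT (h₂₃.trans h₃)
  have hs₃ := hc₃.self hl hT h₃
  obtain ⟨p, k, d, hp, hd, hpath⟩ := hc₁
  obtain ⟨u, k', d', hu, hd', hpath'⟩ := hc₃
  have h₂₃' := hT.anc_of_le h₃ ha₂ ha₃ h₂₃.le
  have hu₃ := hu.anc hT h₃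
  -- From the first region to `v` and on to the vertex `u` of the third region: the length is less
  -- than `1 / 6 + 1 / 6`, the radius of the covering.
  have hpu := hpath.trans (hpath'.symm.mono (alive_anti (h₁₂.trans h₂₃).le))
  have key : ∀ b < T, t₁ < b → Hits D l ord b (ord b) → Anc D (ord b) (D.bag u) →
      level D l ord T b ≤ level D l ord T t₁ → (∀ e < T, t₁ < e → Hits D l ord e (ord e) →
        Anc D (ord e) (D.bag u) → level D l ord T b ≤ level D l ord T e) → b = t₃ :=
    fun b hb h1 h2 h3 h4 h5 => (coveredAt_of_minimal_level hl hT hall (by omega) hp hpu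
      (by linarith) hb h1 h2 h3 h4 h5).unique hu
  -- The centre `t₂` is a candidate, so a later centre `b` above `u` of least level exists. It
  -- covers `u`, hence `b = t₃`; then `t₂` has the same least level and would cover `u` as well.
  obtain ⟨b, hb, hbmin⟩ := exists_minimalFor_of_wellFoundedLT
    (fun b => b < T ∧ t₁ < b ∧ Hits D l ord b (ord b) ∧ Anc D (ord b) (D.bag u))
    (level D l ord T) ⟨t₂, h₂₃.trans h₃, h₁₂, hs₂, h₂₃'.trans hu₃⟩
  have hbmin' : ∀ e < T, t₁ < e → Hits D l ord e (ord e) → Anc D (ord e) (D.bag u) →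
      level D l ord T b ≤ level D l ord T e := fun e h1 h2 h3 h4 =>
    (le_total _ _).elim id fun h => hbmin ⟨h1, h2, h3, h4⟩ h
  have hb2 := hbmin' t₂ (h₂₃.trans h₃) h₁₂ hs₂ (h₂₃'.trans hu₃)
  have hb3 := key b hb.1 hb.2.1 hb.2.2.1 hb.2.2.2 (hb2.trans hlev₂) hbmin'
  have := key t₂ (h₂₃.trans h₃) h₁₂ hs₂ (h₂₃'.trans hu₃) hlev₂ fun e h1 h2 h3 h4 => by
    rw [← hlev₃, ← hb3]; exact hbmin' e h1 h2 h3 h4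
  omega

open Classical in
-- Different regions are disjoint, so choosing a covered vertex of `E` for each of them is
-- injective.
theorem card_hitTimes_le [Fintype V] {r : ℕ}
    (hr : (Finset.univ.filter fun v : V => D.bag v = E).card ≤ r) :
    (hitTimes D l ord T E).card ≤ r := by
  refine le_trans ?_ hr
  have h : ∀ t ∈ hitTimes D l ord T E, ∃ w, D.bag w = E ∧ CoveredAt D l ord t w := fun t ht =>
    (mem_hitTimes.1 ht).2
  rcases isEmpty_or_nonempty V with hV | hV
  · rw [Finset.card_eq_zero.2 (Finset.eq_empty_of_forall_notMem fun t ht =>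
      hV.elim (h t ht).choose)]
    exact Nat.zero_le _
  choose! f hf using h
  refine Finset.card_le_card_of_injOn f (fun t ht => by simpa using (hf t ht).1) ?_
  intro t ht t' ht' heq
  exact (hf t ht).2.unique (heq ▸ (hf t' ht').2)

open Classical in
/-- A vertex is charged at most `2 r` times. -/
theorem card_charged_le [Fintype V] (hl : ∀ e ∈ G.edgeSet, 0 ≤ l e) (hT : Topo D ord T)
    (hall : ∀ F, ∃ t < T, ord t = F) {r : ℕ}
    (hr : ∀ E, (Finset.univ.filter fun v : V => D.bag v = E).card ≤ r) :
    ((Finset.range T).filter fun t => Charged D l ord t v).card ≤ 2 * r := by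
  set S := (Finset.range T).filter fun t => Charged D l ord t v with hS
  have hmem : ∀ t ∈ S, t < T ∧ Charged D l ord t v := fun t ht => by simpa [hS] using ht
  -- Levels lie between `1` and `r`; the lower bound holds because a charging region meets the bag
  -- of its own centre.
  have himg : (S.image (level D l ord T)).card ≤ r := by
    have : S.image (level D l ord T) ⊆ Finset.Icc 1 r := by
      intro j hj
      obtain ⟨t, ht, rfl⟩ := Finset.mem_image.1 hj
      rw [Finset.mem_Icc]
      refine ⟨Finset.card_pos.2 ⟨t, mem_hitTimes.2 ⟨(hmem t ht).1, ?_⟩⟩, card_hitTimes_le (hr _)⟩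
      exact (hmem t ht).2.self hl hT (hmem t ht).1
    simpa using Finset.card_le_card this
  refine (Finset.card_le_mul_card_image S 2 fun j _ => ?_).trans (Nat.mul_le_mul_left 2 himg)
  by_contra h3
  obtain ⟨a, ha, b, hb, c, hc, hab, hac, hbc⟩ := Finset.two_lt_card.1 (not_le.1 h3)
  simp only [Finset.mem_filter] at ha hb hc
  have key : ∀ x y z, x < y → y < z → (x ∈ S ∧ level D l ord T x = j) →
      (y ∈ S ∧ level D l ord T y = j) → (z ∈ S ∧ level D l ord T z = j) → False :=
    fun x y z hxy hyz hx hy hz => not_charged_thrice hl hT hall hxy hyz (hmem z hz.1).1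
      (hmem x hx.1).2 (hmem y hy.1).2 (hmem z hz.1).2 (by omega) (by omega)
  rcases hab.lt_or_gt with h1 | h1 <;> rcases hac.lt_or_gt with h2 | h2 <;>
    rcases hbc.lt_or_gt with h3 | h3
  · exact key a b c h1 h3 ha hb hc
  · exact key a c b h2 h3 ha hc hb
  · omega
  · exact key c a b h2 h1 hc ha hb
  · exact key b a c h1 h2 hb ha hc
  · omega
  · exact key b c a h3 h2 hb hc ha
  · exact key c b a h3 h1 hc hb ha

open Classical in
/-- The vertex `u` is charged by the centre `x` if it is close to the vertices covered by `x`. -/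
noncomputable def chargeAt [Fintype V] (D : TreePartition G ι) (l : Sym2 V → ℝ)
    (net : V → Option ι) (x u : V) : ℕ :=
  if ∃ p k d, Seed D l net x p ∧ d < 1 / 6 ∧ PathIn G l (alive net) p u k d then 1 else 0

open Classical in
/-- The number of charges of `u`, up to time `T`. -/
noncomputable def charges [Fintype V] (D : TreePartition G ι) (l : Sym2 V → ℝ) (ord : ℕ → ι)
    (T : ℕ) (u : V) : ℕ :=
  ∑ t ∈ Finset.range T, ∑ x ∈ Finset.univ.filter (fun x => D.bag x = ord t),
    chargeAt D l (netAt D l ord t) x u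

open Classical in
/-- A vertex is charged at most `2 r ^ 2` times. -/
theorem charges_le [Fintype V] (hl : ∀ e ∈ G.edgeSet, 0 ≤ l e) (hT : Topo D ord T)
    (hall : ∀ F, ∃ t < T, ord t = F) {r : ℕ}
    (hr : ∀ E, (Finset.univ.filter fun v : V => D.bag v = E).card ≤ r) :
    charges D l ord T v ≤ 2 * r ^ 2 := by
  -- A charging region consists of the parts of at most `r` centres, each contributing at most one
  -- charge.
  have h1 : ∀ t ∈ Finset.range T, ∑ x ∈ Finset.univ.filter (fun x => D.bag x = ord t),
      chargeAt D l (netAt D l ord t) x v ≤ if Charged D l ord t v then r else 0 := by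
    intro t _
    split_ifs with hc
    · refine (Finset.sum_le_card_nsmul _ _ 1 fun x _ => ?_).trans (by simpa using hr (ord t))
      unfold chargeAt; split_ifs <;> simp
    · refine (Finset.sum_eq_zero fun x hx => ?_).le
      unfold chargeAt
      rw [if_neg]
      rintro ⟨p, k, d, hs, hd, hp⟩
      exact hc ⟨p, k, d, coveredAt_iff.2 ⟨x, by simpa using hx, hs⟩, hd, hp⟩
  refine (Finset.sum_le_sum h1).trans ?_
  rw [← Finset.sum_filter, Finset.sum_const, smul_eq_mul]
  calc _ ≤ 2 * r * r := Nat.mul_le_mul_right _ (card_charged_le hl hT hall hr)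
    _ = 2 * r ^ 2 := by ring

end Packing

/-! ### Region growing with finitely many radii -/

section RegionGrowing

variable {V : Type*} [Fintype V] (R : V → V → Prop) (c l : V → V → ℝ) (f : V → ℝ)

open Classical in
/-- The capacity of the pairs that leave the ball `{f ≤ θ}`. -/
noncomputable def cutSum (θ : ℝ) : ℝ :=
  ∑ u, ∑ w, if R u w ∧ f u ≤ θ ∧ ¬ f w ≤ θ then c u w else 0

open Classical in
/-- The volume of the pairs that start in the ball `{f ≤ θ}`. -/
noncomputable def volSum (θ : ℝ) : ℝ :=
  ∑ u, ∑ w, if R u w ∧ f u ≤ θ then c u w * l u w else 0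

open Classical in
/-- The volume of the pairs that start in the open ball `{f < g}`. -/
noncomputable def totSum (g : ℝ) : ℝ :=
  ∑ u, ∑ w, if R u w ∧ f u < g then c u w * l u w else 0

open Classical in
/-- The volume inside the ball of radius `t`, pairs that leave the ball counted in part. -/
noncomputable def partSum (t : ℝ) : ℝ :=
  ∑ u, ∑ w, if R u w then c u w * max 0 (min (f w) t - min (f u) t) else 0

variable {R c l f}

/-- Region growing: some ball of radius less than `g` has small cut. -/
theorem exists_threshold (hc : ∀ u w, R u w → 0 ≤ c u w) (hl : ∀ u w, R u w → 0 ≤ l u w)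
    (hf : ∀ u, 0 ≤ f u) (hlip : ∀ u w, R u w → f w ≤ f u + l u w) {g K : ℝ} (hg : 0 < g)
    (hK : 0 < K) :
    ∃ θ, θ < g ∧ (θ = 0 ∨ ∃ y, θ = f y) ∧
      K * cutSum R c f θ ≤ Real.log (1 + K) / g * (K * volSum R c l f θ + totSum R c l f g) := by
  classical
  set lam := Real.log (1 + K) / g with hlam
  have hlam0 : 0 ≤ lam := div_nonneg (Real.log_nonneg (by linarith)) hg.le
  have hcl : ∀ u w, R u w → 0 ≤ c u w * l u w := fun u w h => mul_nonneg (hc u w h) (hl u w h)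
  have hvol0 : ∀ θ, 0 ≤ volSum R c l f θ := fun θ =>
    Finset.sum_nonneg fun u _ => Finset.sum_nonneg fun w _ => by
      split_ifs with h
      · exact hcl u w h.1
      · exact le_rfl
  have hterm0 : ∀ u w, 0 ≤ (if R u w ∧ f u < g then c u w * l u w else 0) := fun u w => by
    split_ifs with h
    · exact hcl u w h.1
    · exact le_rfl
  have hW0 : 0 ≤ totSum R c l f g :=
    Finset.sum_nonneg fun u _ => Finset.sum_nonneg fun w _ => hterm0 u w
  -- If the total volume vanishes, then every pair leaving the ball of radius `0` has positive
  -- length and zero volume, hence zero capacity.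
  rcases hW0.eq_or_lt with hW | hW
  · refine ⟨0, hg, .inl rfl, ?_⟩
    have hcut : cutSum R c f 0 = 0 := by
      refine Finset.sum_eq_zero fun u _ => Finset.sum_eq_zero fun w _ => ?_
      split_ifs with h
      · obtain ⟨h1, h2, h3⟩ := h
        have h4 := (Finset.sum_eq_zero_iff_of_nonneg fun u _ =>
          Finset.sum_nonneg fun w _ => hterm0 u w).1 hW.symm u (Finset.mem_univ _)
        have h5 := (Finset.sum_eq_zero_iff_of_nonneg fun w _ => hterm0 u w).1 h4 w
          (Finset.mem_univ _)
        rw [if_pos ⟨h1, by linarith⟩] at h5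
        rcases mul_eq_zero.1 h5 with h6 | h6
        · exact h6
        · have := hlip u w h1; linarith
      · rfl
    rw [hcut, mul_zero]
    exact mul_nonneg hlam0 (add_nonneg (mul_nonneg hK.le (hvol0 _)) hW0)
  by_contra hno
  push Not at hno
  set W := totSum R c l f g with hWdef
  -- the partial volume grows quickly between two consecutive values
  have hgrow : ∀ θ' θ, θ' < θ → (∀ y, f y ≤ θ' ∨ θ ≤ f y) →
      partSum R c f θ' + cutSum R c f θ' * (θ - θ') ≤ partSum R c f θ := by
    intro θ' θ hlt hgap
    unfold partSum cutSum
    rw [Finset.sum_mul, ← Finset.sum_add_distrib]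
    refine Finset.sum_le_sum fun u _ => ?_
    rw [Finset.sum_mul, ← Finset.sum_add_distrib]
    refine Finset.sum_le_sum fun w _ => ?_
    by_cases h : R u w
    · have hcu := hc u w h
      simp only [h, true_and, if_true]
      rcases hgap u with hu | hu <;> rcases hgap w with hw | hw
      · rw [if_neg (by tauto), min_eq_left hu, min_eq_left hw, min_eq_left (by linarith),
          min_eq_left (by linarith)]
        simp
      · rw [if_pos ⟨hu, by linarith⟩, min_eq_left hu, min_eq_right (by linarith),
          min_eq_right hw, min_eq_left (by linarith), max_eq_right (by linarith),
          max_eq_right (by linarith)]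
        linarith
      · rw [if_neg (by tauto), min_eq_left hw, min_eq_right (by linarith), max_eq_left (by linarith)]
        simp only [mul_zero, zero_mul, add_zero]
        exact mul_nonneg hcu (le_max_left _ _)
      · rw [if_neg (by intro h; linarith [h.1]), min_eq_right (by linarith),
          min_eq_right (by linarith)]
        simp only [sub_self, max_self, mul_zero, zero_mul, add_zero]
        exact mul_nonneg hcu (le_max_left _ _)
    · simp [h]
  -- By the Lipschitz condition, a pair counted in part contributes at most its volume. A pair that
  -- starts at height at least `θ` contributes nothing.
  have hpart : ∀ (p : V → Prop) (θ : ℝ), (∀ u, p u ∨ θ ≤ f u) →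
      partSum R c f θ ≤ ∑ u, ∑ w, if R u w ∧ p u then c u w * l u w else 0 := by
    intro p θ hp
    refine Finset.sum_le_sum fun u _ => Finset.sum_le_sum fun w _ => ?_
    by_cases h : R u w
    · have hcu := hc u w h
      have hlu := hl u w h
      simp only [h, true_and, if_true]
      split_ifs with hpu
      · refine mul_le_mul_of_nonneg_left (max_le hlu ?_) hcu
        have := hlip u w h
        rcases min_cases (f w) θ with h1 | h1 <;> rcases min_cases (f u) θ with h2 | h2 <;> linarith
      · have h1 := (hp u).resolve_left hpu
        have h2 := min_le_right (f w) θ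
        rw [min_eq_right h1, max_eq_left (by linarith), mul_zero]
    · simp [h]
  have hpart0 : ∀ θ, 0 ≤ partSum R c f θ := fun θ =>
    Finset.sum_nonneg fun u _ => Finset.sum_nonneg fun w _ => by
      split_ifs with h
      · exact mul_nonneg (hc u w h) (le_max_left _ _)
      · exact le_rfl
  -- Between consecutive elements of `Θ` no vertex enters the ball, so the cut is constant there.
  -- The endpoint `g` is not an admissible radius; it serves only to evaluate the growth.
  let Θ : Finset ℝ := insert g (insert 0 ((Finset.univ.image f).filter (· < g)))
  have hgΘ : g ∈ Θ := Finset.mem_insert_self _ _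
  have h0Θ : (0 : ℝ) ∈ Θ := Finset.mem_insert_of_mem (Finset.mem_insert_self _ _)
  have hΘ0 : ∀ θ ∈ Θ, 0 ≤ θ := by
    intro θ hθ
    simp only [Θ, Finset.mem_insert, Finset.mem_filter, Finset.mem_image, Finset.mem_univ,
      true_and] at hθ
    rcases hθ with rfl | rfl | ⟨⟨y, rfl⟩, -⟩
    · exact hg.le
    · exact le_rfl
    · exact hf y
  have hΘle : ∀ θ ∈ Θ, θ ≤ g := by
    intro θ hθ
    simp only [Θ, Finset.mem_insert, Finset.mem_filter] at hθ
    rcases hθ with rfl | rfl | ⟨-, h⟩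
    · exact le_rfl
    · exact hg.le
    · exact h.le
  -- If all radii fail, `K * partSum + W` grows faster than the exponential with rate `lam`. At `0`
  -- this is weak; every later step gives strict inequality because the assumed failure is strict.
  have key : ∀ θ : Θ, W * Real.exp (lam * θ) ≤ K * partSum R c f θ + W ∧
      (0 < (θ : ℝ) → W * Real.exp (lam * θ) < K * partSum R c f θ + W) := by
    intro θ
    induction θ using WellFoundedLT.induction with
    | _ θ ih =>
      obtain ⟨θ, hθ⟩ := θ
      rcases (hΘ0 θ hθ).eq_or_lt with rfl | hpos
      · refine ⟨?_, fun h => absurd h (lt_irrefl _)⟩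
        have := mul_nonneg hK.le (hpart0 0)
        simp only [mul_zero, Real.exp_zero, mul_one]
        linarith
      suffices h : W * Real.exp (lam * θ) < K * partSum R c f θ + W from ⟨h.le, fun _ => h⟩
      have hne : (Θ.filter (· < θ)).Nonempty := ⟨0, Finset.mem_filter.2 ⟨h0Θ, hpos⟩⟩
      set θ' := (Θ.filter (· < θ)).max' hne with hθ'
      have hmem := (Θ.filter (· < θ)).max'_mem hne
      rw [← hθ', Finset.mem_filter] at hmem
      have hgap : ∀ y, f y ≤ θ' ∨ θ ≤ f y := by
        intro y
        by_contra hy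
        push Not at hy
        refine absurd ((Θ.filter (· < θ)).le_max' (f y) ?_) (not_le.2 hy.1)
        refine Finset.mem_filter.2 ⟨?_, hy.2⟩
        exact Finset.mem_insert_of_mem (Finset.mem_insert_of_mem (Finset.mem_filter.2
          ⟨Finset.mem_image_of_mem _ (Finset.mem_univ _), hy.2.trans_le (hΘle θ hθ)⟩))
      have ih' := (ih ⟨θ', hmem.1⟩ hmem.2).1
      have hθ'g : θ' < g := hmem.2.trans_le (hΘle θ hθ)
      have hcand : θ' = 0 ∨ ∃ y, θ' = f y := by
        have := hmem.1
        simp only [Θ, Finset.mem_insert, Finset.mem_filter, Finset.mem_image, Finset.mem_univ,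
          true_and] at this
        rcases this with h | h | ⟨⟨y, hy⟩, -⟩
        · exact absurd h hθ'g.ne
        · exact .inl h
        · exact .inr ⟨y, hy.symm⟩
      have hbad := hno θ' hθ'g hcand
      have h1 := hgrow θ' θ hmem.2 hgap
      have h2 : partSum R c f θ ≤ volSum R c l f θ' := hpart (fun u => f u ≤ θ') θ hgap
      have hΔ : 0 < θ - θ' := by linarith [hmem.2]
      set ψ := K * partSum R c f θ + W with hψ
      have hψ0 : 0 < ψ := by have := mul_nonneg hK.le (hpart0 θ); linarith
      have h3 : lam * ψ * (θ - θ') < K * cutSum R c f θ' * (θ - θ') := by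
        refine mul_lt_mul_of_pos_right (lt_of_le_of_lt ?_ hbad) hΔ
        refine mul_le_mul_of_nonneg_left ?_ hlam0
        have := mul_le_mul_of_nonneg_left h2 hK.le
        linarith
      -- The slope on the interval exceeds `lam * ψ`, because the volume of the ball of radius `θ'`
      -- dominates the partial volume at the right end `θ`. The next line uses `1 - x ≤ exp (-x)`.
      have h4 : K * partSum R c f θ' + W < ψ * (1 - lam * (θ - θ')) := by
        have := mul_le_mul_of_nonneg_left h1 hK.le
        have e1 : ψ * (1 - lam * (θ - θ')) = ψ - lam * ψ * (θ - θ') := by ring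
        have e2 : K * (partSum R c f θ' + cutSum R c f θ' * (θ - θ')) =
          K * partSum R c f θ' + K * cutSum R c f θ' * (θ - θ') := by ring
        rw [e1]; linarith
      have h5 : ψ * (1 - lam * (θ - θ')) ≤ ψ * Real.exp (-(lam * (θ - θ'))) :=
        mul_le_mul_of_nonneg_left (by have := Real.add_one_le_exp (-(lam * (θ - θ'))); linarith)
          hψ0.le
      have h6 : W * Real.exp (lam * θ') < ψ * Real.exp (-(lam * (θ - θ'))) :=
        lt_of_le_of_lt ih' (h4.trans_le h5)
      have h7 := mul_lt_mul_of_pos_right h6 (Real.exp_pos (lam * (θ - θ')))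
      rw [mul_assoc, mul_assoc, ← Real.exp_add, ← Real.exp_add] at h7
      have e3 : lam * θ' + lam * (θ - θ') = lam * θ := by ring
      rw [e3, neg_add_cancel, Real.exp_zero, mul_one] at h7
      exact h7
  -- At `g` the exponential factor is `1 + K` by the choice of `lam`, while the partial volume is at
  -- most `W`: the strict growth is impossible.
  have h1 := (key ⟨g, hgΘ⟩).2 hg
  have h2 : partSum R c f g ≤ W := hpart (fun u => f u < g) g fun u => lt_or_ge (f u) g
  have h3 : lam * g = Real.log (1 + K) := by rw [hlam]; field_simp
  simp only [h3] at h1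
  rw [Real.exp_log (by linarith)] at h1
  have := mul_le_mul_of_nonneg_left h2 hK.le
  linarith

end RegionGrowing

/-! ### Shortening walks to simple paths -/

section ShortPaths

variable {V : Type*} {G : SimpleGraph V} {l : Sym2 V → ℝ} {A : Set V}

/-- A walk as in `PathIn` that visits each vertex of `S` exactly once and no other vertex. -/
inductive SimplePathIn [DecidableEq V] (G : SimpleGraph V) (l : Sym2 V → ℝ) (A : Set V) :
    Finset V → V → V → ℕ → ℝ → Prop
  | refl {u : V} : u ∈ A → SimplePathIn G l A {u} u u 0 0
  | step {S : Finset V} {u v w : V} {k : ℕ} {d : ℝ} : SimplePathIn G l A S u v k d →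
      G.Adj v w → w ∈ A → w ∉ S → SimplePathIn G l A (insert w S) u w (k + 1) (d + l s(v, w))

theorem SimplePathIn.pathIn [DecidableEq V] {S : Finset V} {u v : V} {k : ℕ} {d : ℝ}
    (h : SimplePathIn G l A S u v k d) : PathIn G l A u v k d := by
  induction h with
  | refl h => exact .refl h
  | step _ ha hw _ ih => exact .step ih ha hw

theorem SimplePathIn.card [DecidableEq V] {S : Finset V} {u v : V} {k : ℕ} {d : ℝ}
    (h : SimplePathIn G l A S u v k d) : S.card = k + 1 := by
  induction h with
  | refl h => rfl
  | step _ ha hw hS ih => rw [Finset.card_insert_of_notMem hS, ih]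

theorem SimplePathIn.truncate [DecidableEq V] (hl : ∀ e ∈ G.edgeSet, 0 ≤ l e) {S : Finset V}
    {u v w : V} {k : ℕ} {d : ℝ}
    (h : SimplePathIn G l A S u v k d) (hw : w ∈ S) :
    ∃ S' k' d', d' ≤ d ∧ SimplePathIn G l A S' u w k' d' := by
  induction h with
  | refl h =>
    rw [Finset.mem_singleton] at hw
    subst hw
    exact ⟨_, _, _, le_rfl, .refl h⟩
  | @step S u v x k d hp ha hx hS ih =>
    rcases Finset.mem_insert.1 hw with rfl | hw
    · exact ⟨_, _, _, le_rfl, .step hp ha hx hS⟩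
    · obtain ⟨S', k', d', h1, h2⟩ := ih hw
      have : 0 ≤ l s(v, x) := hl _ ha
      exact ⟨S', k', d', by linarith, h2⟩

/-- Every walk can be shortened to one with fewer edges than there are vertices. -/
theorem PathIn.shorten [Fintype V] (hl : ∀ e ∈ G.edgeSet, 0 ≤ l e) {u v : V} {k : ℕ} {d : ℝ}
    (h : PathIn G l A u v k d) :
    ∃ k' d', k' < Fintype.card V ∧ d' ≤ d ∧ PathIn G l A u v k' d' := by
  classical
  suffices ∃ S k' d', d' ≤ d ∧ SimplePathIn G l A S u v k' d' by
    obtain ⟨S, k', d', hd, hp⟩ := this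
    refine ⟨k', d', ?_, hd, hp.pathIn⟩
    have := hp.card
    have := S.card_le_univ
    omega
  induction h with
  | refl h => exact ⟨_, _, _, le_rfl, .refl h⟩
  | @step v w k d hp ha hw ih =>
    obtain ⟨S, k', d', hd, hp⟩ := ih
    have : 0 ≤ l s(v, w) := hl _ ha
    by_cases hS : w ∈ S
    -- At a repeated vertex the loop is cut off, which does not lengthen the walk because lengths
    -- are nonnegative.
    · obtain ⟨S', k'', d'', hd', hp'⟩ := hp.truncate hl hS
      exact ⟨S', k'', d'', by linarith, hp'⟩
    · exact ⟨_, _, _, by linarith, .step hp ha hw hS⟩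

end ShortPaths

/-! ### The input part of the memory -/

section Environment

/-- The input is still in place. -/
structure Env (I : Instance) (s : State) : Prop where
  n : s.nat 0 0 0 = I.n
  m : s.nat 1 0 0 = I.m
  bag : ∀ w : Fin I.n, s.nat 2 w 0 = I.D.bag w
  parent : ∀ F : Fin I.m, s.nat 3 F 0 = I.D.parent F
  adj : ∀ u w : Fin I.n, s.nat 4 u w = 1 ↔ I.G.Adj u w
  c : ∀ u w : Fin I.n, I.G.Adj u w → s.val 0 u w = I.c s(u, w)
  l : ∀ u w : Fin I.n, I.G.Adj u w → s.val 1 u w = I.l s(u, w)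

variable {I : Instance} {s s' : State}

theorem Instance.input_env (I : Instance) : Env I I.input := by
  constructor
  · simp [Instance.input]
  · simp [Instance.input]
  · intro w; simp [Instance.input]
  · intro F; simp [Instance.input]
  · intro u w; simp [Instance.input]
  · intro u w h; simp [Instance.input, h]
  · intro u w h; simp [Instance.input, h]

theorem Env.congr (h : Env I s) (hN : ∀ A < 5, s'.nat A = s.nat A)
    (hV : ∀ A < 2, s'.val A = s.val A) : Env I s' where
  n := by rw [hN 0 (by norm_num), h.n]
  m := by rw [hN 1 (by norm_num), h.m]
  bag w := by rw [hN 2 (by norm_num), h.bag]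
  parent w := by rw [hN 3 (by norm_num), h.parent]
  adj u w := by rw [hN 4 (by norm_num), h.adj]
  c u w hu := by rw [hV 0 (by norm_num), h.c u w hu]
  l u w hu := by rw [hV 1 (by norm_num), h.l u w hu]

theorem Env.setNat (h : Env I s) {A i j k : ℕ} (hA : 5 ≤ A) : Env I (s.setNat A i j k) :=
  h.congr (fun _ hB => State.setNat_nat_ne (by omega)) fun _ _ => rfl

theorem Env.setVal (h : Env I s) {A i j : ℕ} {x : ℝ} (hA : 2 ≤ A) : Env I (s.setVal A i j x) :=
  h.congr (fun _ _ => rfl) fun _ hB => State.setVal_val_ne (by omega)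

theorem Env.run {P : Prg} (hP : P.wf = true) (h : Env I s) : Env I (P.run s) :=
  h.congr (fun _ hA => P.run_nat s (P.wN_of_wf hP hA)) fun _ hA => P.run_val s (P.wV_of_wf hP hA)

/-- The invariant rule for loops that leave the input in place. -/
theorem Env.loop {v B : ℕ} {P : Prg} (hE : Env I s) (hwf : (Prg.loop v B P).wf = true)
    (Inv : ℕ → State → Prop) (hv : ∀ j s k, Inv j s → Inv j (s.setNat v 0 0 k)) (h0 : Inv 0 s)
    (hs : ∀ j < s.nat B 0 0, ∀ s' : State, Env I s' →
      (∀ A, (Prg.loop v B P).wN A = false → s'.nat A = s.nat A) →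
      (∀ A, P.wV A = false → s'.val A = s.val A) →
      s'.nat v 0 0 = j → Inv j s' → Inv (j + 1) (P.run s')) :
    Inv (s.nat B 0 0) ((Prg.loop v B P).run s) :=
  Prg.loop_rule Inv (hv _ _ _ h0) fun j hj s' h1 h2 h3 h4 =>
    hv _ _ _ (hs j hj s' (hE.congr (fun A hA => h1 A (Prg.wN_of_wf _ hwf hA))
      fun A hA => h2 A (Prg.wV_of_wf (Prg.loop v B P) hwf hA)) h1 h2 h3 h4)

end Environment

/-! ### Partial sums as loop invariants -/

section Sums

/-- The sum of the first `j` values of `g`. -/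
noncomputable def partialSum {n : ℕ} (g : Fin n → ℝ) (j : ℕ) : ℝ := ∑ u, if u.val < j then g u else 0

theorem partialSum_zero {n : ℕ} (g : Fin n → ℝ) : partialSum g 0 = 0 := by simp [partialSum]

theorem partialSum_succ {n : ℕ} (g : Fin n → ℝ) {j : ℕ} (hj : j < n) :
    partialSum g (j + 1) = partialSum g j + g ⟨j, hj⟩ := by
  have h : ∀ u : Fin n, (if u.val < j + 1 then g u else 0) =
      (if u.val < j then g u else 0) + if u = ⟨j, hj⟩ then g u else 0 := by
    intro u
    rcases lt_trichotomy u.val j with h | h | h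
    · have : u ≠ ⟨j, hj⟩ := fun h' => by simp [h'] at h
      simp [h, this, Nat.lt_succ_of_lt h]
    · have : u = ⟨j, hj⟩ := Fin.ext h
      simp [this]
    · have : u ≠ ⟨j, hj⟩ := fun h' => by simp [h'] at h
      simp [this, not_lt.2 h.le, Nat.not_lt.2 (Nat.succ_le_of_lt h)]
  unfold partialSum
  rw [Finset.sum_congr rfl fun u _ => h u, Finset.sum_add_distrib]
  simp

theorem partialSum_self {n : ℕ} (g : Fin n → ℝ) : partialSum g n = ∑ u, g u := by simp [partialSum]

end Sums

/-! ### Abbreviations for expressions and tests -/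

section Expressions

/-- Entry `i` of the one-dimensional array `A`. -/
abbrev NExp.at (A : ℕ) (i : NExp) : NExp := .get A i (.lit 0)

abbrev VExp.at (A : ℕ) (i : NExp) : VExp := .get A i (.lit 0)

abbrev VExp.var (A : ℕ) : VExp := .get A (.lit 0) (.lit 0)

abbrev VExp.lit (k : ℕ) : VExp := .ofNat (.lit k)

def Cond.eq (a b : NExp) : Cond := .and (.le a b) (.le b a)

/-- `u` and `w` are adjacent. -/
def adjTest (u w : ℕ) : Cond := .eq (.get 4 (.var u) (.var w)) (.lit 1)

/-- Entry `u` of the array `A` is zero. -/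
def zeroTest (A u : ℕ) : Cond := .eq (.at A (.var u)) (.lit 0)

theorem Prg.run_ite_pos {p : Cond} {P Q : Prg} {s : State} (h : p.holds s) :
    (Prg.ite p P Q).run s = P.run s := if_pos h

theorem Prg.run_ite_neg {p : Cond} {P Q : Prg} {s : State} (h : ¬ p.holds s) :
    (Prg.ite p P Q).run s = Q.run s := if_neg h

theorem Cond.eq_holds {a b : NExp} {s : State} : (Cond.eq a b).holds s ↔ a.eval s = b.eval s := by
  simp only [Cond.eq, Cond.holds, le_antisymm_iff]

theorem adjTest_holds {u w : ℕ} {s : State} :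
    (adjTest u w).holds s ↔ s.nat 4 (s.nat u 0 0) (s.nat w 0 0) = 1 := Cond.eq_holds

theorem zeroTest_holds {A u : ℕ} {s : State} :
    (zeroTest A u).holds s ↔ s.nat A (s.nat u 0 0) 0 = 0 := Cond.eq_holds

end Expressions

/-! ### Summation over pairs of vertices -/

section DoubleLoop

variable {I : Instance} {s : State}

/-- A double loop over pairs of vertices that adds `g u w` to the variable `a`. -/
theorem Env.sum_loop {P : Prg} {a : ℕ} (hE : Env I s)
    (hwf : (Prg.loop 27 0 (Prg.loop 28 0 P)).wf = true) (g : Fin I.n → Fin I.n → ℝ)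
    (h : ∀ (u w : Fin I.n) (s' : State), Env I s' →
      (∀ A, (Prg.loop 27 0 (Prg.loop 28 0 P)).wN A = false → s'.nat A = s.nat A) →
      (∀ A, P.wV A = false → s'.val A = s.val A) → s'.nat 27 0 0 = u → s'.nat 28 0 0 = w →
      (P.run s').val a 0 0 = s'.val a 0 0 + g u w) :
    ((Prg.loop 27 0 (Prg.loop 28 0 P)).run s).val a 0 0 = s.val a 0 0 + ∑ u, ∑ w, g u w := by
  have hwf' : (Prg.loop 28 0 P).wf = true := by
    simp only [Prg.wf, Bool.and_eq_true] at hwf ⊢; exact hwf.2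
  have h27 : P.wN 27 = false := by
    simp only [Prg.wf, Prg.wN, Bool.and_eq_true, Bool.not_eq_true', Bool.or_eq_false_iff] at hwf
    exact hwf.1.2.2
  have key := hE.loop hwf
    (fun j s' => s'.val a 0 0 = s.val a 0 0 + partialSum (fun u => ∑ w, g u w) j)
    (fun _ _ _ h => h) (by simp [partialSum_zero]) ?_
  · rw [hE.n, partialSum_self] at key; exact key
  intro j hj s1 hE1 hN1 hV1 hj1 hI1
  rw [hE.n] at hj
  have key2 := hE1.loop hwf'
    (fun i s' => s'.val a 0 0 = s1.val a 0 0 + partialSum (fun w => g ⟨j, hj⟩ w) i)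
    (fun _ _ _ h => h) (by simp [partialSum_zero]) ?_
  · rw [hE1.n, partialSum_self] at key2
    rw [key2, hI1, partialSum_succ _ hj, add_assoc]
  intro i hi s2 hE2 hN2 hV2 hi2 hI2
  rw [hE1.n] at hi
  rw [partialSum_succ _ hi, ← add_assoc, ← hI2]
  refine h ⟨j, hj⟩ ⟨i, hi⟩ s2 hE2 (fun A hA => ?_) (fun A hA => ?_) ?_ hi2
  · rw [hN2 A, hN1 A hA]
    simp only [Prg.wN, Bool.or_eq_false_iff] at hA ⊢
    exact hA.2
  · rw [hV2 A hA, hV1 A hA]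
  · rw [hN2 27, hj1]
    simp only [Prg.wN, h27, Bool.or_false]
    decide

end DoubleLoop

/-! ### Distances by the Bellman–Ford method, capped at one -/

section BellmanFord

/-- Below `1`, `f` is the distance from `X` in the subgraph induced by `A`. -/
structure IsDist {V : Type*} (G : SimpleGraph V) (l : Sym2 V → ℝ) (A X : Set V) (f : V → ℝ) :
    Prop where
  nonneg : ∀ w, 0 ≤ f w
  zero : ∀ w ∈ X, f w = 0
  edge : ∀ u w, G.Adj u w → u ∈ A → w ∈ A → f w ≤ f u + l s(u, w)
  path : ∀ w, f w < 1 → ∃ x ∈ X, ∃ k d, d ≤ f w ∧ PathIn G l A x w k d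

theorem IsDist.le {V : Type*} {G : SimpleGraph V} {l : Sym2 V → ℝ} {A X : Set V} {f : V → ℝ}
    (h : IsDist G l A X f) {x w : V} {k : ℕ} {d : ℝ} (hx : x ∈ X) (hp : PathIn G l A x w k d) :
    f w ≤ d := by
  induction hp with
  | refl _ => exact (h.zero _ hx).le
  | step hp ha hw ih => exact (h.edge _ _ ha hp.right_mem hw).trans (by linarith)

/-- Improve the distance of `w` by the edge from `u`. -/
def relax : Prg :=
  .ite (.and (adjTest 27 28) (.and (zeroTest 7 27) (.and (zeroTest 7 28)
      (.not (.vle (.at 2 (.var 28)) (.add (.at 2 (.var 27)) (.get 1 (.var 27) (.var 28))))))))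
    (.setVal 2 (.var 28) (.lit 0) (.add (.at 2 (.var 27)) (.get 1 (.var 27) (.var 28)))) .skip

/-- Shortest paths among the vertices `w` whose entry in array `7` is zero. -/
def bellmanFord : Prg := .loop 26 0 (.loop 27 0 (.loop 28 0 relax))

/-- Every distance found so far is the length of a walk. -/
def Realized (I : Instance) (A X : Set (Fin I.n)) (f : ℕ → ℕ → ℝ) : Prop :=
  ∀ w : Fin I.n, 0 ≤ f w 0 ∧ f w 0 ≤ 1 ∧
    (f w 0 < 1 → ∃ x ∈ X, ∃ k, PathIn I.G I.l A x w k (f w 0))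

variable {I : Instance} {s : State} {A X : Set (Fin I.n)}

theorem relax_spec (hE : Env I s) (hA : ∀ w : Fin I.n, w ∈ A ↔ s.nat 7 w 0 = 0)
    (hf : Realized I A X (s.val 2)) {u w : Fin I.n} (hu : s.nat 27 0 0 = u)
    (hw : s.nat 28 0 0 = w) :
    Realized I A X ((relax.run s).val 2) ∧
      (∀ v : Fin I.n, (relax.run s).val 2 v 0 ≤ s.val 2 v 0) ∧
      (I.G.Adj u w → u ∈ A → w ∈ A → (relax.run s).val 2 w 0 ≤ s.val 2 u 0 + I.l s(u, w)) := by
  unfold relax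
  have hc : (Cond.and (adjTest 27 28) (.and (zeroTest 7 27) (.and (zeroTest 7 28)
      (.not (.vle (.at 2 (.var 28)) (.add (.at 2 (.var 27)) (.get 1 (.var 27) (.var 28)))))))).holds
        s ↔ I.G.Adj u w ∧ u ∈ A ∧ w ∈ A ∧ ¬ s.val 2 w 0 ≤ s.val 2 u 0 + s.val 1 u w := by
    simp only [Cond.holds, adjTest_holds, zeroTest_holds, NExp.eval, VExp.eval, hu, hw, hE.adj,
      ← hA]
  by_cases h : I.G.Adj u w ∧ u ∈ A ∧ w ∈ A ∧ ¬ s.val 2 w 0 ≤ s.val 2 u 0 + s.val 1 u w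
  · rw [Prg.run_ite_pos (hc.2 h)]
    simp only [Prg.run, NExp.eval, VExp.eval, hu, hw]
    obtain ⟨hadj, huA, hwA, hlt⟩ := h
    rw [hE.l u w hadj] at hlt ⊢
    have hl : 0 ≤ I.l s(u, w) := I.l_nonneg _ hadj
    have hval : ∀ v : Fin I.n, (s.setVal 2 w 0 (s.val 2 u 0 + I.l s(u, w))).val 2 v 0 =
        if v = w then s.val 2 u 0 + I.l s(u, w) else s.val 2 v 0 := by
      intro v; simp [State.setVal_val, Fin.ext_iff]
    refine ⟨fun v => ?_, fun v => ?_, fun _ _ _ => ?_⟩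
    · rw [hval]
      split_ifs with hv
      · subst hv
        have h1 := hf u
        have h2 := hf v
        refine ⟨by linarith, by linarith, fun _ => ?_⟩
        obtain ⟨x, hx, k, hp⟩ := h1.2.2 (by linarith)
        exact ⟨x, hx, _, .step hp hadj hwA⟩
      · exact hf v
    · rw [hval]
      split_ifs with hv
      · subst hv; linarith
      · exact le_rfl
    · rw [hval, if_pos rfl]
  · rw [Prg.run_ite_neg (mt hc.1 h)]
    refine ⟨hf, fun v => le_rfl, fun h1 h2 h3 => ?_⟩
    by_contra h4
    exact h ⟨h1, h2, h3, by rwa [hE.l u w h1]⟩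

theorem relax_round_spec (hE : Env I s) (hA : ∀ w : Fin I.n, w ∈ A ↔ s.nat 7 w 0 = 0)
    (hf : Realized I A X (s.val 2)) {s1 : State} (hs1 : s1 = (Prg.loop 27 0 (.loop 28 0 relax)).run s) :
    Realized I A X (s1.val 2) ∧ (∀ v : Fin I.n, s1.val 2 v 0 ≤ s.val 2 v 0) ∧
      (∀ u w : Fin I.n, I.G.Adj u w → u ∈ A → w ∈ A →
        s1.val 2 w 0 ≤ s.val 2 u 0 + I.l s(u, w)) := by
  have key := hE.loop (v := 27) (B := 0) (P := .loop 28 0 relax) rfl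
    (fun j s1 => Realized I A X (s1.val 2) ∧ (∀ v : Fin I.n, s1.val 2 v 0 ≤ s.val 2 v 0) ∧
      (∀ u w : Fin I.n, u.val < j → I.G.Adj u w → u ∈ A → w ∈ A →
        s1.val 2 w 0 ≤ s.val 2 u 0 + I.l s(u, w)))
    (fun _ _ _ h => h) ⟨hf, fun _ => le_rfl, fun u w h => absurd h (Nat.not_lt_zero _)⟩ ?_
  · rw [hE.n, ← hs1] at key
    exact ⟨key.1, key.2.1, fun u w => key.2.2 u w u.2⟩
  rintro j hj s2 hE2 hN2 hV2 hj2 ⟨hf2, hle2, hedge2⟩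
  rw [hE.n] at hj
  have hA2 : ∀ w : Fin I.n, w ∈ A ↔ s2.nat 7 w 0 = 0 := fun w => by rw [hN2 7 rfl, hA]
  have key2 := hE2.loop (v := 28) (B := 0) (P := relax) rfl
    (fun i s3 => Realized I A X (s3.val 2) ∧ (∀ v : Fin I.n, s3.val 2 v 0 ≤ s2.val 2 v 0) ∧
      (∀ w : Fin I.n, w.val < i → I.G.Adj ⟨j, hj⟩ w → (⟨j, hj⟩ : Fin I.n) ∈ A → w ∈ A →
        s3.val 2 w 0 ≤ s2.val 2 j 0 + I.l s(⟨j, hj⟩, w)))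
    (fun _ _ _ h => h) ⟨hf2, fun _ => le_rfl, fun w h => absurd h (Nat.not_lt_zero _)⟩ ?_
  · rw [hE2.n] at key2
    obtain ⟨h1, h2, h3⟩ := key2
    refine ⟨h1, fun v => (h2 v).trans (hle2 v), fun u w hu ha huA hwA => ?_⟩
    rcases Nat.lt_succ_iff_lt_or_eq.1 hu with hu | hu
    · exact (h2 w).trans (hedge2 u w hu ha huA hwA)
    · obtain rfl : u = ⟨j, hj⟩ := Fin.ext hu
      have := h3 w w.2 ha huA hwA
      have := hle2 ⟨j, hj⟩
      simp only at *
      linarith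
  rintro i hi s3 hE3 hN3 hV3 hi3 ⟨hf3, hle3, hedge3⟩
  rw [hE2.n] at hi
  have hA3 : ∀ w : Fin I.n, w ∈ A ↔ s3.nat 7 w 0 = 0 := fun w => by rw [hN3 7 rfl, hA2]
  obtain ⟨h1, h2, h3⟩ := relax_spec hE3 hA3 hf3 (u := ⟨j, hj⟩) (w := ⟨i, hi⟩)
    (by rw [hN3 27 rfl, hj2]) hi3
  refine ⟨h1, fun v => (h2 v).trans (hle3 v), fun w hw ha huA hwA => ?_⟩
  rcases Nat.lt_succ_iff_lt_or_eq.1 hw with hw | hw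
  · exact (h2 w).trans (hedge3 w hw ha huA hwA)
  · obtain rfl : w = ⟨i, hi⟩ := Fin.ext hw
    have := h3 ha huA hwA
    have := hle3 ⟨j, hj⟩
    simp only at *
    linarith

theorem bellmanFord_spec (hE : Env I s) (hA : ∀ w : Fin I.n, w ∈ A ↔ s.nat 7 w 0 = 0)
    (hXA : X ⊆ A) (hX : ∀ w ∈ X, s.val 2 w 0 = 0) (hX' : ∀ w ∉ X, s.val 2 w 0 = 1) :
    IsDist I.G I.l A X fun w => (bellmanFord.run s).val 2 w 0 := by
  have hf : Realized I A X (s.val 2) := by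
    intro w
    by_cases hw : w ∈ X
    · rw [hX w hw]
      exact ⟨le_rfl, zero_le_one, fun _ => ⟨w, hw, 0, .refl (hXA hw)⟩⟩
    · rw [hX' w hw]
      exact ⟨zero_le_one, le_rfl, fun h => absurd h (lt_irrefl _)⟩
  -- Updates happen in place, so after `j` rounds a value may belong to a walk with more than `j`
  -- edges. The invariant claims only that values are realized by walks below `1`, and beat all
  -- walks with at most `j` edges.
  have key := hE.loop (v := 26) (B := 0) (P := .loop 27 0 (.loop 28 0 relax)) rfl
    (fun j s1 => Realized I A X (s1.val 2) ∧ (∀ v : Fin I.n, s1.val 2 v 0 ≤ s.val 2 v 0) ∧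
      ∀ (x w : Fin I.n) (k : ℕ) (d : ℝ), x ∈ X → PathIn I.G I.l A x w k d → k ≤ j →
        s1.val 2 w 0 ≤ d)
    (fun _ _ _ h => h) ⟨hf, fun _ => le_rfl, ?_⟩ ?_
  · rw [hE.n] at key
    change _ ∧ _ ∧ _ at key
    obtain ⟨h1, h2, h3⟩ := key
    refine ⟨fun w => (h1 w).1, fun w hw => ?_, fun u w ha hu hw => ?_,
      fun w hw => ?_⟩
    · exact le_antisymm ((h2 w).trans (hX w hw).le) (h1 w).1
    · have hl : 0 ≤ I.l s(u, w) := I.l_nonneg _ ha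
      change ((Prg.loop 26 0 (.loop 27 0 (.loop 28 0 relax))).run s).val 2 w 0 ≤
        ((Prg.loop 26 0 (.loop 27 0 (.loop 28 0 relax))).run s).val 2 u 0 + _
      -- At the cap `1` the inequality is trivial. Below it, the extended walk is shortened to fewer
      -- than `n` edges and so is accounted for after `n` rounds.
      rcases (h1 u).2.1.eq_or_lt with hu1 | hu1
      · rw [hu1]; have := (h1 w).2.1; linarith
      · obtain ⟨x, hx, k, hp⟩ := (h1 u).2.2 hu1
        obtain ⟨k', d', hk', hd', hp'⟩ := (PathIn.step hp ha hw).shorten I.l_nonneg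
        rw [Fintype.card_fin] at hk'
        exact (h3 x w k' d' hx hp' hk'.le).trans hd'
    · obtain ⟨x, hx, k, hp⟩ := (h1 w).2.2 hw
      exact ⟨x, hx, k, _, le_rfl, hp⟩
  · intro x w k d hx hp hk
    obtain rfl : k = 0 := by omega
    cases hp with
    | refl _ => exact (hX _ hx).le
  · rintro j hj s1 hE1 hN1 hV1 hj1 ⟨hf1, hle1, hp1⟩
    obtain ⟨h1, h2, h3⟩ := relax_round_spec hE1 (A := A) (fun w => by rw [hN1 7 rfl, hA]) hf1 rfl
    refine ⟨h1, fun v => (h2 v).trans (hle1 v), fun x w k d hx hp hk => ?_⟩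
    cases hp with
    | refl _ => exact (h2 _).trans ((hle1 _).trans (hX _ hx).le)
    | @step v w k d hp ha hw =>
      have := hp1 x v k d hx hp (by omega)
      exact (h3 v w ha hp.right_mem hw).trans (by linarith)

end BellmanFord

/-! ### The radius of smallest ratio satisfies the region growing bound -/

section Selection

variable {V : Type*} [Fintype V] {R : V → V → Prop} {c l : V → V → ℝ} {f : V → ℝ}

theorem volSum_nonneg (hcl : ∀ u w, R u w → 0 ≤ c u w * l u w) (θ : ℝ) : 0 ≤ volSum R c l f θ :=
  Finset.sum_nonneg fun u _ => Finset.sum_nonneg fun w _ => by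
    split_ifs with h
    · exact hcl u w h.1
    · exact le_rfl

theorem totSum_nonneg (hcl : ∀ u w, R u w → 0 ≤ c u w * l u w) (g : ℝ) : 0 ≤ totSum R c l f g :=
  Finset.sum_nonneg fun u _ => Finset.sum_nonneg fun w _ => by
    split_ifs with h
    · exact hcl u w h.1
    · exact le_rfl

/-- A pair leaving the ball has positive length by the Lipschitz condition; its volume is zero, so
its capacity is zero. -/
theorem cutSum_eq_zero (hcl : ∀ u w, R u w → 0 ≤ c u w * l u w)
    (hlip : ∀ u w, R u w → f w ≤ f u + l u w) {g θ : ℝ} (h0 : totSum R c l f g = 0) (hθ : θ < g) :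
    cutSum R c f θ = 0 := by
  classical
  have hterm : ∀ u w, 0 ≤ (if R u w ∧ f u < g then c u w * l u w else 0) := fun u w => by
    split_ifs with h
    · exact hcl u w h.1
    · exact le_rfl
  refine Finset.sum_eq_zero fun u _ => Finset.sum_eq_zero fun w _ => ?_
  split_ifs with h
  · obtain ⟨h1, h2, h3⟩ := h
    have h4 := (Finset.sum_eq_zero_iff_of_nonneg fun u _ =>
      Finset.sum_nonneg fun w _ => hterm u w).1 h0 u (Finset.mem_univ _)
    have h5 := (Finset.sum_eq_zero_iff_of_nonneg fun w _ => hterm u w).1 h4 w (Finset.mem_univ _)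
    rw [if_pos ⟨h1, by linarith⟩] at h5
    rcases mul_eq_zero.1 h5 with h6 | h6
    · exact h6
    · have := hlip u w h1; linarith
  · rfl

/-- A radius of smallest ratio of cut to volume has small cut. -/
theorem cutSum_le_of_minimal (hc : ∀ u w, R u w → 0 ≤ c u w) (hl : ∀ u w, R u w → 0 ≤ l u w)
    (hf : ∀ u, 0 ≤ f u) (hlip : ∀ u w, R u w → f w ≤ f u + l u w) {g K b : ℝ} (hg : 0 < g)
    (hK : 0 < K) (hb : b < g)
    (hmin : ∀ θ < g, (θ = 0 ∨ ∃ y, θ = f y) →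
      cutSum R c f b * (K * volSum R c l f θ + totSum R c l f g) ≤
        cutSum R c f θ * (K * volSum R c l f b + totSum R c l f g)) :
    K * cutSum R c f b ≤
      Real.log (1 + K) / g * (K * volSum R c l f b + totSum R c l f g) := by
  have hcl : ∀ u w, R u w → 0 ≤ c u w * l u w := fun u w h => mul_nonneg (hc u w h) (hl u w h)
  have hv := volSum_nonneg (f := f) hcl
  have hlam : 0 ≤ Real.log (1 + K) / g := div_nonneg (Real.log_nonneg (by linarith)) hg.le
  rcases (totSum_nonneg (f := f) hcl g).eq_or_lt with hW | hW
  · rw [cutSum_eq_zero hcl hlip hW.symm hb, mul_zero, ← hW]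
    exact mul_nonneg hlam (add_nonneg (mul_nonneg hK.le (hv _)) le_rfl)
  obtain ⟨θ, hθ, hcand, hle⟩ := exists_threshold hc hl hf hlip hg hK
  have h1 := hmin θ hθ hcand
  set h : ℝ → ℝ := fun θ => K * volSum R c l f θ + totSum R c l f g with hh
  have hpos : ∀ θ, 0 < h θ := fun θ => add_pos_of_nonneg_of_pos (mul_nonneg hK.le (hv θ)) hW
  -- The radius `θ` from `exists_threshold` has a good ratio, and that of `b` is no worse; the
  -- ratios are compared after multiplication by both denominators.
  refine le_of_mul_le_mul_right ?_ (hpos θ)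
  calc K * cutSum R c f b * h θ = K * (cutSum R c f b * h θ) := by ring
    _ ≤ K * (cutSum R c f θ * h b) := mul_le_mul_of_nonneg_left h1 hK.le
    _ = K * cutSum R c f θ * h b := by ring
    _ ≤ Real.log (1 + K) / g * h θ * h b := mul_le_mul_of_nonneg_right hle (hpos b).le
    _ = Real.log (1 + K) / g * h b * h θ := by ring

end Selection

/-! ### Clusters and the accounting of their cost -/

section Clusterings

section Ball

variable {V : Type*} {cl : V → Option V}

open Classical in
/-- Add a ball to the clusters. -/
noncomputable def addBall (cl : V → Option V) (f : V → ℝ) (θ : ℝ) (x w : V) : Option V :=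
  if cl w = none ∧ f w ≤ θ then some x else cl w

theorem addBall_ne_none {f : V → ℝ} {θ : ℝ} {x w : V} (h : cl w ≠ none ∨ f w ≤ θ) :
    addBall cl f θ x w ≠ none := by
  unfold addBall
  split_ifs with h'
  · simp
  · tauto

end Ball

variable {V ι κ : Type*} [Fintype V] (G : SimpleGraph V) (c l : Sym2 V → ℝ)

open Classical in
/-- The capacity of the pairs with different labels. -/
noncomputable def cutCost (cl : V → Option κ) : ℝ :=
  ∑ u, ∑ w, if G.Adj u w ∧ cl u ≠ cl w then c s(u, w) else 0

open Classical in
/-- The volume of the pairs without labels. -/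
noncomputable def remVol (cl : V → Option κ) : ℝ :=
  ∑ u, ∑ w, if G.Adj u w ∧ cl u = none ∧ cl w = none then c s(u, w) * l s(u, w) else 0

open Classical in
/-- The volume of the pairs, weighted by the number of charges. -/
noncomputable def chargeVol (q : V → ℕ) : ℝ :=
  ∑ u, ∑ w, if G.Adj u w then c s(u, w) * l s(u, w) * q u else 0

/-- The clusters formed by the labels contain all covered vertices, have small radius, and are paid
for by the volume inside of them and by the charges `q`. -/
structure IsClustering (K : ℝ) (net : V → Option ι) (cl : V → Option V) (q : V → ℕ) : Prop where
  covered : ∀ w, net w ≠ none → cl w ≠ none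
  radius : ∀ w x, cl w = some x → ∃ k d, d < 1 / 2 ∧ PathIn G l Set.univ x w k d
  cost : K * cutCost G c cl ≤ 2 * (Real.log (1 + K) / (1 / 6)) *
    (K * (remVol G c l (fun _ => none : V → Option V) - remVol G c l cl) + chargeVol G c l q)

variable {G c l} {K : ℝ} {net : V → Option ι} {cl : V → Option V} {q : V → ℕ} {D : TreePartition G ι}

theorem isClustering_none : IsClustering G c l K (fun _ => none : V → Option ι) (fun _ => none) 0 where
  covered _ h := absurd rfl h
  radius _ _ h := by cases h
  cost := by simp [cutCost, chargeVol]

/-- The unlabelled adjacent pairs. -/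
def Free (G : SimpleGraph V) (cl : V → Option κ) (u w : V) : Prop :=
  G.Adj u w ∧ cl u = none ∧ cl w = none

/-- Clusters contain all covered vertices, so unlabelled pairs lie in the graph in which distances
are measured. This supplies the Lipschitz condition for region growing. -/
theorem IsClustering.mem_alive (h : IsClustering G c l K net cl q) {w : V} (hw : cl w = none) :
    w ∈ alive net := by
  by_contra h'
  exact h.covered w h' hw

/-- The volume of pairs starting in the ball is paid once, since one endpoint becomes labelled and
the pair leaves `remVol`. The total volume within `1 / 6` is paid by the new charges of the centre.
-/
theorem IsClustering.addBall (hc : ∀ e ∈ G.edgeSet, 0 ≤ c e) (hl : ∀ e ∈ G.edgeSet, 0 ≤ l e)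
    (hK : 0 < K) (h : IsClustering G c l K net cl q) {x : V} {f : V → ℝ} {θ : ℝ}
    (hf : IsDist G l (alive net) {w | Seed D l net x w} f) (hθ : θ < 1 / 6)
    (hcut : K * cutSum (Free G cl) (fun u w => c s(u, w)) f θ ≤ Real.log (1 + K) / (1 / 6) *
      (K * volSum (Free G cl) (fun u w => c s(u, w)) (fun u w => l s(u, w)) f θ +
        totSum (Free G cl) (fun u w => c s(u, w)) (fun u w => l s(u, w)) f (1 / 6))) :
    IsClustering G c l K net (addBall cl f θ x) (q + chargeAt D l net x) := by
  classical
  have hcl : ∀ u w, G.Adj u w → 0 ≤ c s(u, w) * l s(u, w) := fun u w h =>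
    mul_nonneg (hc _ h) (hl _ h)
  refine ⟨fun w hw => addBall_ne_none (.inl (h.covered w hw)), fun w y hy => ?_, ?_⟩
  · unfold SmallDiam.addBall at hy
    split_ifs at hy with hw
    · obtain rfl := Option.some_inj.1 hy
      -- At most `1 / 3` from the centre to a vertex it covers, and less than `1 / 6` from there.
      obtain ⟨p, ⟨-, -, k, d, hd, hp⟩, k', d', hd', hp'⟩ := hf.path w (by linarith)
      exact ⟨_, _, by linarith, (hp.trans hp').mono (Set.subset_univ _)⟩
    · exact h.radius w y hy
  -- `cutCost` runs over ordered pairs and sees a new cut edge once out of the ball and once into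
  -- it, whereas `cutSum` sees only the first; hence the factor `2`.
  · have hsym : cutSum (Free G cl) (fun u w => c s(u, w)) f θ =
        ∑ u, ∑ w, if Free G cl w u ∧ f w ≤ θ ∧ ¬ f u ≤ θ then c s(u, w) else 0 := by
      unfold cutSum
      rw [Finset.sum_comm]
      simp only [Sym2.eq_swap]
    have h1 : cutCost G c (SmallDiam.addBall cl f θ x) ≤
        cutCost G c cl + 2 * cutSum (Free G cl) (fun u w => c s(u, w)) f θ := by
      rw [two_mul]
      nth_rewrite 2 [hsym]
      unfold cutCost cutSum
      simp only [← Finset.sum_add_distrib]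
      refine Finset.sum_le_sum fun u _ => Finset.sum_le_sum fun w _ => ?_
      by_cases ha : G.Adj u w
      · have hcu : 0 ≤ c s(u, w) := hc _ ha
        simp only [Free, ha, ha.symm, true_and, SmallDiam.addBall]
        rcases cl u with _ | y <;> rcases cl w with _ | z <;> by_cases hu' : f u ≤ θ <;>
          by_cases hw' : f w ≤ θ <;> simp [hu', hw']
        all_goals split_ifs <;> first | exact hcu | exact le_rfl
      · simp [Free, ha, mt SimpleGraph.Adj.symm ha]
    have h2 : remVol G c l (SmallDiam.addBall cl f θ x) +
        volSum (Free G cl) (fun u w => c s(u, w)) (fun u w => l s(u, w)) f θ ≤ remVol G c l cl := by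
      unfold remVol volSum
      simp only [← Finset.sum_add_distrib]
      refine Finset.sum_le_sum fun u _ => Finset.sum_le_sum fun w _ => ?_
      by_cases ha : G.Adj u w
      · have hcu := hcl u w ha
        simp only [Free, ha, true_and, SmallDiam.addBall]
        by_cases hu : cl u = none <;> by_cases hw : cl w = none <;> by_cases hu' : f u ≤ θ <;>
          by_cases hw' : f w ≤ θ <;> simp [hu, hw, hu', hw', hcu]
      · simp [Free, ha]
    have h3 : chargeVol G c l q +
        totSum (Free G cl) (fun u w => c s(u, w)) (fun u w => l s(u, w)) f (1 / 6) ≤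
        chargeVol G c l (q + chargeAt D l net x) := by
      unfold chargeVol totSum
      simp only [← Finset.sum_add_distrib]
      refine Finset.sum_le_sum fun u _ => Finset.sum_le_sum fun w _ => ?_
      by_cases ha : G.Adj u w
      · have hcu := hcl u w ha
        simp only [Free, ha, true_and, if_true, Pi.add_apply, Nat.cast_add, mul_add]
        gcongr
        split_ifs with hu
        -- A vertex of value less than `1 / 6` is joined by a walk of such length to a vertex
        -- covered by `x`, so `x` charges it.
        · obtain ⟨p, hp, k, d, hd, hpath⟩ := hf.path u (by linarith [hu.2])
          rw [chargeAt, if_pos ⟨p, k, d, hp, by linarith [hu.2], hpath⟩, Nat.cast_one, mul_one]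
        · positivity
      · simp [Free, ha]
    have hlam : 0 ≤ Real.log (1 + K) / (1 / 6) :=
      div_nonneg (Real.log_nonneg (by linarith)) (by norm_num)
    have h4 := h.cost
    set lam := Real.log (1 + K) / (1 / 6)
    set a := cutSum (Free G cl) (fun u w => c s(u, w)) f θ
    set b := volSum (Free G cl) (fun u w => c s(u, w)) (fun u w => l s(u, w)) f θ
    set t := totSum (Free G cl) (fun u w => c s(u, w)) (fun u w => l s(u, w)) f (1 / 6)
    set R₀ := remVol G c l (fun _ => none : V → Option V)
    set R₁ := remVol G c l cl
    calc K * cutCost G c (SmallDiam.addBall cl f θ x) ≤ K * (cutCost G c cl + 2 * a) :=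
          mul_le_mul_of_nonneg_left h1 hK.le
      _ = K * cutCost G c cl + 2 * (K * a) := by ring
      _ ≤ 2 * lam * (K * (R₀ - R₁) + chargeVol G c l q) + 2 * (lam * (K * b + t)) := by linarith
      _ = 2 * lam * (K * (R₀ - (R₁ - b)) + (chargeVol G c l q + t)) := by ring
      _ ≤ _ := by
        refine mul_le_mul_of_nonneg_left (add_le_add (mul_le_mul_of_nonneg_left ?_ hK.le) h3)
          (by positivity)
        linarith

end Clusterings

/-! ### Loops that treat the vertices independently -/

section Loops

variable {I : Instance} {s : State}

/-- A loop over the vertices whose body changes data of the current vertex only. -/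
theorem Env.map_loop {v : ℕ} {P : Prg} (hE : Env I s) (hwf : (Prg.loop v 0 P).wf = true)
    (Pre Post : Fin I.n → State → Prop)
    (hPre : ∀ u s k, Pre u s → Pre u (s.setNat v 0 0 k))
    (hPost : ∀ u s k, Post u s → Post u (s.setNat v 0 0 k)) (h0 : ∀ u, Pre u s)
    (hs : ∀ (u : Fin I.n) (s' : State), Env I s' →
      (∀ A, (Prg.loop v 0 P).wN A = false → s'.nat A = s.nat A) →
      (∀ A, P.wV A = false → s'.val A = s.val A) → s'.nat v 0 0 = u → Pre u s' →
      Post u (P.run s') ∧ ∀ w ≠ u, (Pre w s' → Pre w (P.run s')) ∧ (Post w s' → Post w (P.run s'))) :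
    ∀ u, Post u ((Prg.loop v 0 P).run s) := by
  have key := hE.loop hwf (fun j s' => (∀ u : Fin I.n, u.val < j → Post u s') ∧
    ∀ u : Fin I.n, j ≤ u.val → Pre u s')
    (fun j s k h => ⟨fun u hu => hPost _ _ _ (h.1 u hu), fun u hu => hPre _ _ _ (h.2 u hu)⟩)
    ⟨fun u hu => absurd hu (Nat.not_lt_zero _), fun u _ => h0 u⟩ ?_
  · rw [hE.n] at key
    exact fun u => key.1 u u.2
  rintro j hj s' hE' hN hV hj' ⟨h1, h2⟩
  rw [hE.n] at hj
  obtain ⟨h3, h4⟩ := hs ⟨j, hj⟩ s' hE' hN hV hj' (h2 ⟨j, hj⟩ le_rfl)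
  refine ⟨fun u hu => ?_, fun u hu => ?_⟩
  · by_cases h : u = ⟨j, hj⟩
    · exact h ▸ h3
    · exact (h4 u h).2 (h1 u (by have : u.val ≠ j := fun h' => h (Fin.ext h'); omega))
  · have h : u ≠ ⟨j, hj⟩ := fun h => by rw [h] at hu; simp at hu
    exact (h4 u h).1 (h2 u (by omega))

/-- The entry that represents an optional label. -/
def code {k : ℕ} (o : Option (Fin k)) : ℕ := o.elim 0 fun x => x + 1

theorem code_eq_zero {k : ℕ} {o : Option (Fin k)} : code o = 0 ↔ o = none := by
  cases o <;> simp [code]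

theorem code_inj {k : ℕ} {o o' : Option (Fin k)} : code o = code o' ↔ o = o' := by
  cases o <;> cases o' <;> simp [code, Fin.ext_iff]

end Loops

/-! ### Sums over unlabelled adjacent pairs -/

section PairSums

/-- Sum `e` over the adjacent unlabelled pairs that pass the test `p` into the variable `a`. -/
def pairSum (a : ℕ) (p : Cond) (e : VExp) : Prg :=
  .seq (.setVal a (.lit 0) (.lit 0) (.lit 0))
    (.loop 27 0 (.loop 28 0 (.ite (.and (adjTest 27 28) (.and (zeroTest 8 27)
      (.and (zeroTest 8 28) p))) (.setVal a (.lit 0) (.lit 0) (.add (.var a) e)) .skip)))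

variable {I : Instance} {s : State}

open Classical in
theorem Env.pairSum (hE : Env I s) {a : ℕ} {p : Cond} {e : VExp}
    (hwf : (pairSum a p e).wf = true) {cl : Fin I.n → Option (Fin I.n)}
    (hcl : ∀ w : Fin I.n, s.nat 8 w 0 = code (cl w)) (q : Fin I.n → Fin I.n → Prop)
    (g : Fin I.n → Fin I.n → ℝ)
    (h : ∀ (u w : Fin I.n) (s' : State), Env I s' → (∀ A, A ≠ a → s'.val A = s.val A) →
      s'.nat 27 0 0 = u → s'.nat 28 0 0 = w →
      (p.holds s' ↔ q u w) ∧ (I.G.Adj u w → e.eval s' = g u w)) :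
    ((SmallDiam.pairSum a p e).run s).val a 0 0 =
      ∑ u, ∑ w, if Free I.G cl u w ∧ q u w then g u w else 0 := by
  have hwf1 := hwf
  simp only [SmallDiam.pairSum, Prg.wf, Bool.and_eq_true] at hwf1
  have hE' : Env I ((Prg.setVal a (.lit 0) (.lit 0) (.lit 0)).run s) :=
    hE.run (by simp only [Prg.wf, Bool.and_eq_true]; exact hwf1.1)
  have key := hE'.sum_loop (a := a) (P := .ite (.and (adjTest 27 28) (.and (zeroTest 8 27)
      (.and (zeroTest 8 28) p))) (.setVal a (.lit 0) (.lit 0) (.add (.var a) e)) .skip)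
    (by simp only [Prg.wf, Bool.and_eq_true]; exact hwf1.2)
    (fun u w => if Free I.G cl u w ∧ q u w then g u w else 0) ?_
  · refine key.trans ?_
    simp [Prg.run, State.setVal_val, NExp.eval, VExp.eval]
  intro u w s' hE2 hN hV hu hw
  have hs0 : ∀ A, A ≠ a → s'.val A = s.val A := fun A hA => by
    rw [hV A (by simp [Prg.wV, hA.symm])]
    exact State.setVal_val_ne hA
  have hs8 : ∀ w : Fin I.n, s'.nat 8 w 0 = code (cl w) := fun w => by
    rw [hN 8 rfl]; exact hcl w
  obtain ⟨h1, h2⟩ := h u w s' hE2 hs0 hu hw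
  have hc : (Cond.and (adjTest 27 28) (.and (zeroTest 8 27) (.and (zeroTest 8 28) p))).holds s' ↔
      Free I.G cl u w ∧ q u w := by
    simp only [Cond.holds, adjTest_holds, zeroTest_holds, hu, hw, hE2.adj, hs8, code_eq_zero, h1,
      Free, and_assoc]
  by_cases hif : Free I.G cl u w ∧ q u w
  · rw [Prg.run_ite_pos (hc.2 hif), if_pos hif, ← h2 hif.1.1]
    simp [Prg.run, State.setVal_val, NExp.eval, VExp.eval]
  · rw [Prg.run_ite_neg (mt hc.1 hif), if_neg hif, add_zero]
    rfl

end PairSums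

/-! ### Computing cut and volume of a ball -/

section Balls

/-- Twice the square of the width. -/
abbrev widthExp : VExp := .ofNat (.mul (.lit 2) (.mul (.var 12) (.var 12)))

/-- The distance of the vertex in the variable `v` is less than `1 / 6`. -/
def nearTest (v : ℕ) : Cond := .not (.vle (.lit 1) (.mul (.lit 6) (.at 2 (.var v))))

/-- The distance of the vertex in the variable `v` is at most the radius. -/
def ballTest (v : ℕ) : Cond := .vle (.at 2 (.var v)) (.var 6)

def evalTotal : Prg :=
  pairSum 5 (nearTest 27) (.mul (.get 0 (.var 27) (.var 28)) (.get 1 (.var 27) (.var 28)))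

/-- Compute the cut and the volume of the ball. -/
def evalBall : Prg :=
  .seq (pairSum 3 (.and (ballTest 27) (.not (ballTest 28))) (.get 0 (.var 27) (.var 28)))
    (pairSum 4 (ballTest 27) (.mul (.get 0 (.var 27) (.var 28)) (.get 1 (.var 27) (.var 28))))

variable {I : Instance} {s : State} {cl : Fin I.n → Option (Fin I.n)} {f : Fin I.n → ℝ}

/-- Capacities and lengths of pairs. -/
abbrev Instance.cap (I : Instance) (u w : Fin I.n) : ℝ := I.c s(u, w)

abbrev Instance.len (I : Instance) (u w : Fin I.n) : ℝ := I.l s(u, w)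

theorem nearTest_holds {v : ℕ} (hf : ∀ w : Fin I.n, s.val 2 w 0 = f w) {u : Fin I.n}
    (hu : s.nat v 0 0 = u) : (nearTest v).holds s ↔ f u < 1 / 6 := by
  simp only [nearTest, Cond.holds, VExp.eval, NExp.eval, hu, hf]
  push_cast
  constructor <;> intro h <;> [skip; intro h'] <;> linarith

theorem ballTest_holds {v : ℕ} (hf : ∀ w : Fin I.n, s.val 2 w 0 = f w) {u : Fin I.n}
    (hu : s.nat v 0 0 = u) : (ballTest v).holds s ↔ f u ≤ s.val 6 0 0 := by
  simp only [ballTest, Cond.holds, VExp.eval, NExp.eval, hu, hf]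

theorem evalTotal_spec (hE : Env I s) (hcl : ∀ w : Fin I.n, s.nat 8 w 0 = code (cl w))
    (hf : ∀ w : Fin I.n, s.val 2 w 0 = f w) :
    (evalTotal.run s).val 5 0 0 = totSum (Free I.G cl) I.cap I.len f (1 / 6) := by
  refine (hE.pairSum rfl hcl (fun u _ => f u < 1 / 6)
    (fun u w => I.cap u w * I.len u w) ?_).trans (by unfold totSum; congr!)
  intro u w s' hE' hV hu hw
  refine ⟨nearTest_holds (fun w => by rw [hV 2 (by norm_num), hf]) hu, fun ha => ?_⟩
  simp only [VExp.eval, NExp.eval, hu, hw, hE'.c u w ha, hE'.l u w ha]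

theorem evalBall_spec (hE : Env I s) (hcl : ∀ w : Fin I.n, s.nat 8 w 0 = code (cl w))
    (hf : ∀ w : Fin I.n, s.val 2 w 0 = f w) :
    (evalBall.run s).val 3 0 0 = cutSum (Free I.G cl) I.cap f (s.val 6 0 0) ∧
      (evalBall.run s).val 4 0 0 = volSum (Free I.G cl) I.cap I.len f (s.val 6 0 0) := by
  constructor
  · rw [evalBall, Prg.run, Prg.run_val _ rfl]
    refine (hE.pairSum (a := 3) (p := .and (ballTest 27) (.not (ballTest 28)))
      (e := .get 0 (.var 27) (.var 28)) rfl hcl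
      (fun u w => f u ≤ s.val 6 0 0 ∧ ¬ f w ≤ s.val 6 0 0) I.cap ?_).trans (by unfold cutSum; congr!)
    intro u w s' hE' hV hu hw
    have hf' : ∀ w : Fin I.n, s'.val 2 w 0 = f w := fun w => by rw [hV 2 (by norm_num), hf]
    refine ⟨?_, fun ha => ?_⟩
    · rw [← hV 6 (by norm_num), Cond.holds, Cond.holds, ballTest_holds hf' hu, ballTest_holds hf' hw]
    · simp only [VExp.eval, NExp.eval, hu, hw, hE'.c u w ha]
  · set s₁ := (pairSum 3 (.and (ballTest 27) (.not (ballTest 28)))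
      (.get 0 (.var 27) (.var 28))).run s with hs₁
    have h6 : s₁.val 6 = s.val 6 := Prg.run_val _ rfl
    have h2 : s₁.val 2 = s.val 2 := Prg.run_val _ rfl
    have h8 : s₁.nat 8 = s.nat 8 := Prg.run_nat _ rfl
    have hE₁ : Env I s₁ := hE.run rfl
    refine (hE₁.pairSum rfl (fun w => by rw [h8, hcl]) (fun u w => f u ≤ s.val 6 0 0)
      (fun u w => I.cap u w * I.len u w) ?_).trans (by unfold volSum; congr!)
    intro u w s' hE' hV hu hw
    have hf' : ∀ w : Fin I.n, s'.val 2 w 0 = f w := fun w => by rw [hV 2 (by norm_num), h2, hf]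
    refine ⟨?_, fun ha => ?_⟩
    · rw [← h6, ← hV 6 (by norm_num), ballTest_holds hf' hu]
    · simp only [VExp.eval, NExp.eval, hu, hw, hE'.c u w ha, hE'.l u w ha]

end Balls

/-! ### Searching for the best ball -/

section Selection

/-- The volume of the ball with the given volume, plus the total volume. -/
abbrev volExp (a : ℕ) : VExp := .add (.mul widthExp (.var a)) (.var 5)

/-- Remember the current ball. -/
def saveBall : Prg :=
  .seq (.setVal 7 (.lit 0) (.lit 0) (.var 6)) (.seq (.setVal 8 (.lit 0) (.lit 0) (.var 3))
    (.setVal 9 (.lit 0) (.lit 0) (.var 4)))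

/-- Compare the current ball with the remembered one. -/
def compareBall : Prg :=
  .ite (.not (.vle (.mul (.var 8) (volExp 4)) (.mul (.var 3) (volExp 9)))) saveBall .skip

/-- Try all radii less than `1 / 6` at which the ball changes. -/
def selectBall : Prg :=
  .seq evalTotal (.seq (.setVal 6 (.lit 0) (.lit 0) (.lit 0)) (.seq evalBall (.seq saveBall
    (.loop 29 0 (.ite (nearTest 29) (.seq (.setVal 6 (.lit 0) (.lit 0) (.at 2 (.var 29)))
      (.seq evalBall compareBall)) .skip)))))

variable {I : Instance} {s : State} {cl : Fin I.n → Option (Fin I.n)} {f : Fin I.n → ℝ}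

/-- The remembered ball is at least as good as all balls with radii in `S`. -/
structure BestBall (I : Instance) (cl : Fin I.n → Option (Fin I.n)) (f : Fin I.n → ℝ) (K : ℝ)
    (S : Set ℝ) (s : State) : Prop where
  lt : s.val 7 0 0 < 1 / 6
  nonneg : 0 ≤ s.val 7 0 0
  cut : s.val 8 0 0 = cutSum (Free I.G cl) I.cap f (s.val 7 0 0)
  vol : s.val 9 0 0 = volSum (Free I.G cl) I.cap I.len f (s.val 7 0 0)
  min : ∀ θ ∈ S, cutSum (Free I.G cl) I.cap f (s.val 7 0 0) *
      (K * volSum (Free I.G cl) I.cap I.len f θ + totSum (Free I.G cl) I.cap I.len f (1 / 6)) ≤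
    cutSum (Free I.G cl) I.cap f θ * (K * volSum (Free I.G cl) I.cap I.len f (s.val 7 0 0) +
      totSum (Free I.G cl) I.cap I.len f (1 / 6))

theorem saveBall_val (s : State) : (saveBall.run s).val 7 0 0 = s.val 6 0 0 ∧
    (saveBall.run s).val 8 0 0 = s.val 3 0 0 ∧ (saveBall.run s).val 9 0 0 = s.val 4 0 0 := by
  simp [saveBall, Prg.run, State.setVal_val, VExp.eval, NExp.eval]

theorem Free.cap_len_nonneg (u w : Fin I.n) (h : Free I.G cl u w) :
    0 ≤ I.cap u w * I.len u w := mul_nonneg (I.c_nonneg _ h.1) (I.l_nonneg _ h.1)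

/-- Cross-multiplied ratios compare transitively only through a positive denominator, here that of
the previously remembered ball. If the total volume is zero, both cuts vanish by `cutSum_eq_zero`,
and the strict comparison `hlt` fails. -/
theorem BestBall.save {K : ℝ} {S : Set ℝ}
    (hK : 0 ≤ K) (hlip : ∀ u w, Free I.G cl u w → f w ≤ f u + I.len u w)
    (h : BestBall I cl f K S s) (h6 : s.val 6 0 0 < 1 / 6) (h6' : 0 ≤ s.val 6 0 0)
    (h3 : s.val 3 0 0 = cutSum (Free I.G cl) I.cap f (s.val 6 0 0))
    (h4 : s.val 4 0 0 = volSum (Free I.G cl) I.cap I.len f (s.val 6 0 0))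
    (hlt : s.val 3 0 0 * (K * s.val 9 0 0 + totSum (Free I.G cl) I.cap I.len f (1 / 6)) <
      s.val 8 0 0 * (K * s.val 4 0 0 + totSum (Free I.G cl) I.cap I.len f (1 / 6))) :
    BestBall I cl f K (insert (s.val 6 0 0) S) (saveBall.run s) := by
  obtain ⟨e7, e8, e9⟩ := saveBall_val s
  refine ⟨by rw [e7]; exact h6, by rw [e7]; exact h6', by rw [e8, e7, h3], by rw [e9, e7, h4], ?_⟩
  rw [e7]
  rw [h3, h4, h.cut, h.vol] at hlt
  have hW := totSum_nonneg (f := f) (Free.cap_len_nonneg (cl := cl)) (1 / 6)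
  have hv := volSum_nonneg (f := f) (Free.cap_len_nonneg (cl := cl))
  rintro θ (rfl | hθ)
  · exact le_rfl
  have h1 := h.min θ hθ
  have hb : 0 < K * volSum (Free I.G cl) I.cap I.len f (s.val 7 0 0) +
      totSum (Free I.G cl) I.cap I.len f (1 / 6) := by
    rcases hW.eq_or_lt with h0 | h0
    · rw [cutSum_eq_zero Free.cap_len_nonneg hlip h0.symm h.lt,
        cutSum_eq_zero Free.cap_len_nonneg hlip h0.symm h6] at hlt
      simp at hlt
    · exact add_pos_of_nonneg_of_pos (mul_nonneg hK (hv _)) h0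
  have h2 : 0 ≤ K * volSum (Free I.G cl) I.cap I.len f θ +
      totSum (Free I.G cl) I.cap I.len f (1 / 6) := add_nonneg (mul_nonneg hK (hv _)) hW
  have h5 : 0 ≤ K * volSum (Free I.G cl) I.cap I.len f (s.val 6 0 0) +
      totSum (Free I.G cl) I.cap I.len f (1 / 6) := add_nonneg (mul_nonneg hK (hv _)) hW
  refine le_of_mul_le_mul_right ?_ hb
  have h7 := mul_le_mul_of_nonneg_right hlt.le h2
  have h8 := mul_le_mul_of_nonneg_right h1 h5
  linarith

theorem widthExp_eval {r : ℕ} (h : s.nat 12 0 0 = r) : widthExp.eval s = 2 * (r : ℝ) ^ 2 := by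
  simp only [VExp.eval, NExp.eval, h]; push_cast; ring

theorem BestBall.compare {r : ℕ} {K : ℝ} {S : Set ℝ} (hr : s.nat 12 0 0 = r)
    (hK : K = 2 * (r : ℝ) ^ 2)
    (hlip : ∀ u w, Free I.G cl u w → f w ≤ f u + I.len u w)
    (h : BestBall I cl f K S s) (h6 : s.val 6 0 0 < 1 / 6) (h6' : 0 ≤ s.val 6 0 0)
    (h3 : s.val 3 0 0 = cutSum (Free I.G cl) I.cap f (s.val 6 0 0))
    (h4 : s.val 4 0 0 = volSum (Free I.G cl) I.cap I.len f (s.val 6 0 0))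
    (h5 : s.val 5 0 0 = totSum (Free I.G cl) I.cap I.len f (1 / 6)) :
    BestBall I cl f K (insert (s.val 6 0 0) S) (compareBall.run s) := by
  have hc : (Cond.not (.vle (.mul (.var 8) (volExp 4)) (.mul (.var 3) (volExp 9)))).holds s ↔
      ¬ s.val 8 0 0 * (K * s.val 4 0 0 + totSum (Free I.G cl) I.cap I.len f (1 / 6)) ≤
        s.val 3 0 0 * (K * s.val 9 0 0 + totSum (Free I.G cl) I.cap I.len f (1 / 6)) := by
    have := widthExp_eval hr
    simp only [Cond.holds, VExp.eval, NExp.eval, ← h5, hK] at this ⊢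
    rw [this]
  unfold compareBall
  by_cases hle : s.val 8 0 0 * (K * s.val 4 0 0 + totSum (Free I.G cl) I.cap I.len f (1 / 6)) ≤
        s.val 3 0 0 * (K * s.val 9 0 0 + totSum (Free I.G cl) I.cap I.len f (1 / 6))
  · rw [Prg.run_ite_neg (by rw [hc, not_not]; exact hle)]
    refine ⟨h.lt, h.nonneg, h.cut, h.vol, ?_⟩
    rintro θ (rfl | hθ)
    · rwa [h.cut, h.vol, h3, h4] at hle
    · exact h.min θ hθ
  · rw [Prg.run_ite_pos (by rw [hc]; exact hle)]
    exact h.save (by rw [hK]; positivity) hlip h6 h6' h3 h4 (not_le.1 hle)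

theorem selectBall_spec (hE : Env I s) (hcl : ∀ w : Fin I.n, s.nat 8 w 0 = code (cl w))
    (hf : ∀ w : Fin I.n, s.val 2 w 0 = f w) {r : ℕ} {K : ℝ} (hr : s.nat 12 0 0 = r)
    (hK : K = 2 * (r : ℝ) ^ 2) (hf0 : ∀ u, 0 ≤ f u)
    (hlip : ∀ u w, Free I.G cl u w → f w ≤ f u + I.len u w) :
    BestBall I cl f K {θ | θ < 1 / 6 ∧ (θ = 0 ∨ ∃ y, θ = f y)} (selectBall.run s) := by
  set s₁ := evalTotal.run s with hs₁
  have hE₁ : Env I s₁ := hE.run rfl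
  set s₂ := s₁.setVal 6 0 0 ((0 : ℕ) : ℝ) with hs₂
  have hE₂ : Env I s₂ := hE₁.setVal (by norm_num)
  have hcl₂ : ∀ w : Fin I.n, s₂.nat 8 w 0 = code (cl w) := fun w => by
    rw [hs₂, State.setVal_nat, hs₁, Prg.run_nat _ rfl]; exact hcl w
  have hf₂ : ∀ w : Fin I.n, s₂.val 2 w 0 = f w := fun w => by
    rw [hs₂, State.setVal_val_ne (by norm_num), hs₁, Prg.run_val _ rfl]; exact hf w
  have h6 : s₂.val 6 0 0 = 0 := by simp [hs₂, State.setVal_val]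
  set s₃ := evalBall.run s₂ with hs₃
  have hE₃ : Env I s₃ := hE₂.run rfl
  obtain ⟨h3, h4⟩ := evalBall_spec hE₂ hcl₂ hf₂
  rw [h6] at h3 h4
  set s₄ := saveBall.run s₃ with hs₄
  have hE₄ : Env I s₄ := hE₃.run rfl
  obtain ⟨e7, e8, e9⟩ := saveBall_val s₃
  have h6₃ : s₃.val 6 0 0 = 0 := by rw [hs₃, Prg.run_val _ rfl]; exact h6
  have hbest : BestBall I cl f K {0} s₄ := by
    rw [h6₃] at e7
    refine ⟨?_, ?_, ?_, ?_, ?_⟩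
    · rw [hs₄, e7]; norm_num
    · rw [hs₄, e7]
    · rw [hs₄, e7, e8]; exact h3
    · rw [hs₄, e7, e9]; exact h4
    · rintro θ rfl; rw [hs₄, e7]
  have hval2 : ∀ w : Fin I.n, s₄.val 2 w 0 = f w := fun w => by
    rw [hs₄, Prg.run_val _ rfl, hs₃, Prg.run_val _ rfl]; exact hf₂ w
  have hval5 : s₄.val 5 0 0 = totSum (Free I.G cl) I.cap I.len f (1 / 6) := by
    rw [hs₄, Prg.run_val _ rfl, hs₃, Prg.run_val _ rfl, hs₂, State.setVal_val_ne (by norm_num)]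
    exact evalTotal_spec hE hcl hf
  have hnat8 : ∀ w : Fin I.n, s₄.nat 8 w 0 = code (cl w) := fun w => by
    rw [hs₄, Prg.run_nat _ rfl, hs₃, Prg.run_nat _ rfl]; exact hcl₂ w
  have hnat12 : s₄.nat 12 0 0 = r := by
    rw [hs₄, Prg.run_nat _ rfl, hs₃, Prg.run_nat _ rfl, hs₂, State.setVal_nat, hs₁,
      Prg.run_nat _ rfl, hr]
  have key := hE₄.loop (v := 29) (B := 0) (P := .ite (nearTest 29)
      (.seq (.setVal 6 (.lit 0) (.lit 0) (.at 2 (.var 29))) (.seq evalBall compareBall)) .skip) rfl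
    (fun j s' => s'.val 5 0 0 = totSum (Free I.G cl) I.cap I.len f (1 / 6) ∧
      BestBall I cl f K {θ | θ < 1 / 6 ∧ (θ = 0 ∨ ∃ y : Fin I.n, y.val < j ∧ θ = f y)} s')
    (fun j s' k h => ⟨h.1, h.2.1, h.2.2, h.2.3, h.2.4, h.2.5⟩) ⟨hval5, ?_⟩ ?_
  · rw [hE₄.n] at key
    refine ⟨key.2.1, key.2.2, key.2.3, key.2.4, ?_⟩
    rintro θ ⟨h1, h2⟩
    refine key.2.5 θ ⟨h1, h2.imp_right ?_⟩
    rintro ⟨y, hy⟩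
    exact ⟨y, y.2, hy⟩
  · refine ⟨hbest.1, hbest.2, hbest.3, hbest.4, ?_⟩
    rintro θ ⟨-, rfl | ⟨y, hy, -⟩⟩
    · exact hbest.5 0 rfl
    · exact absurd hy (Nat.not_lt_zero _)
  · rintro j hj s' hE' hN hV hj' ⟨h5, hb⟩
    rw [hE₄.n] at hj
    have hf' : ∀ w : Fin I.n, s'.val 2 w 0 = f w := fun w => by rw [hV 2 rfl, hval2]
    have hnear := nearTest_holds hf' (u := ⟨j, hj⟩) hj'
    by_cases hlt : f ⟨j, hj⟩ < 1 / 6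
    · rw [Prg.run_ite_pos (hnear.2 hlt)]
      set t₁ := s'.setVal 6 0 0 (f ⟨j, hj⟩) with ht₁
      have hrun : (Prg.seq (.setVal 6 (.lit 0) (.lit 0) (.at 2 (.var 29)))
          (.seq evalBall compareBall)).run s' = compareBall.run (evalBall.run t₁) := by
        have := hf' ⟨j, hj⟩
        simp only at this
        simp only [Prg.run, NExp.eval, VExp.eval, hj', this, ht₁]
      rw [hrun]
      have hE₁' : Env I t₁ := hE'.setVal (by norm_num)
      have ht6 : t₁.val 6 0 0 = f ⟨j, hj⟩ := by simp [ht₁, State.setVal_val]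
      have ht2 : ∀ w : Fin I.n, t₁.val 2 w 0 = f w := fun w => by
        rw [ht₁, State.setVal_val_ne (by norm_num), hf']
      have ht8 : ∀ w : Fin I.n, t₁.nat 8 w 0 = code (cl w) := fun w => by
        rw [ht₁, State.setVal_nat, hN 8 rfl, hnat8]
      obtain ⟨g3, g4⟩ := evalBall_spec hE₁' ht8 ht2
      set t₂ := evalBall.run t₁ with ht₂
      have hk : ∀ A, 5 ≤ A → A ≠ 6 → t₂.val A = s'.val A := by
        intro A hA hA6
        rw [ht₂, Prg.run_val _ (by
          simp only [evalBall, pairSum, Prg.wV, Bool.or_false, Bool.or_eq_false_iff,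
            beq_eq_false_iff_ne]
          omega), ht₁, State.setVal_val_ne hA6]
      have ht26 : t₂.val 6 0 0 = f ⟨j, hj⟩ := by rw [ht₂, Prg.run_val _ rfl, ht6]
      have hb2 : BestBall I cl f K
          {θ | θ < 1 / 6 ∧ (θ = 0 ∨ ∃ y : Fin I.n, y.val < j ∧ θ = f y)} t₂ := by
        obtain ⟨b1, b2, b3, b4, b5⟩ := hb
        refine ⟨?_, ?_, ?_, ?_, ?_⟩
        · rwa [hk 7 (by norm_num) (by norm_num)]
        · rwa [hk 7 (by norm_num) (by norm_num)]
        · rwa [hk 7 (by norm_num) (by norm_num), hk 8 (by norm_num) (by norm_num)]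
        · rwa [hk 7 (by norm_num) (by norm_num), hk 9 (by norm_num) (by norm_num)]
        · rwa [hk 7 (by norm_num) (by norm_num)]
      have ht5 : t₂.val 5 0 0 = totSum (Free I.G cl) I.cap I.len f (1 / 6) := by
        rw [hk 5 (by norm_num) (by norm_num), h5]
      have ht12 : t₂.nat 12 0 0 = r := by
        rw [ht₂, Prg.run_nat _ rfl, ht₁, State.setVal_nat, hN 12 rfl, hnat12]
      have hcmp := hb2.compare ht12 hK hlip (by rw [ht26]; exact hlt) (by rw [ht26]; exact hf0 _)
        (by rw [g3, ht6, ht26]) (by rw [g4, ht6, ht26]) ht5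
      refine ⟨by rw [Prg.run_val _ rfl, ht5], hcmp.1, hcmp.2, hcmp.3, hcmp.4, ?_⟩
      rintro θ ⟨h1, h2⟩
      apply hcmp.5
      rcases h2 with h2 | ⟨y, hy, h2⟩
      · exact .inr ⟨h1, .inl h2⟩
      · rcases Nat.lt_succ_iff_lt_or_eq.1 hy with hy | hy
        · exact .inr ⟨h1, .inr ⟨y, hy, h2⟩⟩
        · left
          rw [ht26, h2]
          exact congrArg f (Fin.ext hy)
    · rw [Prg.run_ite_neg (mt hnear.1 hlt)]
      refine ⟨h5, hb.1, hb.2, hb.3, hb.4, ?_⟩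
      rintro θ ⟨h1, h2⟩
      apply hb.5
      refine ⟨h1, h2.imp_right ?_⟩
      rintro ⟨y, hy, h2⟩
      refine ⟨y, ?_, h2⟩
      rcases Nat.lt_succ_iff_lt_or_eq.1 hy with hy | hy
      -- Only the current vertex remains; it contributes no admissible radius because its distance
      -- is not less than `1 / 6`.
      · exact hy
      · refine absurd h1 ?_
        rw [h2, show y = ⟨j, hj⟩ from Fin.ext hy]
        exact hlt

end Selection

/-! ### Growing the cluster of one centre -/

section Grow

/-- Distance zero from the vertex in the variable `25`. -/
def initDist : Prg :=
  .loop 22 0 (.ite (.eq (.var 22) (.var 25)) (.setVal 2 (.var 22) (.lit 0) (.lit 0))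
    (.setVal 2 (.var 22) (.lit 0) (.lit 1)))

/-- The vertex in the variable `22` is covered by the current centre. -/
def seedTest : Cond :=
  .and (zeroTest 7 22) (.and (.eq (.at 10 (.var 22)) (.lit 1))
    (.vle (.mul (.lit 3) (.at 2 (.var 22))) (.lit 1)))

/-- Mark the vertices covered by the current centre in array `9`, and give them distance zero. -/
def markSeeds : Prg :=
  .loop 22 0 (.ite seedTest (.seq (.setNat 9 (.var 22) (.lit 0) (.lit 1))
    (.setVal 2 (.var 22) (.lit 0) (.lit 0))) (.setVal 2 (.var 22) (.lit 0) (.lit 1)))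

/-- Label the unlabelled vertices of the remembered ball. -/
def addLabels : Prg :=
  .loop 22 0 (.ite (.and (zeroTest 8 22) (.vle (.at 2 (.var 22)) (.var 7)))
    (.setNat 8 (.var 22) (.lit 0) (.add (.var 25) (.lit 1))) .skip)

/-- Form a cluster around the vertices covered by the centre in the variable `25`. -/
def grow : Prg :=
  .seq initDist (.seq bellmanFord (.seq markSeeds (.seq bellmanFord (.seq selectBall addLabels))))

variable {I : Instance} {s : State}

open Classical in
theorem initDist_spec (hE : Env I s) {x : Fin I.n} (hx : s.nat 25 0 0 = x) :
    ∀ w : Fin I.n, (initDist.run s).val 2 w 0 = if w = x then 0 else 1 := by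
  refine hE.map_loop (v := 22) rfl (fun _ _ => True)
    (fun w s => s.val 2 w 0 = if w = x then 0 else 1) (fun _ _ _ _ => trivial)
    (fun _ _ _ h => h) (fun _ => trivial) ?_
  intro u s' hE' hN hV hu _
  have hx' : s'.nat 25 0 0 = x := by rw [hN 25 rfl, hx]
  have hrun : (Prg.ite (.eq (.var 22) (.var 25)) (.setVal 2 (.var 22) (.lit 0) (.lit 0))
      (.setVal 2 (.var 22) (.lit 0) (.lit 1))).run s' = s'.setVal 2 u 0 (if u = x then 0 else 1) := by
    by_cases h : u = x
    · rw [Prg.run_ite_pos (by rw [Cond.eq_holds]; simp only [NExp.eval, hu, hx', h]), if_pos h]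
      simp [Prg.run, NExp.eval, VExp.eval, hu]
    · rw [Prg.run_ite_neg (by rw [Cond.eq_holds]; simpa only [NExp.eval, hu, hx', Fin.ext_iff] using h),
        if_neg h]
      simp [Prg.run, NExp.eval, VExp.eval, hu]
  rw [hrun]
  refine ⟨by simp [State.setVal_val], fun w hw => ⟨fun _ => trivial, fun h => ?_⟩⟩
  rw [← h]
  simp [State.setVal_val, Fin.ext_iff.not.1 hw]

open Classical in
theorem markSeeds_spec (hE : Env I s) (p : Fin I.n → Prop)
    (hp : ∀ (w : Fin I.n) (s' : State), s'.nat 7 = s.nat 7 → s'.nat 10 = s.nat 10 →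
      s'.nat 22 0 0 = w → s'.val 2 w 0 = s.val 2 w 0 → (seedTest.holds s' ↔ p w)) :
    ∀ w : Fin I.n, ((markSeeds.run s).val 2 w 0 = if p w then 0 else 1) ∧
      (markSeeds.run s).nat 9 w 0 = if p w then 1 else s.nat 9 w 0 := by
  refine hE.map_loop (v := 22) rfl
    (fun w s' => s'.val 2 w 0 = s.val 2 w 0 ∧ s'.nat 9 w 0 = s.nat 9 w 0)
    (fun w s' => (s'.val 2 w 0 = if p w then 0 else 1) ∧
      s'.nat 9 w 0 = if p w then 1 else s.nat 9 w 0) (fun _ _ _ h => h)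
    (fun _ _ _ h => h) (fun _ => ⟨rfl, rfl⟩) ?_
  rintro u s' hE' hN hV hu ⟨h2, h9⟩
  have hc := hp u s' (hN 7 rfl) (hN 10 rfl) hu h2
  have hrun : (Prg.ite seedTest (.seq (.setNat 9 (.var 22) (.lit 0) (.lit 1))
      (.setVal 2 (.var 22) (.lit 0) (.lit 0))) (.setVal 2 (.var 22) (.lit 0) (.lit 1))).run s' =
      (if p u then (s'.setNat 9 u 0 1).setVal 2 u 0 0 else s'.setVal 2 u 0 1) := by
    by_cases h : p u
    · rw [Prg.run_ite_pos (hc.2 h), if_pos h]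
      simp [Prg.run, NExp.eval, VExp.eval, hu, State.setNat_nat]
    · rw [Prg.run_ite_neg (mt hc.1 h), if_neg h]
      simp [Prg.run, NExp.eval, VExp.eval, hu]
  rw [hrun]
  have hne : ∀ w ≠ u, w.val ≠ u.val := fun w hw h => hw (Fin.ext h)
  split_ifs with h
  · refine ⟨by simp [State.setVal_val, State.setNat_nat], fun w hw => ?_⟩
    simp [State.setVal_val, State.setNat_nat, hne w hw]
  · refine ⟨by simp [State.setVal_val, h9], fun w hw => ?_⟩
    simp [State.setVal_val, hne w hw]

theorem addLabels_spec (hE : Env I s) {cl : Fin I.n → Option (Fin I.n)} {f : Fin I.n → ℝ}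
    (hcl : ∀ w : Fin I.n, s.nat 8 w 0 = code (cl w)) (hf : ∀ w : Fin I.n, s.val 2 w 0 = f w)
    {x : Fin I.n} (hx : s.nat 25 0 0 = x) :
    ∀ w : Fin I.n, (addLabels.run s).nat 8 w 0 = code (addBall cl f (s.val 7 0 0) x w) := by
  refine hE.map_loop (v := 22) rfl (fun w s' => s'.nat 8 w 0 = code (cl w))
    (fun w s' => s'.nat 8 w 0 = code (addBall cl f (s.val 7 0 0) x w)) (fun _ _ _ h => h)
    (fun _ _ _ h => h) hcl ?_
  intro u s' hE' hN hV hu h8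
  have hc : (Cond.and (zeroTest 8 22) (.vle (.at 2 (.var 22)) (.var 7))).holds s' ↔
      cl u = none ∧ f u ≤ s.val 7 0 0 := by
    simp only [Cond.holds, zeroTest_holds, NExp.eval, VExp.eval, hu, h8, code_eq_zero]
    rw [hV 2 rfl, hV 7 rfl, hf]
  have hne : ∀ w ≠ u, w.val ≠ u.val := fun w hw h => hw (Fin.ext h)
  unfold addBall
  by_cases h : cl u = none ∧ f u ≤ s.val 7 0 0
  · rw [Prg.run_ite_pos (hc.2 h), if_pos h]
    refine ⟨?_, fun w hw => ?_⟩
    · simp [Prg.run, NExp.eval, hu, State.setNat_nat, code, hN 25 rfl, hx]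
    · simp [Prg.run, NExp.eval, hu, State.setNat_nat, hne w hw]
  · rw [Prg.run_ite_neg (mt hc.1 h), if_neg h]
    exact ⟨h8, fun w _ => ⟨id, id⟩⟩

open Classical in
-- Distances are computed twice in the same graph of uncovered vertices: from the centre, to find
-- the vertices it covers, and then from these, to choose the ball. The cap at `1` does no harm
-- since the thresholds are `1 / 3` and `1 / 6`.
theorem grow_spec (hE : Env I s) {net : Fin I.n → Option (Fin I.m)}
    {cl : Fin I.n → Option (Fin I.n)} {q : Fin I.n → ℕ} {r : ℕ} {x : Fin I.n}
    (hnet : ∀ w : Fin I.n, s.nat 7 w 0 = code (net w))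
    (hcl : ∀ w : Fin I.n, s.nat 8 w 0 = code (cl w)) (hr : s.nat 12 0 0 = r) (hr0 : 0 < r)
    (hx : s.nat 25 0 0 = x) (hxa : net x = none)
    (hok : ∀ w : Fin I.n, s.nat 10 w 0 = 1 ↔ Meets I.D net (I.D.bag x) w)
    (hI : IsClustering I.G I.c I.l (2 * (r : ℝ) ^ 2) net cl q) :
    ∃ cl' : Fin I.n → Option (Fin I.n), (∀ w : Fin I.n, (grow.run s).nat 8 w 0 = code (cl' w)) ∧
      IsClustering I.G I.c I.l (2 * (r : ℝ) ^ 2) net cl' (q + chargeAt I.D I.l net x) ∧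
      (∀ w, cl w ≠ none → cl' w ≠ none) ∧ (∀ w, Seed I.D I.l net x w → cl' w ≠ none) ∧
      ∀ w : Fin I.n, (grow.run s).nat 9 w 0 =
        if Seed I.D I.l net x w then 1 else s.nat 9 w 0 := by
  have hA : ∀ w : Fin I.n, w ∈ alive net ↔ s.nat 7 w 0 = 0 := fun w => by
    rw [hnet, code_eq_zero]; rfl
  set s₁ := initDist.run s with hs₁
  have h₁ := initDist_spec hE hx
  have hE₁ : Env I s₁ := hE.run rfl
  have hf₁ := bellmanFord_spec hE₁ (A := alive net) (X := {x})
    (fun w => by rw [hs₁, Prg.run_nat _ rfl, hA]) (Set.singleton_subset_iff.2 hxa)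
    (fun w hw => (h₁ w).trans (if_pos hw)) (fun w hw => (h₁ w).trans (if_neg hw))
  set s₂ := bellmanFord.run s₁ with hs₂
  have hE₂ : Env I s₂ := hE₁.run rfl
  have hN₂ : ∀ A < 20, s₂.nat A = s.nat A := by
    intro A hA
    rw [hs₂, Prg.run_nat _ (by simp [bellmanFord, relax, Prg.wN]; omega), hs₁, Prg.run_nat _ (by
      simp [initDist, Prg.wN]; omega)]
  have h25₂ : s₂.nat 25 = s.nat 25 := by rw [hs₂, Prg.run_nat _ rfl, hs₁, Prg.run_nat _ rfl]
  have hseed := markSeeds_spec hE₂ (Seed I.D I.l net x) ?_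
  swap
  · intro w s' h7 h10 h22 h2
    unfold seedTest
    rw [Cond.holds, Cond.holds, zeroTest_holds, Cond.eq_holds]
    simp only [Cond.holds, NExp.eval, VExp.eval, h22, h7, h10, h2]
    rw [hN₂ 7 (by norm_num), hN₂ 10 (by norm_num), hok, ← hA, Seed]
    refine and_congr_right fun _ => and_congr_right fun _ => ?_
    push_cast
    constructor
    · intro h
      obtain ⟨y, rfl, k, d, hd, hp⟩ := hf₁.path w (by linarith)
      exact ⟨k, d, by linarith, hp⟩
    · rintro ⟨k, d, hd, hp⟩
      have := hf₁.le rfl hp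
      linarith
  set s₃ := markSeeds.run s₂ with hs₃
  have hE₃ : Env I s₃ := hE₂.run rfl
  have hN₃ : ∀ A < 20, A ≠ 9 → s₃.nat A = s.nat A := by
    intro A hA hA9
    rw [hs₃, Prg.run_nat _ (by simp [markSeeds, Prg.wN]; omega), hN₂ A hA]
  have hf := bellmanFord_spec hE₃ (A := alive net) (X := {w | Seed I.D I.l net x w})
    (fun w => by rw [hN₃ 7 (by norm_num) (by norm_num), hA]) (fun w hw => hw.1)
    (fun w hw => (hseed w).1.trans (if_pos hw)) (fun w hw => (hseed w).1.trans (if_neg hw))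
  set s₄ := bellmanFord.run s₃ with hs₄
  set f : Fin I.n → ℝ := fun w => s₄.val 2 w 0 with hfdef
  have hE₄ : Env I s₄ := hE₃.run rfl
  have hN₄ : ∀ A < 20, s₄.nat A = s₃.nat A := by
    intro A hA
    rw [hs₄, Prg.run_nat _ (by simp [bellmanFord, relax, Prg.wN]; omega)]
  have hcl₄ : ∀ w : Fin I.n, s₄.nat 8 w 0 = code (cl w) := fun w => by
    rw [hN₄ 8 (by norm_num), hN₃ 8 (by norm_num) (by norm_num), hcl]
  have hlip : ∀ u w, Free I.G cl u w → f w ≤ f u + I.len u w := fun u w h =>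
    hf.edge u w h.1 (hI.mem_alive h.2.1) (hI.mem_alive h.2.2)
  have hbest := selectBall_spec hE₄ hcl₄ (f := f) (fun _ => rfl) (r := r)
    (by rw [hN₄ 12 (by norm_num), hN₃ 12 (by norm_num) (by norm_num), hr]) rfl hf.nonneg hlip
  set s₅ := selectBall.run s₄ with hs₅
  have hE₅ : Env I s₅ := hE₄.run rfl
  have hN₅ : ∀ A < 20, s₅.nat A = s₄.nat A := by
    intro A hA
    rw [hs₅, Prg.run_nat _ (by
      simp [selectBall, evalTotal, evalBall, compareBall, saveBall, pairSum, Prg.wN]; omega)]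
  have hlab := addLabels_spec hE₅ (cl := cl) (f := f) (x := x)
    (fun w => by rw [hN₅ 8 (by norm_num), hcl₄]) (fun w => by rw [hs₅, Prg.run_val _ rfl])
    (by rw [hs₅, Prg.run_nat _ rfl, hs₄, Prg.run_nat _ rfl, hs₃, Prg.run_nat _ rfl, h25₂, hx])
  set θ := s₅.val 7 0 0 with hθ
  have hK : (0 : ℝ) < 2 * (r : ℝ) ^ 2 := by positivity
  refine ⟨addBall cl f θ x, hlab, ?_, fun w hw => addBall_ne_none (.inl hw),
    fun w hw => addBall_ne_none (.inr ?_), fun w => ?_⟩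
  · refine hI.addBall I.c_nonneg I.l_nonneg hK hf hbest.lt ?_
    exact cutSum_le_of_minimal (fun u w h => I.c_nonneg _ h.1) (fun u w h => I.l_nonneg _ h.1)
      hf.nonneg hlip (by norm_num) hK hbest.lt fun θ h1 h2 => hbest.min θ ⟨h1, h2⟩
  · exact (hf.zero w hw).le.trans hbest.nonneg
  · change (addLabels.run s₅).nat 9 w 0 = _
    rw [Prg.run_nat _ rfl, hN₅ 9 (by norm_num), hN₄ 9 (by norm_num), (hseed w).2,
      hN₂ 9 (by norm_num)]

end Grow

/-! ### Testing which bags are met by the earlier regions -/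

section Meeting

/-- Does the region of the vertex in the variable `23` meet the bag of the vertex in the
variable `22`? -/
def testHit : Prg :=
  .seq (.setNat 14 (.lit 0) (.lit 0) (.lit 0))
    (.loop 24 0 (.ite (.and (.eq (.at 2 (.var 24)) (.at 2 (.var 22)))
      (.eq (.at 7 (.var 24)) (.at 7 (.var 23)))) (.setNat 14 (.lit 0) (.lit 0) (.lit 1)) .skip))

/-- Do all regions that meet the bag in the variable `21` meet the bag of the vertex in the
variable `22`? -/
def testMeets : Prg :=
  .seq (.setNat 10 (.var 22) (.lit 0) (.lit 1))
    (.loop 23 0 (.ite (.and (.eq (.at 2 (.var 23)) (.var 21)) (.not (zeroTest 7 23)))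
      (.seq testHit (.ite (.eq (.var 14) (.lit 0)) (.setNat 10 (.var 22) (.lit 0) (.lit 0)) .skip))
      .skip))

/-- Prepare the arrays `9` and `10` for the bag in the variable `21`. -/
def prepare : Prg :=
  .loop 22 0 (.seq (.setNat 9 (.var 22) (.lit 0) (.lit 0)) testMeets)

variable {I : Instance} {s : State} {net : Fin I.n → Option (Fin I.m)}

theorem testHit_spec (hE : Env I s) (hnet : ∀ w : Fin I.n, s.nat 7 w 0 = code (net w))
    {w y : Fin I.n} (hw : s.nat 22 0 0 = w) (hy : s.nat 23 0 0 = y) :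
    (testHit.run s).nat 14 0 0 = 0 ↔ ¬ ∃ z, I.D.bag z = I.D.bag w ∧ net z = net y := by
  have hE₁ : Env I (s.setNat 14 0 0 0) := hE.setNat (by norm_num)
  have key := hE₁.loop (v := 24) (B := 0) (P := .ite (.and (.eq (.at 2 (.var 24)) (.at 2 (.var 22)))
      (.eq (.at 7 (.var 24)) (.at 7 (.var 23)))) (.setNat 14 (.lit 0) (.lit 0) (.lit 1)) .skip) rfl
    (fun j s' => s'.nat 14 0 0 = 0 ↔
      ¬ ∃ z : Fin I.n, z.val < j ∧ I.D.bag z = I.D.bag w ∧ net z = net y)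
    (fun j s k h => h) (by simp [State.setNat_nat]) ?_
  · rw [hE₁.n] at key
    simp only [Fin.is_lt, true_and] at key
    exact key
  intro j hj s' hE' hN hV hj' hInv
  rw [hE₁.n] at hj
  have hnet' : ∀ w : Fin I.n, s'.nat 7 w 0 = code (net w) := fun w => by
    rw [hN 7 rfl, State.setNat_nat_ne (by norm_num), hnet]
  have hw' : s'.nat 22 0 0 = w := by rw [hN 22 rfl, State.setNat_nat_ne (by norm_num), hw]
  have hy' : s'.nat 23 0 0 = y := by rw [hN 23 rfl, State.setNat_nat_ne (by norm_num), hy]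
  obtain ⟨z, rfl⟩ : ∃ z : Fin I.n, z.val = j := ⟨⟨j, hj⟩, rfl⟩
  have hc : (Cond.and (.eq (.at 2 (.var 24)) (.at 2 (.var 22)))
      (.eq (.at 7 (.var 24)) (.at 7 (.var 23)))).holds s' ↔
      I.D.bag z = I.D.bag w ∧ net z = net y := by
    rw [Cond.holds, Cond.eq_holds, Cond.eq_holds]
    simp only [NExp.eval, hj', hw', hy', hE'.bag, hnet', code_inj, Fin.ext_iff]
  by_cases h : I.D.bag z = I.D.bag w ∧ net z = net y
  · rw [Prg.run_ite_pos (hc.2 h)]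
    simp only [Prg.run, NExp.eval, State.setNat_nat]
    simp only [and_self, if_true, one_ne_zero, false_iff, not_not]
    exact ⟨z, Nat.lt_succ_self _, h⟩
  · rw [Prg.run_ite_neg (mt hc.1 h)]
    simp only [Prg.run]
    rw [hInv, not_iff_not]
    constructor
    · rintro ⟨z', h1, h2⟩; exact ⟨z', by omega, h2⟩
    · rintro ⟨z', h1, h2⟩
      refine ⟨z', ?_, h2⟩
      rcases Nat.lt_succ_iff_lt_or_eq.1 h1 with h1 | h1
      · exact h1
      · exact absurd (Fin.ext h1 ▸ h2) h

open Classical in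
theorem testMeets_spec (hE : Env I s) (hnet : ∀ w : Fin I.n, s.nat 7 w 0 = code (net w))
    {w : Fin I.n} {F : Fin I.m} (hw : s.nat 22 0 0 = w) (hF : s.nat 21 0 0 = F) :
    ((testMeets.run s).nat 10 w 0 = 1 ↔ Meets I.D net F w) ∧
      ∀ u ≠ w, (testMeets.run s).nat 10 u 0 = s.nat 10 u 0 := by
  have hE₁ : Env I (s.setNat 10 w 0 1) := hE.setNat (by norm_num)
  have key := hE₁.loop (v := 23) (B := 0) (P := .ite (.and (.eq (.at 2 (.var 23)) (.var 21))
      (.not (zeroTest 7 23))) (.seq testHit (.ite (.eq (.var 14) (.lit 0))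
        (.setNat 10 (.var 22) (.lit 0) (.lit 0)) .skip)) .skip) rfl
    (fun j s' => (s'.nat 10 w 0 = if ∀ y : Fin I.n, y.val < j → I.D.bag y = F → net y ≠ none →
      ∃ z, I.D.bag z = I.D.bag w ∧ net z = net y then 1 else 0) ∧
      ∀ u ≠ w, s'.nat 10 u 0 = s.nat 10 u 0)
    (fun j s k h => h) ⟨by simp [State.setNat_nat], fun u hu => ?_⟩ ?_
  · rw [hE₁.n] at key
    have hrun : testMeets.run s = (Prg.loop 23 0 (.ite (.and (.eq (.at 2 (.var 23)) (.var 21))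
      (.not (zeroTest 7 23))) (.seq testHit (.ite (.eq (.var 14) (.lit 0))
        (.setNat 10 (.var 22) (.lit 0) (.lit 0)) .skip)) .skip)).run (s.setNat 10 w 0 1) := by
      rw [testMeets, Prg.run]
      simp only [Prg.run, NExp.eval, hw]
    rw [hrun]
    refine ⟨?_, key.2⟩
    rw [key.1]
    simp [Meets]
  · simp [State.setNat_nat, Fin.ext_iff.not.1 hu]
  rintro j hj s' hE' hN hV hj' ⟨hInv, hrest⟩
  rw [hE₁.n] at hj
  have hnet' : ∀ w : Fin I.n, s'.nat 7 w 0 = code (net w) := fun w => by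
    rw [hN 7 rfl, State.setNat_nat_ne (by norm_num), hnet]
  have hw' : s'.nat 22 0 0 = w := by rw [hN 22 rfl, State.setNat_nat_ne (by norm_num), hw]
  have hF' : s'.nat 21 0 0 = F := by rw [hN 21 rfl, State.setNat_nat_ne (by norm_num), hF]
  obtain ⟨y, rfl⟩ : ∃ z : Fin I.n, z.val = j := ⟨⟨j, hj⟩, rfl⟩
  have hc : (Cond.and (.eq (.at 2 (.var 23)) (.var 21)) (.not (zeroTest 7 23))).holds s' ↔
      I.D.bag y = F ∧ net y ≠ none := by
    rw [Cond.holds, Cond.eq_holds, Cond.holds, zeroTest_holds]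
    simp only [NExp.eval, hj', hF', hE'.bag, hnet', code_eq_zero, Fin.ext_iff, ne_eq]
  have hiff : (∀ y' : Fin I.n, y'.val < y.val + 1 → I.D.bag y' = F → net y' ≠ none →
      ∃ z, I.D.bag z = I.D.bag w ∧ net z = net y') ↔
      (∀ y' : Fin I.n, y'.val < y.val → I.D.bag y' = F → net y' ≠ none →
      ∃ z, I.D.bag z = I.D.bag w ∧ net z = net y') ∧ (I.D.bag y = F ∧ net y ≠ none →
      ∃ z, I.D.bag z = I.D.bag w ∧ net z = net y) := by
    constructor
    · exact fun h => ⟨fun y' h' => h y' (by omega), fun h' => h y (by omega) h'.1 h'.2⟩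
    · rintro ⟨h1, h2⟩ y' h3 h4 h5
      rcases Nat.lt_succ_iff_lt_or_eq.1 h3 with h3 | h3
      · exact h1 y' h3 h4 h5
      · obtain rfl := Fin.ext h3
        exact h2 ⟨h4, h5⟩
  by_cases h : I.D.bag y = F ∧ net y ≠ none
  · rw [Prg.run_ite_pos (hc.2 h), Prg.run]
    have hhit := testHit_spec hE' hnet' hw' hj'
    set s₂ := testHit.run s' with hs₂
    have h22 : s₂.nat 22 0 0 = w := by rw [hs₂, Prg.run_nat _ rfl, hw']
    have h10 : s₂.nat 10 = s'.nat 10 := by rw [hs₂, Prg.run_nat _ rfl]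
    have hc2 : (Cond.eq (.var 14) (.lit 0)).holds s₂ ↔
        ¬ ∃ z, I.D.bag z = I.D.bag w ∧ net z = net y := by
      rw [Cond.eq_holds, ← hhit]; rfl
    by_cases h2 : ∃ z, I.D.bag z = I.D.bag w ∧ net z = net y
    · rw [Prg.run_ite_neg (by rw [hc2, not_not]; exact h2)]
      simp only [Prg.run, h10, hInv, hiff]
      simp only [h2, imp_true_iff, and_true, true_and]
      tauto
    · rw [Prg.run_ite_pos (hc2.2 h2)]
      simp only [Prg.run, NExp.eval, h22, State.setNat_nat]
      refine ⟨?_, fun u hu => ?_⟩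
      · rw [if_pos (by simp), if_neg]
        exact fun h' => h2 ((hiff.1 h').2 h)
      · rw [if_neg (by simp [Fin.ext_iff.not.1 hu]), h10, hrest u hu]
  · rw [Prg.run_ite_neg (mt hc.1 h)]
    simp only [Prg.run, hInv, hiff]
    refine ⟨?_, hrest⟩
    simp only [h, false_imp_iff, and_true]

theorem prepare_spec (hE : Env I s) (hnet : ∀ w : Fin I.n, s.nat 7 w 0 = code (net w))
    {F : Fin I.m} (hF : s.nat 21 0 0 = F) :
    ∀ w : Fin I.n, ((prepare.run s).nat 10 w 0 = 1 ↔ Meets I.D net F w) ∧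
      (prepare.run s).nat 9 w 0 = 0 := by
  refine hE.map_loop (v := 22) rfl (fun _ _ => True)
    (fun w s' => (s'.nat 10 w 0 = 1 ↔ Meets I.D net F w) ∧ s'.nat 9 w 0 = 0)
    (fun _ _ _ _ => trivial) (fun _ _ _ h => h) (fun _ => trivial) ?_
  intro u s' hE' hN hV hu _
  have hrun : (Prg.seq (.setNat 9 (.var 22) (.lit 0) (.lit 0)) testMeets).run s' =
      testMeets.run (s'.setNat 9 u 0 0) := by simp only [Prg.run, NExp.eval, hu]
  have hE₁ : Env I (s'.setNat 9 u 0 0) := hE'.setNat (by norm_num)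
  obtain ⟨h1, h2⟩ := testMeets_spec hE₁ (net := net) (w := u) (F := F)
    (fun w => by rw [State.setNat_nat_ne (by norm_num), hN 7 rfl, hnet])
    (by rw [State.setNat_nat_ne (by norm_num), hu])
    (by rw [State.setNat_nat_ne (by norm_num), hN 21 rfl, hF])
  rw [hrun]
  have h9 : (testMeets.run (s'.setNat 9 u 0 0)).nat 9 = (s'.setNat 9 u 0 0).nat 9 :=
    Prg.run_nat _ rfl
  rw [h9]
  refine ⟨⟨h1, by simp [State.setNat_nat]⟩, fun w hw => ⟨fun _ => trivial, fun h => ?_⟩⟩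
  rw [h2 w hw, State.setNat_nat_ne (by norm_num)]
  refine ⟨h.1, ?_⟩
  simp [State.setNat_nat, h.2]

end Meeting

/-! ### Processing one bag -/

section Covering

variable {V ι : Type*} [Fintype V] {G : SimpleGraph V} {D : TreePartition G ι} {c l : Sym2 V → ℝ}
  {net : V → Option ι} {cl : V → Option V} {q : V → ℕ} {K : ℝ}

/-- A covered vertex covers nothing, so skipping it in `growAll` leaves the sum of charges correct.
-/
theorem chargeAt_eq_zero {x : V} (h : net x ≠ none) : chargeAt D l net x = 0 := by
  funext u
  unfold chargeAt
  rw [if_neg]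
  · rfl
  · rintro ⟨p, k, d, ⟨-, -, k', d', -, hp⟩, -⟩
    exact h hp.left_mem

/-- While the centres of one bag are handled, `net` stays fixed, and it is updated once at the end.
By then the clusters contain everything newly covered. -/
theorem IsClustering.netStep {F : ι} (h : IsClustering G c l K net cl q)
    (hcov : ∀ x w, D.bag x = F → Seed D l net x w → cl w ≠ none) :
    IsClustering G c l K (netStep D l net F) cl q where
  covered w hw := by
    unfold SmallDiam.netStep at hw
    split_ifs at hw with h'
    · obtain ⟨x, hx, hs⟩ := h'
      exact hcov x w hx hs
    · exact h.covered w hw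
  radius := h.radius
  cost := h.cost

/-- Grow clusters around the vertices of the bag in the variable `21`, which are not covered. -/
def growAll : Prg :=
  .loop 25 0 (.ite (.and (.eq (.at 2 (.var 25)) (.var 21)) (zeroTest 7 25)) grow .skip)

/-- Cover the marked vertices. -/
def cover : Prg :=
  .loop 22 0 (.ite (.eq (.at 9 (.var 22)) (.lit 1))
    (.setNat 7 (.var 22) (.lit 0) (.add (.var 21) (.lit 1))) .skip)

/-- Process the bag in the variable `21`. -/
def process : Prg :=
  .seq prepare (.seq growAll (.seq cover (.setNat 6 (.var 21) (.lit 0) (.lit 1))))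

variable {I : Instance} {s : State} {net : Fin I.n → Option (Fin I.m)}
  {cl : Fin I.n → Option (Fin I.n)} {q : Fin I.n → ℕ} {r : ℕ} {F : Fin I.m}

open Classical in
theorem growAll_spec (hE : Env I s) (hnet : ∀ w : Fin I.n, s.nat 7 w 0 = code (net w))
    (hcl : ∀ w : Fin I.n, s.nat 8 w 0 = code (cl w)) (hr : s.nat 12 0 0 = r) (hr0 : 0 < r)
    (hF : s.nat 21 0 0 = F) (hok : ∀ w : Fin I.n, s.nat 10 w 0 = 1 ↔ Meets I.D net F w)
    (h9 : ∀ w : Fin I.n, s.nat 9 w 0 = 0)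
    (hI : IsClustering I.G I.c I.l (2 * (r : ℝ) ^ 2) net cl q) :
    ∃ cl' : Fin I.n → Option (Fin I.n), (∀ w : Fin I.n, (growAll.run s).nat 8 w 0 = code (cl' w)) ∧
      IsClustering I.G I.c I.l (2 * (r : ℝ) ^ 2) net cl'
        (q + fun u => ∑ x ∈ Finset.univ.filter (fun x => I.D.bag x = F),
          chargeAt I.D I.l net x u) ∧
      (∀ x w, I.D.bag x = F → Seed I.D I.l net x w → cl' w ≠ none) ∧
      ∀ w : Fin I.n, (growAll.run s).nat 9 w 0 =
        if ∃ x, I.D.bag x = F ∧ Seed I.D I.l net x w then 1 else 0 := by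
  have key := hE.loop (v := 25) (B := 0)
    (P := .ite (.and (.eq (.at 2 (.var 25)) (.var 21)) (zeroTest 7 25)) grow .skip) rfl
    (fun j s' => ∃ cl' : Fin I.n → Option (Fin I.n), (∀ w : Fin I.n, s'.nat 8 w 0 = code (cl' w)) ∧
      IsClustering I.G I.c I.l (2 * (r : ℝ) ^ 2) net cl'
        (q + fun u => ∑ x ∈ Finset.univ.filter (fun x => x.val < j ∧ I.D.bag x = F),
          chargeAt I.D I.l net x u) ∧
      (∀ x w : Fin I.n, x.val < j → I.D.bag x = F → Seed I.D I.l net x w → cl' w ≠ none) ∧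
      ∀ w : Fin I.n, s'.nat 9 w 0 =
        if ∃ x : Fin I.n, x.val < j ∧ I.D.bag x = F ∧ Seed I.D I.l net x w then 1 else 0)
    (fun j s k h => h) ⟨cl, hcl, ?_, fun x w h => absurd h (Nat.not_lt_zero _), ?_⟩ ?_
  · rw [hE.n] at key
    simp only [Fin.is_lt, true_and, forall_const] at key
    exact key
  · convert hI using 1
    funext u
    simp
  · simpa using h9
  rintro j hj s' hE' hN hV hj' ⟨cl', hcl', hI', hcov, h9'⟩
  rw [hE.n] at hj
  obtain ⟨x, rfl⟩ : ∃ z : Fin I.n, z.val = j := ⟨⟨j, hj⟩, rfl⟩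
  have hnet' : ∀ w : Fin I.n, s'.nat 7 w 0 = code (net w) := fun w => by rw [hN 7 rfl, hnet]
  have hF' : s'.nat 21 0 0 = F := by rw [hN 21 rfl, hF]
  have hc : (Cond.and (.eq (.at 2 (.var 25)) (.var 21)) (zeroTest 7 25)).holds s' ↔
      I.D.bag x = F ∧ net x = none := by
    rw [Cond.holds, Cond.eq_holds, zeroTest_holds]
    simp only [NExp.eval, hj', hF', hE'.bag, hnet', code_eq_zero, Fin.ext_iff]
  have hsum : ∀ u, ∑ y ∈ Finset.univ.filter (fun y : Fin I.n => y.val < x.val + 1 ∧ I.D.bag y = F),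
      chargeAt I.D I.l net y u = (∑ y ∈ Finset.univ.filter (fun y : Fin I.n => y.val < x.val ∧
        I.D.bag y = F), chargeAt I.D I.l net y u) +
        if I.D.bag x = F then chargeAt I.D I.l net x u else 0 := by
    intro u
    by_cases hx : I.D.bag x = F
    · have : Finset.univ.filter (fun y : Fin I.n => y.val < x.val + 1 ∧ I.D.bag y = F) =
          insert x (Finset.univ.filter (fun y : Fin I.n => y.val < x.val ∧ I.D.bag y = F)) := by
        ext y
        simp only [Finset.mem_filter, Finset.mem_univ, true_and, Finset.mem_insert, Fin.ext_iff]
        constructor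
        · rintro ⟨h1, h2⟩
          rcases Nat.lt_succ_iff_lt_or_eq.1 h1 with h1 | h1
          · exact .inr ⟨h1, h2⟩
          · exact .inl h1
        · rintro (h1 | ⟨h1, h2⟩)
          · exact ⟨by omega, by rw [Fin.ext h1, hx]⟩
          · exact ⟨by omega, h2⟩
      rw [this, Finset.sum_insert (by simp), if_pos hx, add_comm]
    · rw [if_neg hx, add_zero]
      refine Finset.sum_congr (Finset.filter_congr fun y _ => and_congr_left fun hy => ?_) fun _ _ => rfl
      have : y.val ≠ x.val := fun h => hx (by rw [← Fin.ext h, hy])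
      omega
  have hlt : ∀ (y : Fin I.n) (w : Fin I.n), y.val < x.val + 1 ∧ I.D.bag y = F ∧
      Seed I.D I.l net y w → (y.val < x.val ∧ I.D.bag y = F ∧ Seed I.D I.l net y w) ∨
        (I.D.bag x = F ∧ Seed I.D I.l net x w) := by
    rintro y w ⟨h1, h2⟩
    rcases Nat.lt_succ_iff_lt_or_eq.1 h1 with h1 | h1
    · exact .inl ⟨h1, h2⟩
    · exact .inr (Fin.ext h1 ▸ h2)
  by_cases h : I.D.bag x = F ∧ net x = none
  · rw [Prg.run_ite_pos (hc.2 h)]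
    obtain ⟨hxF, hxn⟩ := h
    obtain ⟨cl₂, h1, h2, h3, h4, h5⟩ := grow_spec hE' hnet' hcl' (by rw [hN 12 rfl, hr]) hr0 hj' hxn
      (fun w => by rw [hN 10 rfl, hok, hxF]) hI'
    refine ⟨cl₂, h1, ?_, fun y w hy hyF hs => ?_, fun w => ?_⟩
    · convert h2 using 1
      rw [add_assoc]
      congr 1
      funext u
      rw [Pi.add_apply, hsum, if_pos hxF]
    · rcases hlt y w ⟨hy, hyF, hs⟩ with h | h
      · exact h3 w (hcov y w h.1 h.2.1 h.2.2)
      · exact h4 w h.2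
    · rw [h5, h9']
      by_cases hs : Seed I.D I.l net x w
      · rw [if_pos hs, if_pos ⟨x, Nat.lt_succ_self _, hxF, hs⟩]
      · rw [if_neg hs]
        refine if_congr ⟨?_, ?_⟩ rfl rfl
        · rintro ⟨y, hy, hs⟩; exact ⟨y, by omega, hs⟩
        · rintro ⟨y, hy⟩
          rcases hlt y w hy with h | h
          · exact ⟨y, h⟩
          · exact absurd h.2 hs
  · rw [Prg.run_ite_neg (mt hc.1 h)]
    have hno : I.D.bag x = F → ∀ w, ¬ Seed I.D I.l net x w := by
      rintro hxF w ⟨-, -, k', d', -, hp⟩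
      exact h ⟨hxF, hp.left_mem⟩
    refine ⟨cl', hcl', ?_, fun y w hy hyF hs => ?_, fun w => ?_⟩
    · convert hI' using 1
      congr 1
      funext u
      rw [hsum]
      split_ifs with hxF
      · rw [chargeAt_eq_zero fun hx => h ⟨hxF, hx⟩]; rfl
      · rfl
    · rcases hlt y w ⟨hy, hyF, hs⟩ with h | h
      · exact hcov y w h.1 h.2.1 h.2.2
      · exact absurd h.2 (hno h.1 w)
    · rw [Prg.run, h9']
      refine if_congr ⟨?_, ?_⟩ rfl rfl
      · rintro ⟨y, hy, hs⟩; exact ⟨y, by omega, hs⟩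
      · rintro ⟨y, hy⟩
        rcases hlt y w hy with h | h
        · exact ⟨y, h⟩
        · exact absurd h.2 (hno h.1 w)

theorem cover_spec (hE : Env I s) (hnet : ∀ w : Fin I.n, s.nat 7 w 0 = code (net w))
    (hF : s.nat 21 0 0 = F)
    (h9 : ∀ w : Fin I.n, s.nat 9 w 0 = 1 ↔ ∃ x, I.D.bag x = F ∧ Seed I.D I.l net x w) :
    ∀ w : Fin I.n, (cover.run s).nat 7 w 0 = code (netStep I.D I.l net F w) := by
  refine hE.map_loop (v := 22) rfl (fun w s' => s'.nat 7 w 0 = code (net w))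
    (fun w s' => s'.nat 7 w 0 = code (netStep I.D I.l net F w))
    (fun _ _ _ h => h) (fun _ _ _ h => h) hnet ?_
  intro u s' hE' hN hV hu h7
  have hc : (Cond.eq (.at 9 (.var 22)) (.lit 1)).holds s' ↔
      ∃ x, I.D.bag x = F ∧ Seed I.D I.l net x u := by
    rw [Cond.eq_holds, ← h9, ← hN 9 rfl]
    simp only [NExp.eval, hu]
  have hne : ∀ w ≠ u, w.val ≠ u.val := fun w hw h => hw (Fin.ext h)
  unfold netStep
  by_cases h : ∃ x, I.D.bag x = F ∧ Seed I.D I.l net x u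
  · rw [Prg.run_ite_pos (hc.2 h), if_pos h]
    refine ⟨?_, fun w hw => ?_⟩
    · simp [Prg.run, NExp.eval, hu, State.setNat_nat, code, hN 21 rfl, hF]
    · simp [Prg.run, NExp.eval, hu, State.setNat_nat, hne w hw]
  · rw [Prg.run_ite_neg (mt hc.1 h), if_neg h]
    exact ⟨h7, fun w _ => ⟨id, id⟩⟩

open Classical in
theorem process_spec (hE : Env I s) (hnet : ∀ w : Fin I.n, s.nat 7 w 0 = code (net w))
    (hcl : ∀ w : Fin I.n, s.nat 8 w 0 = code (cl w)) (hr : s.nat 12 0 0 = r) (hr0 : 0 < r)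
    (hF : s.nat 21 0 0 = F) (hI : IsClustering I.G I.c I.l (2 * (r : ℝ) ^ 2) net cl q) :
    (∀ w : Fin I.n, (process.run s).nat 7 w 0 = code (netStep I.D I.l net F w)) ∧
    (∃ cl' : Fin I.n → Option (Fin I.n), (∀ w : Fin I.n, (process.run s).nat 8 w 0 = code (cl' w)) ∧
      IsClustering I.G I.c I.l (2 * (r : ℝ) ^ 2) (netStep I.D I.l net F) cl'
        (q + fun u => ∑ x ∈ Finset.univ.filter (fun x => I.D.bag x = F),
          chargeAt I.D I.l net x u)) ∧
    (process.run s).nat 12 0 0 = r ∧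
    ∀ E : Fin I.m, (process.run s).nat 6 E 0 = if E = F then 1 else s.nat 6 E 0 := by
  have hprep := prepare_spec hE hnet hF
  set s₁ := prepare.run s with hs₁
  have hE₁ : Env I s₁ := hE.run rfl
  have h21₁ : s₁.nat 21 0 0 = F := by rw [hs₁, Prg.run_nat _ rfl, hF]
  have h7₁ : ∀ w : Fin I.n, s₁.nat 7 w 0 = code (net w) := fun w => by
    rw [hs₁, Prg.run_nat _ rfl, hnet]
  obtain ⟨cl', h8, hI', hcov, h9⟩ := growAll_spec hE₁ h7₁
    (fun w => by rw [hs₁, Prg.run_nat _ rfl, hcl]) (by rw [hs₁, Prg.run_nat _ rfl, hr]) hr0 h21₁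
    (fun w => (hprep w).1) (fun w => (hprep w).2) hI
  set s₂ := growAll.run s₁ with hs₂
  have hE₂ : Env I s₂ := hE₁.run rfl
  have h21₂ : s₂.nat 21 0 0 = F := by rw [hs₂, Prg.run_nat _ rfl, h21₁]
  have h7 := cover_spec hE₂ (net := net) (F := F) (fun w => by rw [hs₂, Prg.run_nat _ rfl, h7₁])
    h21₂ (fun w => by rw [h9]; simp)
  set s₃ := cover.run s₂ with hs₃
  have h21₃ : s₃.nat 21 0 0 = F := by rw [hs₃, Prg.run_nat _ rfl, h21₂]
  have hrun : process.run s = s₃.setNat 6 F 0 1 := by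
    simp only [process, Prg.run, NExp.eval]
    rw [← hs₁, ← hs₂, ← hs₃, h21₃]
  rw [hrun]
  refine ⟨fun w => ?_, ⟨cl', fun w => ?_, hI'.netStep hcov⟩, ?_, fun E => ?_⟩
  · rw [State.setNat_nat_ne (by norm_num), h7]
  · rw [State.setNat_nat_ne (by norm_num), hs₃, Prg.run_nat _ rfl, h8]
  · rw [State.setNat_nat_ne (by norm_num), hs₃, Prg.run_nat _ rfl, hs₂, Prg.run_nat _ rfl, hs₁,
      Prg.run_nat _ rfl, hr]
  · simp only [State.setNat_nat, true_and, and_true, Fin.ext_iff]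
    rw [hs₃, Prg.run_nat _ rfl, hs₂, Prg.run_nat _ rfl, hs₁, Prg.run_nat _ rfl]

end Covering

/-! ### Computing the width -/

section Width

/-- Store the number of vertices in the bag of the vertex in the variable `22`. -/
def countBag : Prg :=
  .seq (.setNat 13 (.lit 0) (.lit 0) (.lit 0))
    (.loop 23 0 (.ite (.eq (.at 2 (.var 23)) (.at 2 (.var 22)))
      (.setNat 13 (.lit 0) (.lit 0) (.add (.var 13) (.lit 1))) .skip))

/-- Store the width in the variable `12`. -/
def computeWidth : Prg :=
  .loop 22 0 (.seq countBag (.ite (.le (.var 13) (.var 12)) .skip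
    (.setNat 12 (.lit 0) (.lit 0) (.var 13))))

variable {I : Instance} {s : State}

open Classical in
theorem countBag_spec (hE : Env I s) {x : Fin I.n} (hx : s.nat 22 0 0 = x) :
    (countBag.run s).nat 13 0 0 = (Finset.univ.filter fun y => I.D.bag y = I.D.bag x).card := by
  have hE₁ : Env I (s.setNat 13 0 0 0) := hE.setNat (by norm_num)
  have key := hE₁.loop (v := 23) (B := 0) (P := .ite (.eq (.at 2 (.var 23)) (.at 2 (.var 22)))
      (.setNat 13 (.lit 0) (.lit 0) (.add (.var 13) (.lit 1))) .skip) rfl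
    (fun j s' => s'.nat 13 0 0 =
      (Finset.univ.filter fun y : Fin I.n => y.val < j ∧ I.D.bag y = I.D.bag x).card)
    (fun j s k h => h) (by simp [State.setNat_nat]) ?_
  · rw [hE₁.n] at key
    simp only [Fin.is_lt, true_and] at key
    exact key
  intro j hj s' hE' hN hV hj' hInv
  rw [hE₁.n] at hj
  obtain ⟨y, rfl⟩ : ∃ z : Fin I.n, z.val = j := ⟨⟨j, hj⟩, rfl⟩
  have hx' : s'.nat 22 0 0 = x := by rw [hN 22 rfl, State.setNat_nat_ne (by norm_num), hx]
  have hc : (Cond.eq (.at 2 (.var 23)) (.at 2 (.var 22))).holds s' ↔ I.D.bag y = I.D.bag x := by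
    rw [Cond.eq_holds]
    simp only [NExp.eval, hj', hx', hE'.bag, Fin.ext_iff]
  by_cases h : I.D.bag y = I.D.bag x
  · rw [Prg.run_ite_pos (hc.2 h)]
    have : Finset.univ.filter (fun z : Fin I.n => z.val < y.val + 1 ∧ I.D.bag z = I.D.bag x) =
        insert y (Finset.univ.filter fun z : Fin I.n => z.val < y.val ∧ I.D.bag z = I.D.bag x) := by
      ext z
      simp only [Finset.mem_filter, Finset.mem_univ, true_and, Finset.mem_insert, Fin.ext_iff]
      constructor
      · rintro ⟨h1, h2⟩
        rcases Nat.lt_succ_iff_lt_or_eq.1 h1 with h1 | h1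
        · exact .inr ⟨h1, h2⟩
        · exact .inl h1
      · rintro (h1 | ⟨h1, h2⟩)
        · exact ⟨by omega, by rw [Fin.ext h1, h]⟩
        · exact ⟨by omega, h2⟩
    rw [this, Finset.card_insert_of_notMem (by simp), ← hInv]
    simp [Prg.run, NExp.eval, State.setNat_nat]
  · rw [Prg.run_ite_neg (mt hc.1 h), Prg.run, hInv]
    congr 1
    refine Finset.filter_congr fun z _ => and_congr_left fun hz => ?_
    have : z.val ≠ y.val := fun h' => h (by rw [← Fin.ext h', hz])
    omega

open Classical in
theorem card_bag_le_width {V ι : Type*} [Fintype V] [Fintype ι] {G : SimpleGraph V}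
    (D : TreePartition G ι) (E : ι) :
    (Finset.univ.filter fun y => D.bag y = E).card ≤ D.width :=
  Finset.le_sup (f := fun E => (Finset.univ.filter fun y => D.bag y = E).card) (Finset.mem_univ E)

theorem computeWidth_spec (hE : Env I s) (h0 : s.nat 12 0 0 = 0) :
    (computeWidth.run s).nat 12 0 0 = I.D.width := by
  classical
  have key := hE.loop (v := 22) (B := 0) (P := .seq countBag (.ite (.le (.var 13) (.var 12)) .skip
    (.setNat 12 (.lit 0) (.lit 0) (.var 13)))) rfl
    (fun j s' => s'.nat 12 0 0 ≤ I.D.width ∧ ∀ x : Fin I.n, x.val < j →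
      (Finset.univ.filter fun y => I.D.bag y = I.D.bag x).card ≤ s'.nat 12 0 0)
    (fun j s k h => h) ⟨by rw [h0]; exact Nat.zero_le _, fun x h => absurd h (Nat.not_lt_zero _)⟩ ?_
  · rw [hE.n] at key
    refine le_antisymm key.1 ?_
    unfold TreePartition.width
    refine Finset.sup_le fun E _ => ?_
    obtain ⟨x, rfl⟩ := I.D.bag_surjective E
    refine le_trans (le_of_eq ?_) (key.2 x x.2)
    congr!
  rintro j hj s' hE' hN hV hj' ⟨h1, h2⟩
  rw [hE.n] at hj
  obtain ⟨x, rfl⟩ : ∃ z : Fin I.n, z.val = j := ⟨⟨j, hj⟩, rfl⟩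
  have hcount := countBag_spec hE' hj'
  have h12 : (countBag.run s').nat 12 0 0 = s'.nat 12 0 0 := by rw [Prg.run_nat _ rfl]
  rw [Prg.run]
  by_cases h : (countBag.run s').nat 13 0 0 ≤ (countBag.run s').nat 12 0 0
  · rw [Prg.run_ite_pos (by simpa only [Cond.holds, NExp.eval] using h), Prg.run, h12]
    refine ⟨h1, fun y hy => ?_⟩
    rcases Nat.lt_succ_iff_lt_or_eq.1 hy with hy | hy
    · exact h2 y hy
    · rw [Fin.ext hy, ← hcount, ← h12]
      exact h
  · rw [Prg.run_ite_neg (by simpa only [Cond.holds, NExp.eval] using h)]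
    simp only [Prg.run, NExp.eval, State.setNat_nat, and_self, if_true]
    refine ⟨?_, fun y hy => ?_⟩
    · rw [hcount]
      refine le_trans (le_of_eq ?_) (card_bag_le_width I.D (I.D.bag x))
      congr!
    rcases Nat.lt_succ_iff_lt_or_eq.1 hy with hy | hy
    · have := h2 y hy; omega
    · rw [Fin.ext hy, ← hcount]

theorem width_pos {V ι : Type*} [Fintype V] [Fintype ι] {G : SimpleGraph V}
    (D : TreePartition G ι) (v : V) : 0 < D.width := by
  classical
  refine lt_of_lt_of_le (Finset.card_pos.2 ⟨v, ?_⟩) (card_bag_le_width D (D.bag v))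
  simp

end Width

/-! ### Processing all bags, parents first -/

section Schedule

/-- Process the bag in the variable `21`, if it is not processed but its parent is. -/
def visit : Prg :=
  .ite (.and (zeroTest 6 21) (.not (.and (.not (.eq (.at 3 (.var 21)) (.var 21)))
    (.eq (.at 6 (.at 3 (.var 21))) (.lit 0))))) process .skip

/-- Process all bags, parents first. -/
def processAll : Prg := .loop 20 1 (.loop 21 1 visit)

variable {I : Instance} {s : State}

open Classical in
/-- The bags with nonzero entry in array `6` have been processed. -/
def Processed (I : Instance) (s : State) : Prop :=
  s.nat 12 0 0 = I.D.width ∧ ∃ (T : ℕ) (ord : ℕ → Fin I.m) (cl : Fin I.n → Option (Fin I.n)),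
    Topo I.D ord T ∧ (∀ w : Fin I.n, s.nat 7 w 0 = code (netAt I.D I.l ord T w)) ∧
    (∀ w : Fin I.n, s.nat 8 w 0 = code (cl w)) ∧
    IsClustering I.G I.c I.l (2 * (I.D.width : ℝ) ^ 2) (netAt I.D I.l ord T) cl
      (charges I.D I.l ord T) ∧
    ∀ F : Fin I.m, s.nat 6 F 0 ≠ 0 ↔ ∃ t < T, ord t = F

theorem charges_congr {V ι : Type*} [Fintype V] {G : SimpleGraph V} {D : TreePartition G ι}
    {l : Sym2 V → ℝ} {ord ord' : ℕ → ι} {T : ℕ} (h : ∀ t < T, ord t = ord' t) :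
    charges D l ord T = charges D l ord' T := by
  funext u
  unfold charges
  refine Finset.sum_congr rfl fun t ht => ?_
  rw [Finset.mem_range] at ht
  rw [h t ht, netAt_congr fun t' ht' => h t' (ht'.trans ht)]

theorem Topo.snoc {V ι : Type*} {G : SimpleGraph V} {D : TreePartition G ι} {ord : ℕ → ι} {T : ℕ}
    (h : Topo D ord T) {F : ι} (hF : ¬ ∃ t < T, ord t = F)
    (hp : D.parent F = F ∨ ∃ t < T, ord t = D.parent F) :
    Topo D (Function.update ord T F) (T + 1) := by
  have hlt : ∀ t < T, Function.update ord T F t = ord t := fun t ht =>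
    Function.update_of_ne ht.ne _ _
  constructor
  · intro t ht t' ht' heq
    rcases Nat.lt_succ_iff_lt_or_eq.1 ht with h1 | rfl <;>
      rcases Nat.lt_succ_iff_lt_or_eq.1 ht' with h2 | rfl
    · rw [hlt t h1, hlt t' h2] at heq
      exact h.inj t h1 t' h2 heq
    · rw [hlt t h1, Function.update_self] at heq
      exact absurd ⟨t, h1, heq⟩ hF
    · rw [hlt t' h2, Function.update_self] at heq
      exact absurd ⟨t', h2, heq.symm⟩ hF
    · rfl
  · intro t ht
    rcases Nat.lt_succ_iff_lt_or_eq.1 ht with h1 | rfl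
    · rw [hlt t h1]
      rcases h.parent t h1 with h2 | ⟨t', h2, h3⟩
      · exact .inl h2
      · exact .inr ⟨t', h2, by rw [hlt t' (h2.trans h1), h3]⟩
    · rw [Function.update_self]
      rcases hp with h2 | ⟨t', h2, h3⟩
      · exact .inl h2
      · exact .inr ⟨t', h2, by rw [hlt t' h2, h3]⟩

theorem visit_spec (hE : Env I s) (h : Processed I s) {F : Fin I.m} (hF : s.nat 21 0 0 = F) :
    Processed I (visit.run s) ∧
      (∀ E : Fin I.m, s.nat 6 E 0 ≠ 0 → (visit.run s).nat 6 E 0 ≠ 0) ∧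
      (I.D.parent F = F ∨ s.nat 6 (I.D.parent F) 0 ≠ 0 → (visit.run s).nat 6 F 0 ≠ 0) := by
  classical
  have hc : (Cond.and (zeroTest 6 21) (.not (.and (.not (.eq (.at 3 (.var 21)) (.var 21)))
      (.eq (.at 6 (.at 3 (.var 21))) (.lit 0))))).holds s ↔
      s.nat 6 F 0 = 0 ∧ (I.D.parent F = F ∨ s.nat 6 (I.D.parent F) 0 ≠ 0) := by
    rw [Cond.holds, Cond.holds, Cond.holds, Cond.holds, Cond.eq_holds, Cond.eq_holds, zeroTest_holds]
    simp only [NExp.eval, hF, hE.parent, Fin.ext_iff]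
    tauto
  by_cases hif : s.nat 6 F 0 = 0 ∧ (I.D.parent F = F ∨ s.nat 6 (I.D.parent F) 0 ≠ 0)
  · unfold visit
    rw [Prg.run_ite_pos (hc.2 hif)]
    obtain ⟨h12, T, ord, cl, hT, h7, h8, hI, h6⟩ := h
    -- The bag is nonempty, so the width is positive.
    obtain ⟨x, -⟩ := I.D.bag_surjective F
    obtain ⟨g7, ⟨cl', g8, gI⟩, g12, g6⟩ := process_spec hE h7 h8 h12 (width_pos I.D x) hF hI
    have hlt : ∀ t < T, ord t = Function.update ord T F t := fun t ht =>
      (Function.update_of_ne ht.ne _ _).symm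
    have hnet : netAt I.D I.l (Function.update ord T F) (T + 1) =
        netStep I.D I.l (netAt I.D I.l ord T) F := by
      rw [netAt, Function.update_self, netAt_congr hlt]
    refine ⟨⟨g12, T + 1, Function.update ord T F, cl', hT.snoc ?_ ?_, ?_, g8, ?_, fun E => ?_⟩, ?_, ?_⟩
    · rw [← h6, not_not]; exact hif.1
    · rw [← h6]; exact hif.2
    · rw [hnet]; exact g7
    · rw [hnet]
      convert gI using 1
      rw [charges_congr hlt]
      funext u
      rw [Pi.add_apply]
      unfold charges
      rw [Finset.sum_range_succ, Function.update_self, netAt_congr hlt]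
      congr!
    · rw [g6]
      have h1 : (∃ t < T + 1, Function.update ord T F t = E) ↔ E = F ∨ ∃ t < T, ord t = E := by
        constructor
        · rintro ⟨t, ht, rfl⟩
          rcases Nat.lt_succ_iff_lt_or_eq.1 ht with h1 | rfl
          · exact .inr ⟨t, h1, hlt t h1⟩
          · exact .inl (Function.update_self ..)
        · rintro (rfl | ⟨t, ht, rfl⟩)
          · exact ⟨T, Nat.lt_succ_self _, Function.update_self ..⟩
          · exact ⟨t, by omega, (hlt t ht).symm⟩
      rw [h1, ← h6]
      split_ifs with hEF <;> simp [hEF]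
    · intro E hE
      rw [g6]
      split_ifs
      · exact one_ne_zero
      · exact hE
    · intro _
      rw [g6, if_pos rfl]
      exact one_ne_zero
  · unfold visit
    rw [Prg.run_ite_neg (mt hc.1 hif), Prg.run]
    exact ⟨h, fun _ => id, fun hp h0 => hif ⟨h0, hp⟩⟩

/-- Processed bags stay processed, so it suffices that the parent was processed when the round
began. -/
theorem round_spec (hE : Env I s) (h : Processed I s) :
    Processed I ((Prg.loop 21 1 visit).run s) ∧
      ∀ F : Fin I.m, I.D.parent F = F ∨ s.nat 6 (I.D.parent F) 0 ≠ 0 →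
        ((Prg.loop 21 1 visit).run s).nat 6 F 0 ≠ 0 := by
  have key := hE.loop (v := 21) (B := 1) (P := visit) rfl
    (fun j s' => Processed I s' ∧ (∀ F : Fin I.m, s.nat 6 F 0 ≠ 0 → s'.nat 6 F 0 ≠ 0) ∧
      ∀ F : Fin I.m, F.val < j → I.D.parent F = F ∨ s.nat 6 (I.D.parent F) 0 ≠ 0 →
        s'.nat 6 F 0 ≠ 0) (fun j s k h => h)
    ⟨h, fun _ => id, fun F h => absurd h (Nat.not_lt_zero _)⟩ ?_
  · rw [hE.m] at key
    exact ⟨key.1, fun F => key.2.2 F F.2⟩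
  rintro j hj s' hE' hN hV hj' ⟨h1, h2, h3⟩
  rw [hE.m] at hj
  obtain ⟨F, rfl⟩ : ∃ z : Fin I.m, z.val = j := ⟨⟨j, hj⟩, rfl⟩
  obtain ⟨g1, g2, g3⟩ := visit_spec hE' h1 hj'
  refine ⟨g1, fun E hE => g2 E (h2 E hE), fun E hEF hp => ?_⟩
  rcases Nat.lt_succ_iff_lt_or_eq.1 hEF with h | h
  · exact g2 E (h3 E h hp)
  · obtain rfl := Fin.ext h
    exact g3 (hp.imp_right (h2 _))

/-- On a shortest way to the root no bag repeats, since a repetition could be cut out; so there are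
fewer than `m` steps. -/
theorem TreePartition.exists_iterate_lt {V : Type*} {G : SimpleGraph V} {m : ℕ}
    (D : TreePartition G (Fin m)) (F : Fin m) : ∃ k < m, D.parent^[k] F = D.root := by
  classical
  have h := D.reaches_root F
  refine ⟨Nat.find h, ?_, Nat.find_spec h⟩
  by_contra hlt
  have hinj : Function.Injective fun i : Fin (m + 1) => D.parent^[i.val] F := by
    have key : ∀ i j : Fin (m + 1), i.val < j.val → D.parent^[i.val] F = D.parent^[j.val] F → False := by
      intro i j hij heq
      have hj := j.2
      refine Nat.find_min h (m := Nat.find h - j.val + i.val) (by omega) ?_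
      rw [Function.iterate_add_apply, heq, ← Function.iterate_add_apply,
        Nat.sub_add_cancel (by omega)]
      exact Nat.find_spec h
    intro i j heq
    rcases lt_trichotomy i.val j.val with h1 | h1 | h1
    · exact (key i j h1 heq).elim
    · exact Fin.ext h1
    · exact (key j i h1 heq.symm).elim
  have := Fintype.card_le_of_injective _ hinj
  simp at this

/-- After `j` rounds all bags of depth less than `j` are processed, and every depth is less than
`m`. -/
theorem processAll_spec (hE : Env I s) (h : Processed I s) :
    Processed I (processAll.run s) ∧ ∀ F : Fin I.m, (processAll.run s).nat 6 F 0 ≠ 0 := by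
  have key := hE.loop (v := 20) (B := 1) (P := .loop 21 1 visit) rfl
    (fun j s' => Processed I s' ∧ ∀ (F : Fin I.m) (k : ℕ), k < j → I.D.parent^[k] F = I.D.root →
      s'.nat 6 F 0 ≠ 0) (fun j s k h => h) ⟨h, fun F k h => absurd h (Nat.not_lt_zero _)⟩ ?_
  · rw [hE.m] at key
    refine ⟨key.1, fun F => ?_⟩
    obtain ⟨k, hk, hroot⟩ := I.D.exists_iterate_lt F
    exact key.2 F k hk hroot
  rintro j hj s' hE' hN hV hj' ⟨h1, h2⟩
  obtain ⟨g1, g2⟩ := round_spec hE' h1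
  refine ⟨g1, fun F k hk hroot => g2 F ?_⟩
  cases k with
  | zero =>
    left
    rw [Function.iterate_zero, id] at hroot
    rw [hroot, I.D.parent_root]
  | succ k =>
    rw [Function.iterate_succ_apply] at hroot
    exact .inr (h2 _ k (by omega) hroot)

end Schedule

/-! ### Writing the result, and the whole algorithm -/

section Output

/-- Write the edges between different clusters to array `5`. -/
def output : Prg :=
  .loop 22 0 (.loop 23 0 (.ite (.and (adjTest 22 23)
    (.not (.eq (.at 8 (.var 22)) (.at 8 (.var 23)))))
    (.setNat 5 (.var 22) (.var 23) (.lit 1)) .skip))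

/-- The algorithm. -/
def algorithm : Prg := .seq computeWidth (.seq processAll output)

variable {I : Instance} {s : State} {cl : Fin I.n → Option (Fin I.n)}

open Classical in
theorem output_spec (hE : Env I s) (hcl : ∀ w : Fin I.n, s.nat 8 w 0 = code (cl w))
    (h5 : ∀ u w : Fin I.n, s.nat 5 u w = 0) :
    ∀ u w : Fin I.n, (output.run s).nat 5 u w = if I.G.Adj u w ∧ cl u ≠ cl w then 1 else 0 := by
  have key := hE.loop (v := 22) (B := 0) (P := .loop 23 0 (.ite (.and (adjTest 22 23)
    (.not (.eq (.at 8 (.var 22)) (.at 8 (.var 23)))))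
    (.setNat 5 (.var 22) (.var 23) (.lit 1)) .skip)) rfl
    (fun j s' => ∀ u w : Fin I.n, s'.nat 5 u w =
      if u.val < j ∧ I.G.Adj u w ∧ cl u ≠ cl w then 1 else 0) (fun j s k h => h) (by simpa using h5) ?_
  · rw [hE.n] at key
    simp only [Fin.is_lt, true_and] at key
    exact key
  intro j hj s' hE' hN hV hj' hInv
  rw [hE.n] at hj
  obtain ⟨x, rfl⟩ : ∃ z : Fin I.n, z.val = j := ⟨⟨j, hj⟩, rfl⟩
  have key := hE'.loop (v := 23) (B := 0) (P := .ite (.and (adjTest 22 23)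
    (.not (.eq (.at 8 (.var 22)) (.at 8 (.var 23)))))
    (.setNat 5 (.var 22) (.var 23) (.lit 1)) .skip) rfl
    (fun j s' => ∀ u w : Fin I.n, s'.nat 5 u w =
      if (u.val < x.val ∨ u = x ∧ w.val < j) ∧ I.G.Adj u w ∧ cl u ≠ cl w then 1 else 0)
    (fun j s k h => h) (by simpa using hInv) ?_
  · rw [hE'.n] at key
    intro u w
    rw [key]
    refine if_congr (and_congr_left fun _ => ?_) rfl rfl
    rw [Nat.lt_succ_iff_lt_or_eq, Fin.ext_iff]
    simp
  intro i hi s₂ hE₂ hN₂ hV₂ hi' hInv₂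
  rw [hE'.n] at hi
  obtain ⟨y, rfl⟩ : ∃ z : Fin I.n, z.val = i := ⟨⟨i, hi⟩, rfl⟩
  have hx : s₂.nat 22 0 0 = x := by rw [hN₂ 22 rfl, hj']
  have h8 : ∀ w : Fin I.n, s₂.nat 8 w 0 = code (cl w) := fun w => by rw [hN₂ 8 rfl, hN 8 rfl, hcl]
  have hc : (Cond.and (adjTest 22 23) (.not (.eq (.at 8 (.var 22)) (.at 8 (.var 23))))).holds s₂ ↔
      I.G.Adj x y ∧ cl x ≠ cl y := by
    rw [Cond.holds, Cond.holds, adjTest_holds, Cond.eq_holds]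
    simp only [NExp.eval, hi', hx, h8, code_inj, hE₂.adj, ne_eq]
  intro u w
  by_cases huw : u = x ∧ w = y
  · obtain ⟨rfl, rfl⟩ := huw
    by_cases h : I.G.Adj u w ∧ cl u ≠ cl w
    · rw [Prg.run_ite_pos (hc.2 h), if_pos ⟨.inr ⟨rfl, Nat.lt_succ_self _⟩, h⟩]
      simp [Prg.run, NExp.eval, hi', hx, State.setNat_nat]
    · rw [Prg.run_ite_neg (mt hc.1 h), if_neg (fun h' => h h'.2), Prg.run, hInv₂,
        if_neg (fun h' => h h'.2)]
  · have hrest : ((Prg.ite (.and (adjTest 22 23) (.not (.eq (.at 8 (.var 22)) (.at 8 (.var 23)))))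
        (.setNat 5 (.var 22) (.var 23) (.lit 1)) .skip).run s₂).nat 5 u w = s₂.nat 5 u w := by
      by_cases h : I.G.Adj x y ∧ cl x ≠ cl y
      · rw [Prg.run_ite_pos (hc.2 h)]
        simp only [Prg.run, NExp.eval, hi', hx, State.setNat_nat, true_and, ← Fin.ext_iff, if_neg huw]
      · rw [Prg.run_ite_neg (mt hc.1 h), Prg.run]
    rw [hrest, hInv₂]
    refine if_congr (and_congr_left fun _ => or_congr_right (and_congr_right fun hu => ?_)) rfl rfl
    have : w.val ≠ y.val := fun h => huw ⟨hu, Fin.ext h⟩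
    omega

end Output

/-! ### From labels to sets of edges -/

section CutEdges

variable {V κ : Type*} [Fintype V] (G : SimpleGraph V)

open Classical in
/-- The edges between vertices with different labels. -/
noncomputable def cutEdges (cl : V → κ) : Finset (Sym2 V) :=
  Finset.univ.filter fun e => ∃ u w, e = s(u, w) ∧ G.Adj u w ∧ cl u ≠ cl w

variable {G} {c l : Sym2 V → ℝ}

theorem mem_cutEdges {cl : V → κ} {u w : V} :
    s(u, w) ∈ cutEdges G cl ↔ G.Adj u w ∧ cl u ≠ cl w := by
  simp only [cutEdges, Finset.mem_filter, Finset.mem_univ, true_and]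
  constructor
  · rintro ⟨u', w', h, ha, hne⟩
    rcases Sym2.eq_iff.1 h with ⟨rfl, rfl⟩ | ⟨rfl, rfl⟩
    · exact ⟨ha, hne⟩
    · exact ⟨ha.symm, hne.symm⟩
  · exact fun h => ⟨u, w, rfl, h⟩

theorem cutEdges_subset (cl : V → κ) : (cutEdges G cl : Set (Sym2 V)) ⊆ G.edgeSet := by
  intro e he
  induction e with
  | _ u w => exact (mem_cutEdges.1 he).1

/-- The supremum is over finitely many pairs, so the strict bound survives; pairs outside `S` get
the value `0`. -/
theorem weakDiam_lt_one {S : Set V} (h : ∀ u ∈ S, ∀ v ∈ S, dist G l u v < 1) :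
    weakDiam G l S < 1 := by
  classical
  refine lt_of_le_of_lt (b := Finset.univ.sup fun p : V × V =>
    if p.1 ∈ S ∧ p.2 ∈ S then dist G l p.1 p.2 else 0) ?_ ?_
  · refine iSup₂_le fun u hu => iSup₂_le fun v hv => ?_
    refine le_trans (le_of_eq ?_) (Finset.le_sup (f := fun p : V × V =>
      if p.1 ∈ S ∧ p.2 ∈ S then dist G l p.1 p.2 else 0) (Finset.mem_univ (u, v)))
    simp [hu, hv]
  · rw [Finset.sup_lt_iff (by simp)]
    rintro ⟨u, v⟩ -
    simp only
    split_ifs with h'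
    · exact h u h'.1 v h'.2
    · exact zero_lt_one

/-- Every remaining edge joins equal labels, so labels are constant on components. -/
theorem isSmallDiameterDecomposition_cutEdges {cl : V → κ}
    (h : ∀ u v, cl u = cl v → ∃ k d, d < 1 ∧ PathIn G l Set.univ u v k d) :
    IsSmallDiameterDecomposition G l (cutEdges G cl) := by
  refine ⟨cutEdges_subset cl, fun C => weakDiam_lt_one fun u hu v hv => ?_⟩
  have hcl : ∀ u v, (G.deleteEdges (cutEdges G cl : Set (Sym2 V))).Reachable u v → cl u = cl v := by
    rintro u v ⟨p⟩
    induction p with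
    | nil => rfl
    | cons ha _ ih =>
      rw [SimpleGraph.deleteEdges_adj] at ha
      rw [← ih]
      by_contra hne
      exact ha.2 (mem_cutEdges.2 ⟨ha.1, hne⟩)
  obtain ⟨k, d, hd, hp⟩ := h u v (hcl u v (SimpleGraph.ConnectedComponent.exact
    ((SimpleGraph.ConnectedComponent.mem_supp_iff C u).1 hu |>.trans
      ((SimpleGraph.ConnectedComponent.mem_supp_iff C v).1 hv).symm)))
  exact hp.dist_le.trans_lt (ENNReal.ofReal_lt_one.2 hd)

open Classical in
/-- A sum over ordered adjacent pairs counts every edge twice. -/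
theorem sum_adj_eq (f : Sym2 V → ℝ) :
    (∑ u, ∑ w, if G.Adj u w then f s(u, w) else 0) = 2 * edgeSum G f := by
  have h1 : (∑ u, ∑ w, if G.Adj u w then f s(u, w) else 0) =
      ∑ p ∈ Finset.univ.filter (fun p : V × V => G.Adj p.1 p.2), f s(p.1, p.2) := by
    rw [Finset.sum_filter, Fintype.sum_prod_type]
  have h2 : ∀ p ∈ Finset.univ.filter (fun p : V × V => G.Adj p.1 p.2),
      s(p.1, p.2) ∈ G.edgeFinset := by
    intro p hp
    simpa using hp
  rw [h1, ← Finset.sum_fiberwise_of_maps_to h2, edgeSum, Finset.mul_sum]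
  refine Finset.sum_congr rfl fun e he => ?_
  induction e with
  | _ u w =>
    have ha : G.Adj u w := by simpa using he
    have hset : (Finset.univ.filter (fun p : V × V => G.Adj p.1 p.2)).filter
        (fun p => s(p.1, p.2) = s(u, w)) = {(u, w), (w, u)} := by
      ext ⟨a, b⟩
      simp only [Finset.mem_filter, Finset.mem_univ, true_and, Finset.mem_insert,
        Finset.mem_singleton, Sym2.eq_iff, Prod.mk.injEq]
      constructor
      · exact fun h => h.2
      · rintro (⟨rfl, rfl⟩ | ⟨rfl, rfl⟩)
        · exact ⟨ha, .inl ⟨rfl, rfl⟩⟩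
        · exact ⟨ha.symm, .inr ⟨rfl, rfl⟩⟩
    rw [hset, Finset.sum_pair (by simp [ha.ne]), two_mul]
    simp only [Sym2.eq_swap]

theorem cutCost_eq (cl : V → Option κ) :
    cutCost G c cl = 2 * ∑ e ∈ cutEdges G cl, c e := by
  classical
  have h : ∑ e ∈ cutEdges G cl, c e = edgeSum G fun e => if e ∈ cutEdges G cl then c e else 0 := by
    unfold edgeSum
    rw [← Finset.sum_filter]
    refine Finset.sum_congr ?_ fun _ _ => rfl
    ext e
    simp only [Finset.mem_filter, SimpleGraph.mem_edgeFinset]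
    exact ⟨fun he => ⟨cutEdges_subset cl he, he⟩, fun he => he.2⟩
  rw [h, ← sum_adj_eq]
  unfold cutCost
  refine Finset.sum_congr rfl fun u _ => Finset.sum_congr rfl fun w _ => ?_
  simp only [mem_cutEdges]
  by_cases h1 : G.Adj u w <;> simp [h1]

theorem edgeSum_nonneg {f : Sym2 V → ℝ} (h : ∀ e ∈ G.edgeSet, 0 ≤ f e) : 0 ≤ edgeSum G f :=
  Finset.sum_nonneg fun e he => h e (by classical simpa using he)

end CutEdges

/-! ### The final constant -/

section Cost

variable {V ι : Type*} [Fintype V] {G : SimpleGraph V} {c l : Sym2 V → ℝ}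

/-- Compare `1 + 2 * r ^ 2` with the expansion of `(r + 1) ^ 3`. -/
theorem log_le_three_log (r : ℕ) :
    Real.log (1 + 2 * (r : ℝ) ^ 2) ≤ 3 * Real.log ((r : ℝ) + 1) := by
  have h : (3 : ℝ) * Real.log ((r : ℝ) + 1) = Real.log (((r : ℝ) + 1) ^ 3) := by
    rw [Real.log_pow]; norm_num
  rw [h]
  have hr : (0 : ℝ) ≤ r := Nat.cast_nonneg r
  refine Real.log_le_log (by positivity) ?_
  nlinarith [pow_nonneg hr 2, pow_nonneg hr 3]

/-- With `T` the sum over edges, ordered pairs give `2 * T` for the volume and `K * (2 * T)` for the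
charges. So `cutCost` is at most `48 * log (1 + K) * T`, hence at most `144 * log (r + 1) * T`,
which is below `2 * 136`. -/
theorem IsClustering.cutCost_le (hc : ∀ e ∈ G.edgeSet, 0 ≤ c e) (hl : ∀ e ∈ G.edgeSet, 0 ≤ l e)
    {r : ℕ} (hr : 0 < r) {net : V → Option ι} {cl : V → Option V} {q : V → ℕ}
    (h : IsClustering G c l (2 * (r : ℝ) ^ 2) net cl q) (hq : ∀ u, q u ≤ 2 * r ^ 2) :
    cutCost G c cl ≤
      2 * (136 * Real.log ((r : ℝ) + 1) * edgeSum G fun e => c e * l e) := by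
  classical
  have hcl : ∀ e ∈ G.edgeSet, 0 ≤ c e * l e := fun e he => mul_nonneg (hc e he) (hl e he)
  have hT := edgeSum_nonneg hcl
  set T := edgeSum G fun e => c e * l e with hTdef
  have hK : (0 : ℝ) < 2 * (r : ℝ) ^ 2 := by positivity
  have h0 : remVol G c l (fun _ => none : V → Option V) = 2 * T := by
    rw [hTdef, ← sum_adj_eq]
    simp [remVol]
  have h1 : 0 ≤ remVol G c l cl :=
    Finset.sum_nonneg fun u _ => Finset.sum_nonneg fun w _ => by
      split_ifs with h'
      · exact hcl _ h'.1
      · exact le_rfl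
  have h2 : chargeVol G c l q ≤ 2 * (r : ℝ) ^ 2 * (2 * T) := by
    rw [hTdef, ← sum_adj_eq, Finset.mul_sum]
    refine Finset.sum_le_sum fun u _ => ?_
    rw [Finset.mul_sum]
    refine Finset.sum_le_sum fun w _ => ?_
    split_ifs with ha
    · rw [mul_comm (2 * (r : ℝ) ^ 2)]
      exact mul_le_mul_of_nonneg_left (by exact_mod_cast hq u) (hcl _ ha)
    · simp
  have h3 := h.cost
  have hlog := log_le_three_log r
  have hlog0 : 0 ≤ Real.log (1 + 2 * (r : ℝ) ^ 2) := Real.log_nonneg (by linarith)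
  have hlog1 : 0 ≤ Real.log ((r : ℝ) + 1) := Real.log_nonneg (by simp)
  set L := Real.log (1 + 2 * (r : ℝ) ^ 2)
  set K := 2 * (r : ℝ) ^ 2
  have h4 : K * cutCost G c cl ≤ K * (2 * (L / (1 / 6)) * (4 * T)) := by
    refine h3.trans ?_
    have : K * (2 * (L / (1 / 6)) * (4 * T)) = 2 * (L / (1 / 6)) * (K * (2 * T) + K * (2 * T)) := by
      ring
    rw [this, h0]
    refine mul_le_mul_of_nonneg_left (add_le_add (mul_le_mul_of_nonneg_left ?_ hK.le) h2)
      (by positivity)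
    linarith
  have h5 := le_of_mul_le_mul_left h4 hK
  have h6 : L * T ≤ 3 * Real.log ((r : ℝ) + 1) * T := mul_le_mul_of_nonneg_right hlog hT
  have h7 : 0 ≤ Real.log ((r : ℝ) + 1) * T := mul_nonneg hlog1 hT
  have h8 : 2 * (L / (1 / 6)) * (4 * T) = 48 * (L * T) := by ring
  linarith

end Cost

/-! ### Correctness of the algorithm -/

section Correctness

open Classical in
theorem algorithm_spec (I : Instance) :
    ∃ cl : Fin I.n → Option (Fin I.n),
      (∀ u v, cl u = cl v → ∃ k d, d < 1 ∧ PathIn I.G I.l Set.univ u v k d) ∧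
      cutCost I.G I.c cl ≤
        2 * (136 * Real.log ((I.D.width : ℝ) + 1) * edgeSum I.G fun e => I.c e * I.l e) ∧
      ∀ u w : Fin I.n, (algorithm.run I.input).nat 5 u w =
        if I.G.Adj u w ∧ cl u ≠ cl w then 1 else 0 := by
  have hE := I.input_env
  have hzero : ∀ A i j, 5 ≤ A → I.input.nat A i j = 0 := by
    intro A i j hA
    simp only [Instance.input]
    rw [if_neg (by omega), if_neg (by omega), dif_neg (by omega), dif_neg (by omega),
      dif_neg (by omega)]
  have hwidth := computeWidth_spec hE (hzero 12 0 0 (by norm_num))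
  set s₁ := computeWidth.run I.input with hs₁
  have hE₁ : Env I s₁ := hE.run rfl
  have hP : Processed I s₁ := by
    refine ⟨hwidth, 0, fun _ => I.D.root, fun _ => none, ⟨?_, ?_⟩, fun w => ?_, fun w => ?_, ?_,
      fun F => ?_⟩
    · exact fun t ht => absurd ht (Nat.not_lt_zero t)
    · exact fun t ht => absurd ht (Nat.not_lt_zero t)
    · rw [hs₁, Prg.run_nat _ rfl, hzero 7 _ _ (by norm_num)]; rfl
    · rw [hs₁, Prg.run_nat _ rfl, hzero 8 _ _ (by norm_num)]; rfl
    · have h0 : charges I.D I.l (fun _ => I.D.root) 0 = 0 := by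
        funext u
        simp [charges]
      rw [h0]
      exact isClustering_none
    · rw [hs₁, Prg.run_nat _ rfl, hzero 6 _ _ (by norm_num)]
      simp
  obtain ⟨⟨-, T, ord, cl, hT, h7, h8, hI, h6⟩, hdone⟩ := processAll_spec hE₁ hP
  set s₂ := processAll.run s₁ with hs₂
  have hE₂ : Env I s₂ := hE₁.run rfl
  have hall : ∀ F, ∃ t < T, ord t = F := fun F => (h6 F).1 (hdone F)
  refine ⟨cl, fun u v huv => ?_, ?_, ?_⟩
  -- All bags are processed, so every vertex is labelled; equal labels then mean a common centre at
  -- distance less than `1 / 2` from both.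
  · have hne : cl u ≠ none := by
      obtain ⟨t, ht, heq⟩ := hall (I.D.bag u)
      exact hI.covered u (not_alive_of_bag heq.symm ht)
    obtain ⟨x, hx⟩ := Option.ne_none_iff_exists'.1 hne
    obtain ⟨k, d, hd, hp⟩ := hI.radius u x hx
    obtain ⟨k', d', hd', hp'⟩ := hI.radius v x (huv ▸ hx)
    exact ⟨_, _, by linarith, hp.symm.trans hp'⟩
  · rcases Nat.eq_zero_or_pos I.D.width with h0 | h0
    -- Region growing needs `K > 0`; width zero occurs only without vertices.
    · have : IsEmpty (Fin I.n) := ⟨fun v => by have := width_pos I.D v; omega⟩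
      simp [cutCost, h0]
    · exact hI.cutCost_le I.c_nonneg I.l_nonneg h0 fun u =>
        charges_le I.l_nonneg hT hall fun E => by convert card_bag_le_width I.D E
  · refine output_spec hE₂ h8 fun u w => ?_
    rw [Prg.run_nat _ rfl, Prg.run_nat _ rfl, hzero 5 _ _ le_rfl]

theorem algorithm_isSolution (I : Instance) : I.IsSolution (algorithm.run I.input) := by
  obtain ⟨cl, h1, h2, h3⟩ := algorithm_spec I
  classical
  refine ⟨cutEdges I.G cl, isSmallDiameterDecomposition_cutEdges h1, ?_, fun u v => ?_⟩
  · rw [cutCost_eq] at h2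
    linarith
  · rw [h3]
    exact if_congr mem_cutEdges.symm rfl rfl

end Correctness

/-! ### Transport to arbitrary finite vertex types -/

section Transport

variable {V : Type*} [Fintype V] {G : SimpleGraph V} {c l : Sym2 V → ℝ} {m : ℕ}

/-- The instance given by an enumeration of the vertices. -/
noncomputable def toInstance (D : TreePartition G (Fin m)) (hc : ∀ e ∈ G.edgeSet, 0 ≤ c e)
    (hl : ∀ e ∈ G.edgeSet, 0 ≤ l e) : Instance where
  n := Fintype.card V
  m := m
  G := G.comap (Fintype.equivFin V).symm
  D :=
    { bag := fun v => D.bag ((Fintype.equivFin V).symm v)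
      bag_surjective := D.bag_surjective.comp (Fintype.equivFin V).symm.surjective
      root := D.root
      parent := D.parent
      parent_root := D.parent_root
      reaches_root := D.reaches_root
      edge_mem := fun _ _ h => D.edge_mem _ _ h }
  c := fun e => c (e.map (Fintype.equivFin V).symm)
  l := fun e => l (e.map (Fintype.equivFin V).symm)
  c_nonneg := fun e => by
    induction e with
    | _ u w => exact fun h => hc _ h
  l_nonneg := fun e => by
    induction e with
    | _ u w => exact fun h => hl _ h

variable (D : TreePartition G (Fin m))

theorem toInstance_width (hc : ∀ e ∈ G.edgeSet, 0 ≤ c e)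
    (hl : ∀ e ∈ G.edgeSet, 0 ≤ l e) : (toInstance D hc hl).D.width = D.width := by
  classical
  unfold TreePartition.width
  refine Finset.sup_congr rfl fun i _ => ?_
  refine Finset.card_equiv (Fintype.equivFin V).symm fun v => ?_
  simp only [Finset.mem_filter, Finset.mem_univ, true_and]
  rfl

theorem pathIn_of_toInstance (hc : ∀ e ∈ G.edgeSet, 0 ≤ c e)
    (hl : ∀ e ∈ G.edgeSet, 0 ≤ l e)
    {u v : Fin (toInstance D hc hl).n} {k : ℕ} {d : ℝ}
    (h : PathIn (toInstance D hc hl).G (toInstance D hc hl).l Set.univ u v k d) :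
    PathIn G l Set.univ ((Fintype.equivFin V).symm u) ((Fintype.equivFin V).symm v) k d := by
  induction h with
  | refl _ => exact .refl trivial
  | step _ ha _ ih => exact .step ih ha trivial

theorem cutCost_comap {W κ : Type*} [Fintype W] (e : V ≃ W) (cl : W → Option κ) :
    cutCost (G.comap e.symm) (fun a => c (a.map e.symm)) cl = cutCost G c (cl ∘ e) := by
  unfold cutCost
  rw [← e.sum_comp]
  refine Finset.sum_congr rfl fun u _ => ?_
  rw [← e.sum_comp]
  refine Finset.sum_congr rfl fun w _ => ?_
  congr! 1 <;> simp

theorem edgeSum_comap {W : Type*} [Fintype W] (e : V ≃ W) (f : Sym2 V → ℝ) :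
    edgeSum (G.comap e.symm) (fun a => f (a.map e.symm)) = edgeSum G f := by
  classical
  refine mul_left_cancel₀ (two_ne_zero (α := ℝ)) ?_
  rw [← sum_adj_eq, ← sum_adj_eq, ← e.sum_comp]
  refine Finset.sum_congr rfl fun u _ => ?_
  rw [← e.sum_comp]
  refine Finset.sum_congr rfl fun w _ => ?_
  simp

theorem exists_cutCost_le (hc : ∀ e ∈ G.edgeSet, 0 ≤ c e) (hl : ∀ e ∈ G.edgeSet, 0 ≤ l e) :
    ∃ (n : ℕ) (cl : V → Option (Fin n)),
      (∀ u v, cl u = cl v → ∃ k d, d < 1 ∧ PathIn G l Set.univ u v k d) ∧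
      cutCost G c cl ≤ 2 * (136 * Real.log ((D.width : ℝ) + 1) * edgeSum G fun e => c e * l e) := by
  obtain ⟨cl, h1, h2, -⟩ := algorithm_spec (toInstance D hc hl)
  let e : V ≃ Fin (toInstance D hc hl).n := Fintype.equivFin V
  refine ⟨_, cl ∘ e, fun u v huv => ?_, ?_⟩
  · obtain ⟨k, d, hd, hp⟩ := h1 (e u) (e v) huv
    have hpath : PathIn G l Set.univ (e.symm (e u)) (e.symm (e v)) k d :=
      pathIn_of_toInstance D hc hl hp
    rw [e.symm_apply_apply, e.symm_apply_apply] at hpath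
    exact ⟨k, d, hd, hpath⟩
  · rw [toInstance_width] at h2
    rw [← cutCost_comap, ← edgeSum_comap e]
    exact h2

end Transport

end SmallDiam

theorem theorem2 :
    (∀ (V : Type u) [Fintype V] (G : SimpleGraph V) (r : ℕ) (c l : Sym2 V → ℝ),
      SmallDiam.HasWidthAtMost G r →
      (∀ e ∈ G.edgeSet, 0 ≤ c e) → (∀ e ∈ G.edgeSet, 0 ≤ l e) →
      ∃ E' : Finset (Sym2 V), SmallDiam.IsSmallDiameterDecomposition G l E' ∧
        ∑ e ∈ E', c e ≤
          136 * Real.log ((r : ℝ) + 1) * SmallDiam.edgeSum G (fun e => c e * l e)) ∧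
    (∃ P : SmallDiam.Program,
      SmallDiam.SolvesInPolyTime SmallDiam.unitSize Set.univ P ∧
      SmallDiam.SolvesInPolyTime SmallDiam.bitSize {I | I.IsRational} P) := by
  -- The program is the compiled algorithm; `rfl` checks its well-typedness by evaluation.
  refine ⟨?_, _, SmallDiam.algorithm.solves rfl SmallDiam.algorithm_isSolution⟩
  rintro V _ G r c l ⟨m, D, hD⟩ hc hl
  obtain ⟨n, cl, h1, h2⟩ := SmallDiam.exists_cutCost_le D hc hl
  refine ⟨SmallDiam.cutEdges G cl, SmallDiam.isSmallDiameterDecomposition_cutEdges h1, ?_⟩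
  rw [SmallDiam.cutCost_eq] at h2
  have hT : 0 ≤ SmallDiam.edgeSum G fun e => c e * l e :=
    SmallDiam.edgeSum_nonneg fun e he => mul_nonneg (hc e he) (hl e he)
  -- The algorithm's bound uses the actual width, which may be smaller than `r`.
  have hlog : Real.log ((D.width : ℝ) + 1) ≤ Real.log ((r : ℝ) + 1) :=
    Real.log_le_log (by positivity) (by exact_mod_cast Nat.succ_le_succ hD)
  nlinarith [mul_le_mul_of_nonneg_right hlog hT]
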